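/- \textbf{Setting.} Let $\mathcal H_p=L^2(\mathbb R^3;\mathbb C)$, $p=-i\nabla$, $\langle y\rangle=(1+|y|^2)^{1/2}$, let $d\ge1$ be the number of photon polarisations, let $\mathcal F$ be the symmetric Fock space over $L^2(\mathbb R^3\times\{1,\dots,d\})$ with creation and annihilation operators $a^*(k),a(k)$ ($k$ including the polarisation, $\int dk$ including the sum over it) and $H_f=\int|k|\,a^*(k)a(k)\,dk$. On $\mathcal H_p\otimes\mathcal F$ put $$H_g=H_{0g}+I_g,\quad H_{0g}=H_{pg}\otimes 1+1\otimes H_f,\quad H_{pg}=-\kappa\Delta+V,\quad I_g=g\sum_{1\le m+n\le2}W_{m,n},$$ $$W_{m,n}=\int\prod_{j=1}^{m+n}\frac{dk_j}{|k_j|^{1/2}}\ \prod_{j=1}^m a^*(k_j)\;w_{m,n}[k_1,\dots,k_{m+n}]\prod_{j=m+1}^{m+n}a(k_j),$$ where $g>0$, $\kappa\in\mathbb C\setminus\{0\}$ with $\operatorname{Re}\kappa\ge0$, and for some $\mu\ge0$, $\delta_0>0$, $M$ (the class $GH_\mu$): (i) $\|V u\|\le\frac{|\kappa|}2\|\Delta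 u\|+\|u\|$ for $u\in D(\Delta)=H^2(\mathbb R^3)$; (ii) the coupling functions $w_{m,n}[k]$ are strongly measurable families of linear maps $H^{2-m-n}(\mathbb R^3)\to L^2(\mathbb R^3)$ with $$\sup_{|\delta|\le\delta_0}\ \operatorname*{ess\,sup}_{k}\ \Big\|\big[\min(\langle x\rangle^{m+n}\textstyle\prod_j|k_j|^{1/2},1)\big]^{-\mu}e^{-\delta\langle x\rangle}w_{m,n}[k]e^{\delta\langle x\rangle}\langle p\rangle^{-(2-m-n)}\Big\|\le M,$$ (more precisely, the essential supremum over $k$ of the supremum over $\delta$), and $$\int\prod_j(1+|k_j|^{-1})|k_j|^{-1}\,\|w_{m,n}[k]\langle p\rangle^{-(2-m-n)}\|^2\,dk\le M .$$ Let $\lambda_j$ be an isolated simple eigenvalue of $H_{pg}$ with eigenvector $\psi_j$ and (rank one) spectral projection $P=P_{pj}$: $P^2=P$ is bounded, $\operatorname{Ran}P=\mathbb C\psi_j$, $P$ commutes with $H_{pg}$, and $H_{pg}-\lambda_j$ is boundedly invertible on $\operatorname{Ran}\bar P$, $\bar P=1-P$. Let $$\delta_j=\operatorname{dist}\big(\lambda_j,\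 \sigma(H_{pg})\setminus\{\lambda_j\}+[0,\infty)\big)>0,$$ $$Q_j=\{\lambda\in\mathbb C:\ \operatorname{Re}(\lambda-\lambda_j)\le\tfrac13\delta_j,\ |\operatorname{Im}(\lambda-\lambda_j)|\le\tfrac13\delta_j\},$$ $$\kappa_j^{-1}=\sup_{0\le\delta\le\delta_0}\ \sup_{\lambda\in Q_j}\big\|e^{-\delta\langle x\rangle}(H_{pg}-\lambda)^{-1}\bar P\,e^{\delta\langle x\rangle}\big\| ,$$ and assume $|\lambda_j|,\delta_j,\|P\|\le M$. Let $\chi_1\in C^\infty(\mathbb R;[0,1])$ with $\chi_1(r)=1$ for $r\le 9/10$ and $\chi_1(r)=0$ for $r\ge1$, and for $\rho>0$ put $$\pi=P\otimes\chi_1(H_f/\rho),\quad \bar\pi=P\otimes\sqrt{1-\chi_1(H_f/\rho)^2}+\bar P\otimes1,\quad H_{\bar\pi}=H_{0g}+\bar\pi I_g\bar\pi .$$ If $H_{\bar\pi}-\lambda$ is boundedly invertible on the closed range of $\bar\pi$, put $$F_\pi(H_g-\lambda)=H_{0g}-\lambda+\pi I_g\pi-\pi I_g\bar\pi(H_{\bar\pi}-\lambda)^{-1}\bar\pi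 I_g\pi ,\qquad \mathcal R_{\rho j}(H_g-\lambda)=\rho^{-1}\,\Gamma_\rho F_\pi(H_g-\lambda)\Gamma_\rho^{-1},$$ where $\Gamma_\rho$ acts trivially on $\mathcal H_p$ and on $\mathcal F$ as the second quantization of $f(k)\mapsto\rho^{3/2}f(\rho k)$, so that $\Gamma_\rho a^{\#}(k)\Gamma_\rho^{-1}=\rho^{-3/2}a^{\#}(k/\rho)$. The operator $H_{\lambda j}$ on $\mathcal F$ is defined by $$\mathcal R_{\rho j}(H_g-\lambda)(\psi_j\otimes\Phi)=\psi_j\otimes H_{\lambda j}\Phi .$$ For an operator $A$, $\sigma(A)$ is the set of $z$ for which $A-z$ is not a bijection of $D(A)$ onto the space with bounded inverse, $\sigma_p(A)$ the set of eigenvalues, and $\sigma_{ess}(A)$ the set of $z$ for which $A-z$ is not Fredholm. \textbf{Statement.} Given $d,\kappa,\mu,\delta_0,M$ there is a constant $c>0$ such that, for all data as above, all $0<\rho\le\kappa_j$, all $0<g\le c\rho$ and all $\lambda\in Q_j$ with $\operatorname{Re}(\lambda-\lambda_j)\le\rho/2$, the operator $H_{\bar\pi}-\lambda$ is boundedly invertible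 on the closed range of $\bar\pi$ (so $H_{\lambda j}$ is well defined), and $$\lambda\in\sigma(H_g)\iff0\in\sigma(H_{\lambda j}),\qquad \lambda\in\sigma_p(H_g)\iff0\in\sigma_p(H_{\lambda j}),\qquad \lambda\in\sigma_{ess}(H_g)\iff0\in\sigma_{ess}(H_{\lambda j}).$$ -/

import Mathlib

noncomputable section

namespace ParticleField

open MeasureTheory
open scoped ENNReal FourierTransform

/-! ### Unbounded operators, their compositions and their spectra -/

section Operators

variable {H H' H'' : Type*} [NormedAddCommGroup H] [NormedSpace ℂ H]
  [NormedAddCommGroup H'] [NormedSpace ℂ H'] [NormedAddCommGroup H''] [NormedSpace ℂ H'']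

/-- The product `A B` of two partially defined operators, with its natural domain
`{u ∈ D(B) | B u ∈ D(A)}`. -/
def opComp (A : H' →ₗ.[ℂ] H'') (B : H →ₗ.[ℂ] H') : H →ₗ.[ℂ] H'' :=
  A.comp (B.domRestrict ((A.domain.comap B.toFun).map B.domain.subtype)) (by
    rintro ⟨u, hu⟩
    obtain ⟨hu1, hu2⟩ := Submodule.mem_inf.1 hu
    obtain ⟨y, hy, hyu⟩ := (Submodule.mem_map).1 hu1
    have hy' : B y ∈ A.domain := hy
    have hyu' : u = (y : H) := hyu.symm
    have h : B.domRestrict ((A.domain.comap B.toFun).map B.domain.subtype) ⟨u, hu⟩ = B y :=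
      LinearPMap.domRestrict_apply hyu'
    exact h ▸ hy')

/-- The operator `A - z` on the domain of `A`. -/
def shift (A : H →ₗ.[ℂ] H) (z : ℂ) : H →ₗ.[ℂ] H :=
  ⟨A.domain, A.toFun - z • A.domain.subtype⟩

/-- `A` maps `D(A) ∩ X` bijectively onto `X`, with a bounded inverse. -/
def BddInvertibleOn (A : H →ₗ.[ℂ] H) (X : Submodule ℂ H) : Prop :=
  (∀ u : A.domain, (u : H) ∈ X → A u ∈ X) ∧
  (∀ f ∈ X, ∃ u : A.domain, (u : H) ∈ X ∧ A u = f) ∧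
  ∃ C : ℝ, ∀ u : A.domain, (u : H) ∈ X → ‖(u : H)‖ ≤ C * ‖A u‖

/-- The spectrum: `A - z` is not a bijection `D(A) → H` with bounded inverse. -/
def opSpectrum (A : H →ₗ.[ℂ] H) : Set ℂ := {z | ¬ BddInvertibleOn (shift A z) ⊤}

/-- The point spectrum, i.e. the set of eigenvalues. -/
def pointSpectrum (A : H →ₗ.[ℂ] H) : Set ℂ :=
  {z | ∃ u : A.domain, (u : H) ≠ 0 ∧ A u = z • (u : H)}

/-- Fredholm operators: finite-dimensional kernel, closed range of finite codimension. -/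
def IsFredholm (A : H →ₗ.[ℂ] H) : Prop :=
  FiniteDimensional ℂ (LinearMap.ker A.toFun) ∧
  IsClosed (LinearMap.range A.toFun : Set H) ∧
  FiniteDimensional ℂ (H ⧸ LinearMap.range A.toFun)

/-- The essential spectrum: `A - z` is not Fredholm. -/
def essSpectrum (A : H →ₗ.[ℂ] H) : Set ℂ := {z | ¬ IsFredholm (shift A z)}

end Operators

/-! ### The particle space `L²(ℝ³)` -/

/-- Positions and wave vectors. -/
abbrev Pos : Type := EuclideanSpace ℝ (Fin 3)

/-- The particle Hilbert space `L²(ℝ³; ℂ)`. -/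
abbrev Particle : Type := Lp ℂ 2 (volume : Measure Pos)

/-- `⟨y⟩ = (1 + |y|²)^{1/2}`. -/
def japanese (y : Pos) : ℝ := Real.sqrt (1 + ‖y‖ ^ 2)

/-- The momentum representation of `⟨p⟩^s u`, where `p = -i∇`. With Mathlib's normalisation
`(𝓕 u)(ξ) = ∫ e^{-2πi x·ξ} u(x) dx`, the operator `p` is multiplication by `2πξ`. -/
def momentumWeight (s : ℝ) (u : Particle) : Pos → ℂ :=
  fun ξ => ((japanese ((2 * Real.pi) • ξ) ^ s : ℝ) : ℂ) * (𝓕 u : Particle) ξ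

/-- The norm `‖⟨p⟩^s u‖`, with values in `[0, ∞]`. -/
def sobolevENorm (s : ℝ) (u : Particle) : ℝ≥0∞ := eLpNorm (momentumWeight s u) 2 volume

/-- The Sobolev space `H^s(ℝ³)`, `s ≥ 0`, i.e. the domain of `⟨p⟩^s`. -/
def sobolev (s : ℝ) : Submodule ℂ Particle where
  carrier := {u | MemLp (momentumWeight s u) 2 volume}
  zero_mem' := by
    have h : momentumWeight s 0 =ᵐ[volume] 0 := by
      have h0 : (𝓕 (0 : Particle) : Particle) = 0 := map_zero (Lp.fourierTransformₗᵢ Pos ℂ)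
      filter_upwards [Lp.coeFn_zero ℂ 2 (volume : Measure Pos)] with ξ hξ
      simp [momentumWeight, h0]
    exact (memLp_congr_ae h).2 MemLp.zero
  add_mem' := by
    intro u v hu hv
    have h : momentumWeight s (u + v) =ᵐ[volume] momentumWeight s u + momentumWeight s v := by
      have h0 : (𝓕 (u + v) : Particle) = 𝓕 u + 𝓕 v := map_add (Lp.fourierTransformₗᵢ Pos ℂ) u v
      filter_upwards [Lp.coeFn_add (𝓕 u : Particle) (𝓕 v : Particle)] with ξ hξ
      simp only [momentumWeight, h0, Pi.add_apply]
      rw [hξ, Pi.add_apply, mul_add]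
    exact (memLp_congr_ae h).2 (MemLp.add hu hv)
  smul_mem' := by
    intro c u hu
    have h : momentumWeight s (c • u) =ᵐ[volume] c • momentumWeight s u := by
      have h0 : (𝓕 (c • u) : Particle) = c • 𝓕 u := map_smul (Lp.fourierTransformₗᵢ Pos ℂ) c u
      filter_upwards [Lp.coeFn_smul c (𝓕 u : Particle)] with ξ hξ
      simp only [momentumWeight, h0, Pi.smul_apply]
      rw [hξ, Pi.smul_apply, smul_eq_mul, smul_eq_mul, mul_left_comm]
    exact (memLp_congr_ae h).2 (MemLp.const_smul hu c)

/-- Multiplication by the function `V` on its maximal domain. -/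
def mulOp (V : Pos → ℂ) : Particle →ₗ.[ℂ] Particle :=
  Submodule.toLinearPMap
    { carrier := {p : Particle × Particle | ∀ᵐ x, p.2 x = V x * p.1 x}
      zero_mem' := by
        filter_upwards [Lp.coeFn_zero ℂ 2 (volume : Measure Pos)] with x hx
        simp
      add_mem' := by
        rintro ⟨u, v⟩ ⟨u', v'⟩ h h'
        change ∀ᵐ x, (v + v' : Particle) x = V x * (u + u' : Particle) x
        filter_upwards [Lp.coeFn_add u u', Lp.coeFn_add v v', h, h'] with x h1 h2 h3 h4
        rw [h1, h2, Pi.add_apply, Pi.add_apply, h3, h4, mul_add]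
      smul_mem' := by
        rintro c ⟨u, v⟩ h
        change ∀ᵐ x, (c • v : Particle) x = V x * (c • u : Particle) x
        filter_upwards [Lp.coeFn_smul c u, Lp.coeFn_smul c v, h] with x h1 h2 h3
        rw [h1, h2, Pi.smul_apply, Pi.smul_apply, h3, smul_eq_mul, smul_eq_mul, mul_left_comm] }

/-- The Laplacian on `L²(ℝ³)`, with domain `H²(ℝ³)`: in the momentum representation it is
multiplication by `-|2πξ|²`. -/
def laplacianOp : Particle →ₗ.[ℂ] Particle :=
  opComp ((Lp.fourierTransformₗᵢ Pos ℂ).symm.toLinearEquiv.toLinearMap.toPMap ⊤)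
    (opComp (mulOp fun ξ => -(((2 * Real.pi) ^ 2 * ‖ξ‖ ^ 2 : ℝ) : ℂ))
      ((Lp.fourierTransformₗᵢ Pos ℂ).toLinearEquiv.toLinearMap.toPMap ⊤))

/-- The particle Hamiltonian `-κ Δ + V`. -/
def particleHam (κ : ℂ) (V : Pos → ℂ) : Particle →ₗ.[ℂ] Particle :=
  (-κ) • laplacianOp + mulOp V

/-- The relative bound `‖V u‖ ≤ (|κ|/2) ‖Δ u‖ + ‖u‖` for all `u ∈ D(Δ)`. -/
def PotentialBound (κ : ℂ) (V : Pos → ℂ) : Prop :=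
  ∀ u : laplacianOp.domain, ∃ v : (mulOp V).domain, (v : Particle) = u ∧
    ‖mulOp V v‖ ≤ ‖κ‖ / 2 * ‖laplacianOp u‖ + ‖(u : Particle)‖

/-! ### The Fock space

`Fock d E` is the tensor product of the Hilbert space `E` with the symmetric Fock space over
`L²(ℝ³ × {1, …, d})`, realised as the space of sequences `(Ψ_n)` of symmetric square integrable
functions of `n` photon variables with values in `E`. The number `d` of polarisations is `1` for
scalar bosons and `2` for photons. -/

/-- One-photon variables: a wave vector and a polarisation. -/
abbrev Photon (d : ℕ) : Type := Pos × Fin d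

/-- Lebesgue measure in the wave vector, counting measure in the polarisation. -/
def photonMeasure (d : ℕ) : Measure (Photon d) := (volume : Measure Pos).prod Measure.count

instance instSigmaFinitePhotonMeasure (d : ℕ) : SigmaFinite (photonMeasure d) := by
  unfold photonMeasure; infer_instance

/-- The product measure for `n` photons. -/
def photonMeasureN (d n : ℕ) : Measure (Fin n → Photon d) := Measure.pi fun _ => photonMeasure d

instance instSigmaFinitePhotonMeasureN (d n : ℕ) : SigmaFinite (photonMeasureN d n) := by
  unfold photonMeasureN; infer_instance

theorem quasiMeasurePreserving_perm (d : ℕ) {n : ℕ} (σ : Equiv.Perm (Fin n)) :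
    Measure.QuasiMeasurePreserving (fun k : Fin n → Photon d => k ∘ σ)
      (photonMeasureN d n) (photonMeasureN d n) := by
  have h := measurePreserving_piCongrLeft (fun _ : Fin n => photonMeasure d) σ.symm
  have h' : (fun k : Fin n → Photon d => k ∘ σ) =
      MeasurableEquiv.piCongrLeft (fun _ : Fin n => Photon d) σ.symm := by
    funext k i
    rw [MeasurableEquiv.coe_piCongrLeft]
    have := Equiv.piCongrLeft_apply (P := fun _ : Fin n => Photon d) σ.symm k i
    simpa using this.symm
  rw [h']
  exact h.quasiMeasurePreserving

theorem ae_append (d : ℕ) {n l : ℕ} {p : (Fin (n + l) → Photon d) → Prop}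
    (h : ∀ᵐ k ∂photonMeasureN d (n + l), p k) :
    ∀ᵐ r ∂photonMeasureN d l, ∀ᵐ q ∂photonMeasureN d n, p (Fin.append q r) := by
  have h1 := measurePreserving_sumPiEquivProdPi_symm
    (X := fun _ : Fin n ⊕ Fin l => Photon d) (fun _ => photonMeasure d)
  have h2 := measurePreserving_piCongrLeft (fun _ : Fin (n + l) => photonMeasure d)
    (finSumFinEquiv (m := n) (n := l))
  have h3 := (h2.comp h1).quasiMeasurePreserving.ae h
  have h4 : ∀ z : (Fin n → Photon d) × (Fin l → Photon d),
      (MeasurableEquiv.piCongrLeft (fun _ : Fin (n + l) => Photon d)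
        (finSumFinEquiv (m := n) (n := l)))
        ((MeasurableEquiv.sumPiEquivProdPi fun _ : Fin n ⊕ Fin l => Photon d).symm z)
        = Fin.append z.1 z.2 := by
    rintro ⟨q, r⟩
    funext i
    rw [MeasurableEquiv.coe_piCongrLeft]
    refine Fin.addCases (fun j => ?_) (fun j => ?_) i
    · have := Equiv.piCongrLeft_apply_apply (P := fun _ : Fin (n + l) => Photon d)
        (finSumFinEquiv (m := n) (n := l))
        ((MeasurableEquiv.sumPiEquivProdPi fun _ : Fin n ⊕ Fin l => Photon d).symm (q, r))
        (Sum.inl j)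
      simpa [MeasurableEquiv.sumPiEquivProdPi, Equiv.sumPiEquivProdPi] using this
    · have := Equiv.piCongrLeft_apply_apply (P := fun _ : Fin (n + l) => Photon d)
        (finSumFinEquiv (m := n) (n := l))
        ((MeasurableEquiv.sumPiEquivProdPi fun _ : Fin n ⊕ Fin l => Photon d).symm (q, r))
        (Sum.inr j)
      simpa [MeasurableEquiv.sumPiEquivProdPi, Equiv.sumPiEquivProdPi] using this
  have h5 : ∀ᵐ z ∂(photonMeasureN d n).prod (photonMeasureN d l), p (Fin.append z.1 z.2) := by
    refine Filter.Eventually.mono h3 fun z hz => ?_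
    rw [← h4 z]
    exact hz
  have h6 := (Measure.measurePreserving_swap
    (μ := photonMeasureN d l) (ν := photonMeasureN d n)).quasiMeasurePreserving.ae h5
  exact Measure.ae_ae_of_ae_prod h6

theorem quasiMeasurePreserving_tail (d m l : ℕ) :
    Measure.QuasiMeasurePreserving (fun k : Fin (m + l) → Photon d => k ∘ Fin.natAdd m)
      (photonMeasureN d (m + l)) (photonMeasureN d l) := by
  refine ⟨by fun_prop, ?_⟩
  refine Measure.AbsolutelyContinuous.mk fun s hs h0 => ?_
  rw [Measure.map_apply (by fun_prop) hs]
  have h1 := measurePreserving_sumPiEquivProdPi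
    (X := fun _ : Fin m ⊕ Fin l => Photon d) (fun _ => photonMeasure d)
  have h2 := measurePreserving_piCongrLeft (fun _ : Fin (m + l) => photonMeasure d)
    (finSumFinEquiv (m := m) (n := l))
  have h3 := (h1.comp h2.symm).quasiMeasurePreserving
  have h4 : Measure.QuasiMeasurePreserving Prod.snd
      ((photonMeasureN d m).prod (photonMeasureN d l)) (photonMeasureN d l) :=
    Measure.quasiMeasurePreserving_snd
  have h5 : Measure.pi (fun _ : Fin (m + l) => photonMeasure d) _ = 0 :=
    (h4.comp h3).preimage_null h0
  exact h5

theorem ae_tail (d m : ℕ) {n l : ℕ} {p : (Fin (n + l) → Photon d) → Prop}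
    (h : ∀ᵐ k ∂photonMeasureN d (n + l), p k) :
    ∀ᵐ k ∂photonMeasureN d (m + l), ∀ σ : Equiv.Perm (Fin (m + l)),
      ∀ᵐ q ∂photonMeasureN d n, p (Fin.append q ((k ∘ σ) ∘ Fin.natAdd m)) := by
  rw [Filter.eventually_all]
  intro σ
  exact (quasiMeasurePreserving_perm d σ).ae ((quasiMeasurePreserving_tail d m l).ae (ae_append d h))

section Fock

variable (d : ℕ) (E : Type*) [NormedAddCommGroup E] [NormedSpace ℂ E]

/-- The Fock space with values in `E`. -/
def Fock : Submodule ℂ (lp (fun n : ℕ => Lp E 2 (photonMeasureN d n)) 2) where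
  carrier := {Ψ | ∀ (n : ℕ) (σ : Equiv.Perm (Fin n)),
    ∀ᵐ k ∂photonMeasureN d n, (Ψ n) (k ∘ σ) = (Ψ n) k}
  zero_mem' := by
    intro n σ
    have h := Lp.coeFn_zero E 2 (photonMeasureN d n)
    filter_upwards [h, (quasiMeasurePreserving_perm d σ).ae h] with k h1 h2
    simp only [lp.coeFn_zero, Pi.zero_apply]
    rw [h1, h2]; rfl
  add_mem' := by
    intro Ψ Φ hΨ hΦ n σ
    have h := Lp.coeFn_add (Ψ n) (Φ n)
    filter_upwards [h, (quasiMeasurePreserving_perm d σ).ae h, hΨ n σ, hΦ n σ] with k h1 h2 h3 h4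
    simp only [lp.coeFn_add, Pi.add_apply] at *
    rw [h1, h2, h3, h4]
  smul_mem' := by
    intro c Ψ hΨ n σ
    have h := Lp.coeFn_smul c (Ψ n)
    filter_upwards [h, (quasiMeasurePreserving_perm d σ).ae h, hΨ n σ] with k h1 h2 h3
    simp only [lp.coeFn_smul, Pi.smul_apply] at *
    rw [h1, h2, h3]

variable {d E}

/-- The `n`-photon component of a Fock space vector, as a function. -/
def sector (Ψ : Fock d E) (n : ℕ) : (Fin n → Photon d) → E :=
  (((Ψ : lp (fun n : ℕ => Lp E 2 (photonMeasureN d n)) 2) n : Lp E 2 (photonMeasureN d n)) :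
    (Fin n → Photon d) → E)

theorem sector_zero (n : ℕ) :
    ∀ᵐ k ∂photonMeasureN d n, sector (0 : Fock d E) n k = 0 := by
  filter_upwards [Lp.coeFn_zero E 2 (photonMeasureN d n)] with k hk
  simpa [sector] using hk

theorem sector_add (Ψ Φ : Fock d E) (n : ℕ) :
    ∀ᵐ k ∂photonMeasureN d n, sector (Ψ + Φ) n k = sector Ψ n k + sector Φ n k := by
  filter_upwards [Lp.coeFn_add ((Ψ : lp (fun n : ℕ => Lp E 2 (photonMeasureN d n)) 2) n)
    ((Φ : lp (fun n : ℕ => Lp E 2 (photonMeasureN d n)) 2) n)] with k hk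
  simpa [sector] using hk

theorem sector_smul (c : ℂ) (Ψ : Fock d E) (n : ℕ) :
    ∀ᵐ k ∂photonMeasureN d n, sector (c • Ψ) n k = c • sector Ψ n k := by
  filter_upwards [Lp.coeFn_smul c ((Ψ : lp (fun n : ℕ => Lp E 2 (photonMeasureN d n)) 2) n)]
    with k hk
  simpa [sector] using hk

/-- A vector of the Fock space whose components vanish almost everywhere is zero. -/
theorem fock_eq_zero {Ψ : Fock d E} (h : ∀ n, ∀ᵐ k ∂photonMeasureN d n, sector Ψ n k = 0) :
    Ψ = 0 := by
  apply Subtype.ext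
  apply lp.ext
  funext n
  apply Lp.ext
  filter_upwards [h n, Lp.coeFn_zero E 2 (photonMeasureN d n)] with k h1 h2
  have h1' : ((Ψ : lp (fun n : ℕ => Lp E 2 (photonMeasureN d n)) 2) n) k = 0 := h1
  rw [h1']
  simpa using h2.symm

variable {E' : Type*} [NormedAddCommGroup E'] [NormedSpace ℂ E']

/-- The decomposable operator that acts on the value `Ψ_n(k)` by the operator `a n k`, on its
maximal domain. -/
def decomposable (a : ∀ n, (Fin n → Photon d) → (E →ₗ.[ℂ] E')) : Fock d E →ₗ.[ℂ] Fock d E' :=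
  Submodule.toLinearPMap
    { carrier := {p : Fock d E × Fock d E' | ∀ n, ∀ᵐ k ∂photonMeasureN d n,
        (sector p.1 n k, sector p.2 n k) ∈ (a n k).graph}
      zero_mem' := by
        intro n
        filter_upwards [sector_zero (d := d) (E := E) n, sector_zero (d := d) (E := E') n]
          with k h1 h2
        simp only [Prod.fst_zero, Prod.snd_zero]
        rw [h1, h2]
        exact (a n k).graph.zero_mem
      add_mem' := by
        rintro ⟨u, v⟩ ⟨u', v'⟩ h h' n
        filter_upwards [sector_add u u' n, sector_add v v' n, h n, h' n] with k h1 h2 h3 h4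
        simp only [Prod.mk_add_mk]
        rw [h1, h2]
        exact (a n k).graph.add_mem h3 h4
      smul_mem' := by
        rintro c ⟨u, v⟩ h n
        filter_upwards [sector_smul c u n, sector_smul c v n, h n] with k h1 h2 h3
        simp only [Prod.smul_mk]
        rw [h1, h2]
        exact (a n k).graph.smul_mem c h3 }

/-- The energy `|k₁| + … + |k_n|` of `n` free photons. -/
def photonEnergy {n : ℕ} (k : Fin n → Photon d) : ℝ := ∑ j, ‖(k j).1‖

variable (d E) in
/-- The field Hamiltonian `1 ⊗ H_f`. -/
def fieldHam : Fock d E →ₗ.[ℂ] Fock d E :=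
  decomposable fun _ k => (((photonEnergy k : ℝ) : ℂ) • LinearMap.id).toPMap ⊤

variable (d) in
/-- The free Hamiltonian `A ⊗ 1 + 1 ⊗ H_f`, with domain `D(A ⊗ 1) ∩ D(1 ⊗ H_f)`. -/
def freeHam (A : E →ₗ.[ℂ] E) : Fock d E →ₗ.[ℂ] Fock d E :=
  decomposable (fun _ _ => A) + fieldHam d E

/-- The one-photon dilation `(y, ι) ↦ (e^{-θ} y, ι)` of the wave vector. -/
def photonScale (θ : ℝ) (k : Photon d) : Photon d := (Real.exp (-θ) • k.1, k.2)

theorem measurePreserving_photonScale (d : ℕ) (θ : ℝ) : ∃ c : NNReal,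
    MeasurePreserving (photonScale (d := d) θ) (photonMeasure d) (c • photonMeasure d) := by
  refine ⟨Real.toNNReal |(Real.exp (-θ) ^ Module.finrank ℝ Pos)⁻¹|, ?_, ?_⟩
  · unfold photonScale; fun_prop
  · have h : (photonScale (d := d) θ) = Prod.map (fun y : Pos => Real.exp (-θ) • y) id := rfl
    rw [h, photonMeasure, ← Measure.map_prod_map _ _ (by fun_prop) measurable_id, Measure.map_id,
      Measure.map_addHaar_smul _ (Real.exp_pos _).ne', Measure.prod_smul_left]
    rfl

theorem quasiMeasurePreserving_photonScale (d n : ℕ) (θ : ℝ) :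
    Measure.QuasiMeasurePreserving (fun (k : Fin n → Photon d) j => photonScale θ (k j))
      (photonMeasureN d n) (photonMeasureN d n) := by
  obtain ⟨c, h⟩ := measurePreserving_photonScale d θ
  have h1 := measurePreserving_pi (fun _ : Fin n => photonMeasure d)
    (fun _ : Fin n => c • photonMeasure d) (fun _ => h)
  have h2 : Measure.pi (fun _ : Fin n => c • photonMeasure d) = c ^ n • photonMeasureN d n := by
    refine Measure.pi_eq fun s _ => ?_
    have h3 : ∀ (ν : Measure (Photon d)) (t : Set (Photon d)), (c • ν) t = (c : ℝ≥0∞) * ν t :=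
      fun _ _ => rfl
    have h4 : (c ^ n • photonMeasureN d n) (Set.univ.pi s) =
        ((c ^ n : NNReal) : ℝ≥0∞) * photonMeasureN d n (Set.univ.pi s) := rfl
    rw [h4]
    simp only [h3, photonMeasureN, Measure.pi_pi, Finset.prod_mul_distrib, Finset.prod_const,
      Finset.card_univ, Fintype.card_fin, ENNReal.coe_pow]
  refine ⟨h1.measurable, ?_⟩
  change Measure.map _ (Measure.pi fun _ : Fin n => photonMeasure d) ≪ _
  rw [h1.map_eq, h2]
  exact Measure.smul_absolutelyContinuous

variable (d E) in
/-- The photon dilation `U_{f θ}`, the second quantization of `f(k) ↦ e^{-3θ/2} f(e^{-θ} k)`. -/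
def photonDilation (θ : ℝ) : Fock d E →ₗ.[ℂ] Fock d E :=
  Submodule.toLinearPMap
    { carrier := {p : Fock d E × Fock d E | ∀ n, ∀ᵐ k ∂photonMeasureN d n,
        sector p.2 n k = ((Real.exp (-(3 * θ / 2)) ^ n : ℝ) : ℂ) •
          sector p.1 n (fun j => photonScale θ (k j))}
      zero_mem' := by
        intro n
        filter_upwards [sector_zero (d := d) (E := E) n,
          (quasiMeasurePreserving_photonScale d n θ).ae (sector_zero (d := d) (E := E) n)]
          with k h1 h2
        simp only [Prod.fst_zero, Prod.snd_zero]
        rw [h1, h2, smul_zero]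
      add_mem' := by
        rintro ⟨u, v⟩ ⟨u', v'⟩ h h' n
        filter_upwards [sector_add v v' n,
          (quasiMeasurePreserving_photonScale d n θ).ae (sector_add u u' n), h n, h' n]
          with k h1 h2 h3 h4
        simp only [Prod.mk_add_mk] at *
        rw [h1, h2, h3, h4, smul_add]
      smul_mem' := by
        rintro c ⟨u, v⟩ h n
        filter_upwards [sector_smul c v n,
          (quasiMeasurePreserving_photonScale d n θ).ae (sector_smul c u n), h n]
          with k h1 h2 h3
        simp only [Prod.smul_mk] at *
        rw [h1, h2, h3, smul_comm] }

end Fock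

/-! ### The interaction -/

/-- The value of a partially defined operator, extended by zero. -/
def valueOrZero {H H' : Type*} [AddCommGroup H] [Module ℂ H] [AddCommGroup H'] [Module ℂ H']
    (A : H →ₗ.[ℂ] H') (u : H) : H' :=
  open scoped Classical in if h : u ∈ A.domain then A ⟨u, h⟩ else 0

section ValueOrZero

variable {H H' : Type*} [AddCommGroup H] [Module ℂ H] [AddCommGroup H'] [Module ℂ H']
  (A : H →ₗ.[ℂ] H')

theorem valueOrZero_of_mem {u : H} (hu : u ∈ A.domain) : valueOrZero A u = A ⟨u, hu⟩ :=
  dif_pos hu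

theorem valueOrZero_zero : valueOrZero A 0 = 0 := by
  rw [valueOrZero_of_mem A A.domain.zero_mem]
  exact A.map_zero

theorem valueOrZero_add {u v : H} (hu : u ∈ A.domain) (hv : v ∈ A.domain) :
    valueOrZero A (u + v) = valueOrZero A u + valueOrZero A v := by
  rw [valueOrZero_of_mem A hu, valueOrZero_of_mem A hv,
    valueOrZero_of_mem A (A.domain.add_mem hu hv)]
  exact A.map_add ⟨u, hu⟩ ⟨v, hv⟩

theorem valueOrZero_smul (c : ℂ) {u : H} (hu : u ∈ A.domain) :
    valueOrZero A (c • u) = c • valueOrZero A u := by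
  rw [valueOrZero_of_mem A hu, valueOrZero_of_mem A (A.domain.smul_mem c hu)]
  exact A.map_smul c ⟨u, hu⟩

end ValueOrZero

/-- Coupling functions `w_{m,n}[k₁, …, k_m, q₁, …, q_n]`, with values in the linear maps
`H^{2-m-n}(ℝ³) → L²(ℝ³)`. -/
abbrev Coupling (d m n : ℕ) : Type :=
  (Fin m → Photon d) → (Fin n → Photon d) → (sobolev (2 - m - n : ℝ) →ₗ[ℂ] Particle)

section Interaction

variable {d m n : ℕ}

/-- `w[k, q]` as a partially defined operator on the particle space. -/
def couplingOp (w : Coupling d m n) (k : Fin m → Photon d) (q : Fin n → Photon d) :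
    Particle →ₗ.[ℂ] Particle :=
  ⟨sobolev (2 - m - n : ℝ), w k q⟩

/-- `∏ |k_j|^{-1/2}`. -/
def photonFactor {n : ℕ} (k : Fin n → Photon d) : ℝ := ∏ j, ‖(k j).1‖ ^ (-(1 / 2 : ℝ))

/-- The integrand of the annihilation part of `W_{m,n}`:
`∏|q_j|^{-1/2} w[k, q] Ψ_{n+l}(q, r)`. -/
def annihilated (w : Coupling d m n) (Ψ : Fock d Particle) {l : ℕ} (k : Fin m → Photon d)
    (r : Fin l → Photon d) (q : Fin n → Photon d) : Particle :=
  ((photonFactor q : ℝ) : ℂ) •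
    valueOrZero (couplingOp w k q) (sector Ψ (n + l) (Fin.append q r))

/-- `Ψ_{n+l}` takes values in the domain of the coupling function, and the annihilation integral
is absolutely convergent. -/
def Annihilable (w : Coupling d m n) (Ψ : Fock d Particle) {l : ℕ} (k : Fin m → Photon d)
    (r : Fin l → Photon d) : Prop :=
  (∀ᵐ q ∂photonMeasureN d n,
    sector Ψ (n + l) (Fin.append q r) ∈ sobolev (2 - m - n : ℝ)) ∧
  Integrable (annihilated w Ψ k r) (photonMeasureN d n)

/-- The `(m+l)`-photon component of `W_{m,n} Ψ`: with
`(a(q₁) ⋯ a(q_n) Ψ)_l (r) = ((l+n)!/l!)^{1/2} Ψ_{n+l}(q, r)` and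
`a*(k₁) ⋯ a*(k_m)` acting as `((l+m)!/l!)^{1/2}` times symmetrisation. -/
def interactionValue (w : Coupling d m n) (Ψ : Fock d Particle) (l : ℕ)
    (k : Fin (m + l) → Photon d) : Particle :=
  ((Real.sqrt ((l + m).factorial / l.factorial) * Real.sqrt ((l + n).factorial / l.factorial) /
      (l + m).factorial : ℝ) : ℂ) •
    ∑ σ : Equiv.Perm (Fin (m + l)),
      ((photonFactor ((k ∘ σ) ∘ Fin.castAdd l) : ℝ) : ℂ) •
        ∫ q, annihilated w Ψ ((k ∘ σ) ∘ Fin.castAdd l) ((k ∘ σ) ∘ Fin.natAdd m) q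
          ∂photonMeasureN d n

theorem annihilated_zero (w : Coupling d m n) {l : ℕ} :
    ∀ᵐ k ∂photonMeasureN d (m + l), ∀ σ : Equiv.Perm (Fin (m + l)),
      Annihilable w 0 ((k ∘ σ) ∘ Fin.castAdd l) ((k ∘ σ) ∘ Fin.natAdd m) ∧
      annihilated w 0 ((k ∘ σ) ∘ Fin.castAdd l) ((k ∘ σ) ∘ Fin.natAdd m)
        =ᵐ[photonMeasureN d n] 0 := by
  filter_upwards [ae_tail d m (sector_zero (d := d) (E := Particle) (n + l))] with k hk σ
  have h3 : annihilated w 0 ((k ∘ σ) ∘ Fin.castAdd l) ((k ∘ σ) ∘ Fin.natAdd m)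
        =ᵐ[photonMeasureN d n] 0 := by
    filter_upwards [hk σ] with q hq
    simp only [annihilated]
    rw [hq, valueOrZero_zero, smul_zero, Pi.zero_apply]
  refine ⟨⟨?_, (integrable_congr h3).2 (integrable_zero _ _ _)⟩, h3⟩
  filter_upwards [hk σ] with q hq
  rw [hq]
  exact Submodule.zero_mem _

theorem annihilated_add (w : Coupling d m n) (Ψ Φ : Fock d Particle) {l : ℕ} :
    ∀ᵐ k ∂photonMeasureN d (m + l), ∀ σ : Equiv.Perm (Fin (m + l)),
      Annihilable w Ψ ((k ∘ σ) ∘ Fin.castAdd l) ((k ∘ σ) ∘ Fin.natAdd m) →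
      Annihilable w Φ ((k ∘ σ) ∘ Fin.castAdd l) ((k ∘ σ) ∘ Fin.natAdd m) →
      Annihilable w (Ψ + Φ) ((k ∘ σ) ∘ Fin.castAdd l) ((k ∘ σ) ∘ Fin.natAdd m) ∧
      annihilated w (Ψ + Φ) ((k ∘ σ) ∘ Fin.castAdd l) ((k ∘ σ) ∘ Fin.natAdd m)
        =ᵐ[photonMeasureN d n]
      annihilated w Ψ ((k ∘ σ) ∘ Fin.castAdd l) ((k ∘ σ) ∘ Fin.natAdd m) +
      annihilated w Φ ((k ∘ σ) ∘ Fin.castAdd l) ((k ∘ σ) ∘ Fin.natAdd m) := by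
  filter_upwards [ae_tail d m (sector_add Ψ Φ (n + l))] with k hk σ h1 h2
  have h3 : annihilated w (Ψ + Φ) ((k ∘ σ) ∘ Fin.castAdd l) ((k ∘ σ) ∘ Fin.natAdd m)
        =ᵐ[photonMeasureN d n]
      annihilated w Ψ ((k ∘ σ) ∘ Fin.castAdd l) ((k ∘ σ) ∘ Fin.natAdd m) +
      annihilated w Φ ((k ∘ σ) ∘ Fin.castAdd l) ((k ∘ σ) ∘ Fin.natAdd m) := by
    filter_upwards [hk σ, h1.1, h2.1] with q hq hq1 hq2
    simp only [annihilated, Pi.add_apply]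
    rw [hq, valueOrZero_add _ hq1 hq2, smul_add]
  refine ⟨⟨?_, (integrable_congr h3).2 (h1.2.add h2.2)⟩, h3⟩
  filter_upwards [hk σ, h1.1, h2.1] with q hq hq1 hq2
  rw [hq]
  exact Submodule.add_mem _ hq1 hq2

theorem annihilated_smul (w : Coupling d m n) (c : ℂ) (Ψ : Fock d Particle) {l : ℕ} :
    ∀ᵐ k ∂photonMeasureN d (m + l), ∀ σ : Equiv.Perm (Fin (m + l)),
      Annihilable w Ψ ((k ∘ σ) ∘ Fin.castAdd l) ((k ∘ σ) ∘ Fin.natAdd m) →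
      Annihilable w (c • Ψ) ((k ∘ σ) ∘ Fin.castAdd l) ((k ∘ σ) ∘ Fin.natAdd m) ∧
      annihilated w (c • Ψ) ((k ∘ σ) ∘ Fin.castAdd l) ((k ∘ σ) ∘ Fin.natAdd m)
        =ᵐ[photonMeasureN d n]
      c • annihilated w Ψ ((k ∘ σ) ∘ Fin.castAdd l) ((k ∘ σ) ∘ Fin.natAdd m) := by
  filter_upwards [ae_tail d m (sector_smul c Ψ (n + l))] with k hk σ h1
  have h3 : annihilated w (c • Ψ) ((k ∘ σ) ∘ Fin.castAdd l) ((k ∘ σ) ∘ Fin.natAdd m)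
        =ᵐ[photonMeasureN d n]
      c • annihilated w Ψ ((k ∘ σ) ∘ Fin.castAdd l) ((k ∘ σ) ∘ Fin.natAdd m) := by
    filter_upwards [hk σ, h1.1] with q hq hq1
    simp only [annihilated, Pi.smul_apply]
    rw [hq, valueOrZero_smul _ c hq1, smul_comm]
  refine ⟨⟨?_, (integrable_congr h3).2 (h1.2.smul c)⟩, h3⟩
  filter_upwards [hk σ, h1.1] with q hq hq1
  rw [hq]
  exact Submodule.smul_mem _ c hq1

theorem interactionValue_zero (w : Coupling d m n) (l : ℕ) :
    ∀ᵐ k ∂photonMeasureN d (m + l), interactionValue w 0 l k = 0 := by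
  filter_upwards [annihilated_zero (l := l) w] with k hk
  simp only [interactionValue]
  rw [Finset.sum_eq_zero, smul_zero]
  intro σ _
  rw [integral_congr_ae (hk σ).2, integral_zero', smul_zero]

/-- `v = W_{m,n} u`. -/
def InteractionRel (w : Coupling d m n) (u v : Fock d Particle) : Prop :=
  (∀ l, ∀ᵐ k ∂photonMeasureN d (m + l),
    (∀ σ : Equiv.Perm (Fin (m + l)),
      Annihilable w u ((k ∘ σ) ∘ Fin.castAdd l) ((k ∘ σ) ∘ Fin.natAdd m)) ∧
    sector v (m + l) k = interactionValue w u l k) ∧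
  ∀ N < m, ∀ᵐ k ∂photonMeasureN d N, sector v N k = 0

theorem interactionRel_zero (w : Coupling d m n) : InteractionRel w 0 0 := by
  refine ⟨fun l => ?_, fun N _ => sector_zero N⟩
  filter_upwards [annihilated_zero (l := l) w, interactionValue_zero w l,
    sector_zero (d := d) (E := Particle) (m + l)] with k h1 h2 h3
  exact ⟨fun σ => (h1 σ).1, h3.trans h2.symm⟩

theorem interactionRel_add {w : Coupling d m n} {u v u' v' : Fock d Particle}
    (h : InteractionRel w u v) (h' : InteractionRel w u' v') :
    InteractionRel w (u + u') (v + v') := by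
  refine ⟨fun l => ?_, fun N hlt => ?_⟩
  · filter_upwards [annihilated_add w u u', sector_add v v' (m + l), h.1 l, h'.1 l]
      with k h1 h2 h3 h4
    refine ⟨fun σ => (h1 σ (h3.1 σ) (h4.1 σ)).1, ?_⟩
    rw [h2, h3.2, h4.2]
    simp only [interactionValue]
    rw [← smul_add, ← Finset.sum_add_distrib]
    congr 1
    refine Finset.sum_congr rfl fun σ _ => ?_
    rw [integral_congr_ae (h1 σ (h3.1 σ) (h4.1 σ)).2,
      integral_add' (h3.1 σ).2 (h4.1 σ).2, smul_add]
  · filter_upwards [sector_add v v' N, h.2 N hlt, h'.2 N hlt] with k h1 h2 h3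
    rw [h1, h2, h3, add_zero]

theorem interactionRel_smul {w : Coupling d m n} {u v : Fock d Particle} (c : ℂ)
    (h : InteractionRel w u v) : InteractionRel w (c • u) (c • v) := by
  refine ⟨fun l => ?_, fun N hlt => ?_⟩
  · filter_upwards [annihilated_smul w c u, sector_smul c v (m + l), h.1 l] with k h1 h2 h3
    refine ⟨fun σ => (h1 σ (h3.1 σ)).1, ?_⟩
    rw [h2, h3.2]
    simp only [interactionValue]
    rw [smul_comm c, Finset.smul_sum]
    congr 1
    refine Finset.sum_congr rfl fun σ _ => ?_
    rw [integral_congr_ae (h1 σ (h3.1 σ)).2, smul_comm c]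
    congr 1
    exact (integral_smul c _).symm
  · filter_upwards [sector_smul c v N, h.2 N hlt] with k h1 h2
    rw [h1, h2, smul_zero]

/-- The operator
`W_{m,n} = ∫ ∏ dk_j |k_j|^{-1/2} a*(k₁) ⋯ a*(k_m) w[k₁, …, k_{m+n}] a(k_{m+1}) ⋯ a(k_{m+n})`
on its maximal domain. -/
def interactionTerm (w : Coupling d m n) : Fock d Particle →ₗ.[ℂ] Fock d Particle :=
  Submodule.toLinearPMap
    { carrier := {p : Fock d Particle × Fock d Particle | InteractionRel w p.1 p.2}
      zero_mem' := interactionRel_zero w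
      add_mem' := fun h h' => interactionRel_add h h'
      smul_mem' := fun c _ h => interactionRel_smul c h }

/-- The weighted operator norm of `w[k, q]`: the supremum over `|δ| ≤ δ₀` of the norm of
`[min(⟨x⟩^{m+n} ∏|k_j|^{1/2}, 1)]^{-μ} e^{-δ⟨x⟩} w[k, q] e^{δ⟨x⟩} ⟨p⟩^{-(2-m-n)}`. -/
def weightedNorm (μ δ₀ : ℝ) (w : Coupling d m n) (k : Fin m → Photon d) (q : Fin n → Photon d) :
    ℝ≥0∞ :=
  ⨆ (δ : ℝ) (_ : |δ| ≤ δ₀) (u : sobolev (2 - m - n : ℝ)) (v : sobolev (2 - m - n : ℝ))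
    (_ : ∀ᵐ x, (v : Particle) x = (Real.exp (δ * japanese x) : ℂ) * (u : Particle) x),
    eLpNorm (fun x => ((min (japanese x ^ (m + n) * (∏ j, ‖(k j).1‖ ^ (1 / 2 : ℝ)) *
        ∏ j, ‖(q j).1‖ ^ (1 / 2 : ℝ)) 1 ^ (-μ) * Real.exp (-(δ * japanese x)) : ℝ) : ℂ) *
        (w k q v) x) 2 volume
      / sobolevENorm (2 - m - n) u

/-- The norm `‖w‖^{(0)}_μ`, the (essential) supremum over the photon variables. -/
def couplingNorm (μ δ₀ : ℝ) (w : Coupling d m n) : ℝ≥0∞ :=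
  essSup (fun z : (Fin m → Photon d) × (Fin n → Photon d) => weightedNorm μ δ₀ w z.1 z.2)
    ((photonMeasureN d m).prod (photonMeasureN d n))

/-- The norm of `w[k, q] ⟨p⟩^{-(2-m-n)}`. -/
def plainNorm (w : Coupling d m n) (k : Fin m → Photon d) (q : Fin n → Photon d) : ℝ≥0∞ :=
  ⨆ u : sobolev (2 - m - n : ℝ), ‖w k q u‖ₑ / sobolevENorm (2 - m - n) u

/-- `∫ ∏_j (1 + |k_j|^{-1}) |k_j|^{-1} ‖w[k] ⟨p⟩^{-(2-m-n)}‖² dk`. -/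
def ultravioletIntegral (w : Coupling d m n) : ℝ≥0∞ :=
  ∫⁻ z : (Fin m → Photon d) × (Fin n → Photon d),
    ENNReal.ofReal ((∏ j, (1 + ‖(z.1 j).1‖⁻¹) * ‖(z.1 j).1‖⁻¹) *
        ∏ j, (1 + ‖(z.2 j).1‖⁻¹) * ‖(z.2 j).1‖⁻¹) * plainNorm w z.1 z.2 ^ 2
    ∂((photonMeasureN d m).prod (photonMeasureN d n))

/-- The conditions on a single coupling function: strong measurability, and the bound `M` on the
norm `‖w‖^{(0)}_μ` and on the ultraviolet integral. -/
def CouplingBound (μ δ₀ M : ℝ) (w : Coupling d m n) : Prop :=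
  (∀ u : sobolev (2 - m - n : ℝ), AEStronglyMeasurable
    (fun z : (Fin m → Photon d) × (Fin n → Photon d) => w z.1 z.2 u)
    ((photonMeasureN d m).prod (photonMeasureN d n))) ∧
  couplingNorm μ δ₀ w ≤ ENNReal.ofReal M ∧ ultravioletIntegral w ≤ ENNReal.ofReal M

end Interaction

section Hamiltonians

variable {d : ℕ}

/-- `I_g = g ∑_{1 ≤ m+n ≤ 2} W_{m,n}`. -/
def interaction (g : ℝ) (w : ∀ m n, Coupling d m n) : Fock d Particle →ₗ.[ℂ] Fock d Particle :=
  (g : ℂ) • (interactionTerm (w 1 0) + interactionTerm (w 0 1) + interactionTerm (w 2 0) +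
    interactionTerm (w 1 1) + interactionTerm (w 0 2))

/-- `H_{0g} = H_{pg} + H_f` with `H_{pg} = -κ Δ + V`. -/
def unperturbedHam (d : ℕ) (κ : ℂ) (V : Pos → ℂ) : Fock d Particle →ₗ.[ℂ] Fock d Particle :=
  freeHam d (particleHam κ V)

/-- The Hamiltonian `H_g = H_{0g} + I_g`. -/
def hamiltonian (κ : ℂ) (V : Pos → ℂ) (g : ℝ) (w : ∀ m n, Coupling d m n) :
    Fock d Particle →ₗ.[ℂ] Fock d Particle :=
  unperturbedHam d κ V + interaction g w

/-- `H_g = H_{0g} + I_g` is a generalized particle-field Hamiltonian of class `GH_μ`, with all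
bounds on the coupling functions given by `M`. -/
def IsGH (μ δ₀ M : ℝ) (κ : ℂ) (V : Pos → ℂ) (w : ∀ m n, Coupling d m n) : Prop :=
  PotentialBound κ V ∧ ∀ m n, 1 ≤ m + n → m + n ≤ 2 → CouplingBound μ δ₀ M (w m n)

end Hamiltonians

/-! ### The particle eigenvalue `λ_j` -/

section Eigenvalue

variable {E : Type*} [NormedAddCommGroup E] [NormedSpace ℂ E]

/-- `z` is an isolated simple eigenvalue of `A` with eigenvector `ψ` and `P` is the corresponding
(rank one) spectral projection: a bounded projection onto `ℂ ψ` that commutes with `A` and such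
that `A - z` is boundedly invertible on the complement `ker P = Ran (1 - P)`. -/
def IsSimpleSpectralProjection (A : E →ₗ.[ℂ] E) (z : ℂ) (P : E →L[ℂ] E) (ψ : E) : Prop :=
  P ∘L P = P ∧ ψ ≠ 0 ∧ LinearMap.range (P : E →ₗ[ℂ] E) = Submodule.span ℂ {ψ} ∧
  (∃ h : ψ ∈ A.domain, A ⟨ψ, h⟩ = z • ψ) ∧
  (∀ u : A.domain, ∃ h : P u ∈ A.domain, A ⟨P u, h⟩ = P (A u)) ∧
  BddInvertibleOn (shift A z) (LinearMap.ker (P : E →ₗ[ℂ] E))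

/-- `δ_j = dist(λ_j, σ(A) ∖ {λ_j} + [0, ∞))`. -/
def gap (A : E →ₗ.[ℂ] E) (z : ℂ) : ℝ :=
  Metric.infDist z {y | ∃ ν ∈ opSpectrum A \ {z}, ∃ t : ℝ, 0 ≤ t ∧ y = ν + t}

/-- The set `Q_j = {λ | Re (λ - λ_j) ≤ δ_j/3, |Im (λ - λ_j)| ≤ δ_j/3}`. -/
def regionQ (A : E →ₗ.[ℂ] E) (z : ℂ) : Set ℂ :=
  {ζ | (ζ - z).re ≤ gap A z / 3 ∧ |(ζ - z).im| ≤ gap A z / 3}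

/-- `K` bounds the norms of
`(A^δ - λ)^{-1} (1 - P^δ) = e^{-δ⟨x⟩} (A - λ)^{-1} (1 - P) e^{δ⟨x⟩}` for all `0 ≤ δ ≤ δ₀` and
`λ ∈ Q_j`. Here `u = (A - λ)^{-1} (1 - P) f` and `f` runs through the `L²`-functions of the form
`e^{δ⟨x⟩} h`, `h ∈ L²`. -/
def IsReducedResolventBound (A : Particle →ₗ.[ℂ] Particle) (z : ℂ)
    (P : Particle →L[ℂ] Particle) (δ₀ : ℝ) (K : ℝ≥0∞) : Prop :=
  ∀ δ : ℝ, 0 ≤ δ → δ ≤ δ₀ → ∀ ζ ∈ regionQ A z, ∀ (u : A.domain) (f : Particle),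
    P u = 0 → A u - ζ • (u : Particle) = f - P f →
    eLpNorm (fun x => (Real.exp (-(δ * japanese x)) : ℂ) * (u : Particle) x) 2 volume ≤
      K * eLpNorm (fun x => (Real.exp (-(δ * japanese x)) : ℂ) * f x) 2 volume

/-- The parameter `κ_j`: its inverse is the supremum of the norms of
`(A^δ - λ)^{-1} (1 - P^δ)` over `0 ≤ δ ≤ δ₀` and `λ ∈ Q_j`. -/
def kappaParam (A : Particle →ₗ.[ℂ] Particle) (z : ℂ) (P : Particle →L[ℂ] Particle) (δ₀ : ℝ) :
    ℝ≥0∞ :=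
  (sInf {K | IsReducedResolventBound A z P δ₀ K})⁻¹

end Eigenvalue

/-! ### The Feshbach-Schur map and the operators `H_{λj}` -/

/-- Smooth cut-off functions `χ₁`. -/
def IsCutoff (χ : ℝ → ℝ) : Prop :=
  ContDiff ℝ (⊤ : ℕ∞) χ ∧ (∀ r, 0 ≤ χ r ∧ χ r ≤ 1) ∧ (∀ r ≤ 9 / 10, χ r = 1) ∧ ∀ r ≥ 1, χ r = 0

section Feshbach

variable {d : ℕ}

/-- `π = P ⊗ χ₁(H_f/ρ)`. -/
def feshPi (d : ℕ) (P : Particle →L[ℂ] Particle) (χ : ℝ → ℝ) (ρ : ℝ) :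
    Fock d Particle →ₗ.[ℂ] Fock d Particle :=
  decomposable fun _ k =>
    (((χ (photonEnergy k / ρ) : ℝ) : ℂ) • (P : Particle →ₗ[ℂ] Particle)).toPMap ⊤

/-- `π̄ = P ⊗ (1 - χ₁(H_f/ρ)²)^{1/2} + (1 - P) ⊗ 1`, so that `π² + π̄² = 1`. -/
def feshPiBar (d : ℕ) (P : Particle →L[ℂ] Particle) (χ : ℝ → ℝ) (ρ : ℝ) :
    Fock d Particle →ₗ.[ℂ] Fock d Particle :=
  decomposable fun _ k =>
    (((Real.sqrt (1 - χ (photonEnergy k / ρ) ^ 2) : ℝ) : ℂ) • (P : Particle →ₗ[ℂ] Particle) +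
      (LinearMap.id - (P : Particle →ₗ[ℂ] Particle))).toPMap ⊤

/-- The closure of the range of `π̄`. -/
def feshRange (d : ℕ) (P : Particle →L[ℂ] Particle) (χ : ℝ → ℝ) (ρ : ℝ) :
    Submodule ℂ (Fock d Particle) :=
  (LinearMap.range (feshPiBar d P χ ρ).toFun).topologicalClosure

/-- `H_{π̄} = H₀ + π̄ I π̄`. -/
def feshBarHam (H₀ I : Fock d Particle →ₗ.[ℂ] Fock d Particle) (P : Particle →L[ℂ] Particle)
    (χ : ℝ → ℝ) (ρ : ℝ) : Fock d Particle →ₗ.[ℂ] Fock d Particle :=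
  H₀ + opComp (feshPiBar d P χ ρ) (opComp I (feshPiBar d P χ ρ))

/-- `H₀ + I - λ` lies in the domain of the Feshbach-Schur map: `H_{π̄} - λ` is boundedly
invertible on `Ran π̄`. -/
def InFeshDomain (H₀ I : Fock d Particle →ₗ.[ℂ] Fock d Particle) (P : Particle →L[ℂ] Particle)
    (χ : ℝ → ℝ) (ρ : ℝ) (ζ : ℂ) : Prop :=
  BddInvertibleOn (shift (feshBarHam H₀ I P χ ρ) ζ) (feshRange d P χ ρ)

/-- The inverse of `H_{π̄} - λ` on `Ran π̄`. -/
def feshInv (H₀ I : Fock d Particle →ₗ.[ℂ] Fock d Particle) (P : Particle →L[ℂ] Particle)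
    (χ : ℝ → ℝ) (ρ : ℝ) (ζ : ℂ) : Fock d Particle →ₗ.[ℂ] Fock d Particle :=
  ((shift (feshBarHam H₀ I P χ ρ) ζ).domRestrict (feshRange d P χ ρ)).inverse

/-- The smooth Feshbach-Schur map
`F_π(H - λ) = H₀ - λ + π I π - π I π̄ (H_{π̄} - λ)^{-1} π̄ I π`, where `H = H₀ + I`. -/
def feshbachMap (H₀ I : Fock d Particle →ₗ.[ℂ] Fock d Particle) (P : Particle →L[ℂ] Particle)
    (χ : ℝ → ℝ) (ρ : ℝ) (ζ : ℂ) : Fock d Particle →ₗ.[ℂ] Fock d Particle :=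
  shift H₀ ζ + opComp (feshPi d P χ ρ) (opComp I (feshPi d P χ ρ)) -
    opComp (feshPi d P χ ρ) (opComp I (opComp (feshPiBar d P χ ρ)
      (opComp (feshInv H₀ I P χ ρ ζ) (opComp (feshPiBar d P χ ρ) (opComp I (feshPi d P χ ρ))))))

/-- The scaling transformation `S_ρ(A) = Γ_ρ A Γ_ρ^{-1}` with `Γ_ρ = U_f(-ln ρ)`. It acts trivially
on the particle variables, and `S_ρ(a^#(k)) = ρ^{-3/2} a^#(k/ρ)`. -/
def scaling (ρ : ℝ) (A : Fock d Particle →ₗ.[ℂ] Fock d Particle) :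
    Fock d Particle →ₗ.[ℂ] Fock d Particle :=
  opComp (photonDilation d Particle (-Real.log ρ))
    (opComp A (photonDilation d Particle (-Real.log ρ)).inverse)

/-- The renormalization map `R_{ρj} = ρ^{-1} S_ρ ∘ F_π`. -/
def renormMap (H₀ I : Fock d Particle →ₗ.[ℂ] Fock d Particle) (P : Particle →L[ℂ] Particle)
    (χ : ℝ → ℝ) (ρ : ℝ) (ζ : ℂ) : Fock d Particle →ₗ.[ℂ] Fock d Particle :=
  ((ρ⁻¹ : ℝ) : ℂ) • scaling ρ (feshbachMap H₀ I P χ ρ ζ)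

/-- The embedding `Φ ↦ ψ ⊗ Φ` of the scalar Fock space. -/
def tensorLeft (d : ℕ) (ψ : Particle) : Fock d ℂ →ₗ.[ℂ] Fock d Particle :=
  decomposable fun _ _ => (LinearMap.toSpanSingleton ℂ Particle ψ).toPMap ⊤

/-- The operator `H_{λj}` on the scalar Fock space, defined by
`R_{ρj}(H - λ) (ψ ⊗ Φ) = ψ ⊗ H_{λj} Φ`, i.e. `R_{ρj}(H - λ)` restricted to `Ran (P ⊗ 1)` equals
`P ⊗ H_{λj}`, where `ψ` spans `Ran P`. -/
def effectiveHam (H₀ I : Fock d Particle →ₗ.[ℂ] Fock d Particle) (P : Particle →L[ℂ] Particle)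
    (ψ : Particle) (χ : ℝ → ℝ) (ρ : ℝ) (ζ : ℂ) : Fock d ℂ →ₗ.[ℂ] Fock d ℂ :=
  opComp (tensorLeft d ψ).inverse (opComp (renormMap H₀ I P χ ρ ζ) (tensorLeft d ψ))

end Feshbach

end ParticleField

end

noncomputable section

namespace ParticleField

open MeasureTheory
open scoped ENNReal NNReal FourierTransform

/-! ### Graphs of partially defined operators -/

section Graphs

variable {H H' H'' : Type*} [NormedAddCommGroup H] [NormedSpace ℂ H]
  [NormedAddCommGroup H'] [NormedSpace ℂ H'] [NormedAddCommGroup H''] [NormedSpace ℂ H'']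

/-! The theorem is the isospectrality of the smooth Feshbach-Schur map, made quantitative in `g` and
`ρ`.

Invertibility. On `Ran π̄` the free operator `H_{0g} - λ` has an inverse of size `O(1/ρ)`. In the
fibre with photon energy `r` it is `H_{pg} - (λ - r)`. On `Ran P̄` the definition of `κ_j` bounds
the inverse, because `Q_j` is stable under `λ ↦ λ - r`. On `Ran P` the cutoff leaves only `r >
9ρ/10`, while `Re (λ - λ_j) ≤ ρ/2`. The term `W_{m,n}` is bounded relative to `⟨p⟩^{2-m-n} (1 +
H_f)^{(m+n)/2}`, hence `I_g` relative to `H_{0g}`. So `I_g (H_{0g} - λ)⁻¹` on `Ran π̄` is `O(g/ρ)`,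
and for `g ≤ cρ` a Neumann series inverts `H_π̄ - λ`.

Reduction to bounded operators. Let `G = (H_{0g} - z)⁻¹` with `z = λ_j - 1`. On the common domain
`Ran G` one has `H_{0g} - λ = τ G⁻¹` and `I_g = W G⁻¹`, where `τ = 1 + (z - λ) G` and `W` are
bounded. Since `π` and `π̄` commute with `G`, the operators `H_g - λ` and `F_π` become the bounded
operators `τ + W` and `feshF`. Spectrum, eigenvalues and the Fredholm property can be read off from
these (`mem_opSpectrum_iff_of_graph` and its companions). Domains are handled throughout by graphs
(`IsRepresented`).

Algebra. Identities in a noncommutative ring (`FeshbachData`) show that the two-term complexes given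
by `τ + W` and by the compression of `feshF` to `Ran (P ⊗ 1)` are homotopy equivalent
(`HomotopyRetract` in both directions). A homotopy equivalence transports injectivity, surjectivity,
finite-dimensional kernel and cokernel, and closedness of the range. The dilation and the factor
`ρ⁻¹` only change the maps of the equivalence.

The analytic input is `lintegral_createdVal_sq_le` for the field, `particleHam_estimate` for the
particle, and their combination in `exists_fibre_bound` and `diagOp_interaction_bound`. It is
assembled in `exists_isRepresented`. The spectral conclusion is `spectra_iff_of_feshbach`. -/

theorem mem_graph_opComp {A : H' →ₗ.[ℂ] H''} {B : H →ₗ.[ℂ] H'} {u : H} {v : H''} :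
    (u, v) ∈ (opComp A B).graph ↔ ∃ y, (u, y) ∈ B.graph ∧ (y, v) ∈ A.graph := by
  constructor
  · intro h
    obtain ⟨⟨u', hu'⟩, rfl, rfl⟩ := (LinearPMap.mem_graph_iff _).1 h
    obtain ⟨hu1, hu2⟩ := Submodule.mem_inf.1 hu'
    obtain ⟨y, hy, hyu⟩ := (Submodule.mem_map).1 hu1
    have hyu' : u' = (y : H) := hyu.symm
    refine ⟨B y, ?_, ?_⟩
    · simp only
      rw [hyu']
      exact B.mem_graph y
    · have hm : u' ∈ ((A.domain.comap B.toFun).map B.domain.subtype) ⊓ B.domain := hu'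
      have h1 : B.domRestrict ((A.domain.comap B.toFun).map B.domain.subtype) ⟨u', hm⟩ = B y :=
        LinearPMap.domRestrict_apply hyu'
      refine (LinearPMap.mem_graph_iff _).2 ⟨⟨B y, hy⟩, rfl, ?_⟩
      change _ = A ⟨_, _⟩
      congr 1
      exact Subtype.ext h1.symm
  · rintro ⟨y, h1, h2⟩
    obtain ⟨a, ha1, ha2⟩ := (LinearPMap.mem_graph_iff _).1 h1
    obtain ⟨b, hb1, hb2⟩ := (LinearPMap.mem_graph_iff _).1 h2
    simp only at ha1 ha2 hb1 hb2
    subst ha1 ha2 hb2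
    have hab : B a ∈ A.domain := hb1 ▸ b.2
    have hmem : (a : H) ∈ ((A.domain.comap B.toFun).map B.domain.subtype) ⊓ B.domain :=
      ⟨⟨a, hab, rfl⟩, a.2⟩
    refine (LinearPMap.mem_graph_iff _).2 ⟨⟨(a : H), hmem⟩, rfl, ?_⟩
    have h1 : B.domRestrict ((A.domain.comap B.toFun).map B.domain.subtype) ⟨(a : H), hmem⟩ =
        B a := LinearPMap.domRestrict_apply rfl
    change A ⟨_, _⟩ = A b
    congr 1
    exact Subtype.ext (h1.trans hb1.symm)

theorem mem_graph_iff_exists {A : H →ₗ.[ℂ] H'} {u : H} {v : H'} :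
    (u, v) ∈ A.graph ↔ ∃ h : u ∈ A.domain, A ⟨u, h⟩ = v := by
  rw [LinearPMap.mem_graph_iff]
  constructor
  · rintro ⟨⟨y, hy⟩, rfl, rfl⟩
    exact ⟨hy, rfl⟩
  · rintro ⟨h, rfl⟩
    exact ⟨⟨u, h⟩, rfl, rfl⟩

theorem mem_graph_shift {A : H →ₗ.[ℂ] H} {z : ℂ} {u v : H} :
    (u, v) ∈ (shift A z).graph ↔ (u, v + z • u) ∈ A.graph := by
  rw [mem_graph_iff_exists, mem_graph_iff_exists]
  refine exists_congr fun h => ?_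
  change A ⟨u, h⟩ - z • u = v ↔ _
  rw [sub_eq_iff_eq_add]

theorem mem_graph_add {A B : H →ₗ.[ℂ] H'} {u : H} {v : H'} :
    (u, v) ∈ (A + B).graph ↔ ∃ a b, (u, a) ∈ A.graph ∧ (u, b) ∈ B.graph ∧ v = a + b := by
  rw [mem_graph_iff_exists]
  constructor
  · rintro ⟨h, rfl⟩
    exact ⟨_, _, A.mem_graph ⟨u, h.1⟩, B.mem_graph ⟨u, h.2⟩, rfl⟩
  · rintro ⟨a, b, ha, hb, rfl⟩
    obtain ⟨h1, rfl⟩ := mem_graph_iff_exists.1 ha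
    obtain ⟨h2, rfl⟩ := mem_graph_iff_exists.1 hb
    exact ⟨⟨h1, h2⟩, rfl⟩

theorem mem_graph_sub {A B : H →ₗ.[ℂ] H'} {u : H} {v : H'} :
    (u, v) ∈ (A - B).graph ↔ ∃ a b, (u, a) ∈ A.graph ∧ (u, b) ∈ B.graph ∧ v = a - b := by
  rw [mem_graph_iff_exists]
  constructor
  · rintro ⟨h, rfl⟩
    exact ⟨_, _, A.mem_graph ⟨u, h.1⟩, B.mem_graph ⟨u, h.2⟩, rfl⟩
  · rintro ⟨a, b, ha, hb, rfl⟩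
    obtain ⟨h1, rfl⟩ := mem_graph_iff_exists.1 ha
    obtain ⟨h2, rfl⟩ := mem_graph_iff_exists.1 hb
    exact ⟨⟨h1, h2⟩, rfl⟩

theorem mem_graph_smul {A : H →ₗ.[ℂ] H'} {c : ℂ} {u : H} {v : H'} :
    (u, v) ∈ (c • A).graph ↔ ∃ a, (u, a) ∈ A.graph ∧ v = c • a := by
  rw [mem_graph_iff_exists]
  constructor
  · rintro ⟨h, rfl⟩
    exact ⟨_, A.mem_graph ⟨u, h⟩, rfl⟩
  · rintro ⟨a, ha, rfl⟩
    obtain ⟨h1, rfl⟩ := mem_graph_iff_exists.1 ha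
    exact ⟨h1, rfl⟩

theorem mem_graph_toPMap_top {A : H →ₗ[ℂ] H'} {u : H} {v : H'} :
    (u, v) ∈ (A.toPMap ⊤).graph ↔ v = A u := by
  rw [mem_graph_iff_exists]
  exact ⟨fun ⟨_, h⟩ => h.symm, fun h => ⟨trivial, h.symm⟩⟩

/-- The trivial kernel makes the swapped graph functional; only then does `LinearPMap.inverse` have
that graph. -/
theorem mem_graph_inverse {A : H →ₗ.[ℂ] H'} (hA : LinearMap.ker A.toFun = ⊥) {u : H} {v : H'} :
    (v, u) ∈ A.inverse.graph ↔ (u, v) ∈ A.graph := by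
  rw [LinearPMap.inverse_graph hA]
  simp only [Submodule.mem_map]
  constructor
  · rintro ⟨⟨a, b⟩, hab, h⟩
    simp only [LinearEquiv.coe_coe, LinearEquiv.prodComm_apply, Prod.swap_prod_mk,
      Prod.mk.injEq] at h
    obtain ⟨rfl, rfl⟩ := h
    exact hab
  · intro h
    exact ⟨(u, v), h, rfl⟩

theorem ker_eq_bot_of_graph {A : H →ₗ.[ℂ] H'} (h : ∀ u, (u, (0 : H')) ∈ A.graph → u = 0) :
    LinearMap.ker A.toFun = ⊥ := by
  rw [LinearMap.ker_eq_bot']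
  intro u hu
  exact Subtype.ext (h u (mem_graph_iff_exists.2 ⟨u.2, hu⟩))

theorem mem_graph_domRestrict {A : H →ₗ.[ℂ] H'} {S : Submodule ℂ H} {u : H} {v : H'} :
    (u, v) ∈ (A.domRestrict S).graph ↔ u ∈ S ∧ (u, v) ∈ A.graph := by
  rw [mem_graph_iff_exists, mem_graph_iff_exists]
  constructor
  · rintro ⟨⟨h1, h2⟩, rfl⟩
    exact ⟨h1, h2, (LinearPMap.domRestrict_apply (x := ⟨u, ⟨h1, h2⟩⟩) (y := ⟨u, h2⟩) rfl).symm⟩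
  · rintro ⟨h1, h2, rfl⟩
    exact ⟨⟨h1, h2⟩, LinearPMap.domRestrict_apply (x := ⟨u, ⟨h1, h2⟩⟩) (y := ⟨u, h2⟩) rfl⟩

theorem mem_graph_toLinearPMap {g : Submodule ℂ (H × H')} (hg : ∀ v, ((0 : H), v) ∈ g → v = 0)
    {u : H} {v : H'} : (u, v) ∈ g.toLinearPMap.graph ↔ (u, v) ∈ g := by
  rw [Submodule.toLinearPMap_graph_eq]
  rintro ⟨a, b⟩ hab h
  simp only at h
  subst h
  exact hg b hab

/-- An operator that is bounded after composition with `G` defines a bounded operator. -/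
theorem exists_clm_of_graph (A : H' →ₗ.[ℂ] H'') (G : H →L[ℂ] H') (C : ℝ)
    (h : ∀ f, ∃ v, (G f, v) ∈ A.graph ∧ ‖v‖ ≤ C * ‖f‖) :
    ∃ W : H →L[ℂ] H'', ∀ f, (G f, W f) ∈ A.graph := by
  choose W hW hb using h
  refine ⟨LinearMap.mkContinuous
    { toFun := W
      map_add' := fun f g => ?_
      map_smul' := fun c f => ?_ } C hb, hW⟩
  -- The chosen values are automatically linear, because a graph determines the second component
  -- from the first.
  · refine LinearPMap.mem_graph_snd_inj A (hW (f + g)) ?_ rfl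
    have := A.graph.add_mem (hW f) (hW g)
    simpa using this
  · refine LinearPMap.mem_graph_snd_inj A (hW (c • f)) ?_ rfl
    have := A.graph.smul_mem c (hW f)
    simpa using this

end Graphs

/-! ### Homotopy equivalent operators -/

section Homotopy

variable {H X : Type*} [NormedAddCommGroup H] [NormedSpace ℂ H] [NormedAddCommGroup X]
  [NormedSpace ℂ X]

/-- One half of a homotopy equivalence between the two-term complexes `A : H → H` and
`B : X → X`. -/
structure HomotopyRetract (A : H →L[ℂ] H) (B : X →L[ℂ] X) where
  /-- the map of the sources, from `B` to `A` -/
  Q : X →L[ℂ] H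
  /-- the map of the targets, from `B` to `A` -/
  Q' : X →L[ℂ] H
  /-- the map of the sources, from `A` to `B` -/
  L : H →L[ℂ] X
  /-- the map of the targets, from `A` to `B` -/
  L' : H →L[ℂ] X
  /-- the homotopy -/
  k : H →L[ℂ] H
  comm : ∀ x, A (Q x) = Q' (B x)
  comm' : ∀ u, B (L u) = L' (A u)
  left : ∀ u, u - Q (L u) = k (A u)
  right : ∀ f, f - Q' (L' f) = A (k f)

variable {A : H →L[ℂ] H} {B : X →L[ℂ] X}

/-- If `A u = 0` then `L u ∈ ker B = 0`, and the left homotopy identity leaves `u = k (A u) = 0`. -/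
theorem HomotopyRetract.injective (h : HomotopyRetract A B) (hB : Function.Injective B) :
    Function.Injective A := by
  rw [injective_iff_map_eq_zero] at hB ⊢
  intro u hu
  have h1 : h.L u = 0 := hB _ (by rw [h.comm', hu, map_zero])
  have h2 := h.left u
  rwa [h1, hu, map_zero, map_zero, sub_zero] at h2

/-- If `B x = L' f`, the right homotopy identity exhibits `Q x + k f` as a preimage of `f`. -/
theorem HomotopyRetract.mem_range (h : HomotopyRetract A B) {f : H}
    (hf : h.L' f ∈ LinearMap.range (B : X →ₗ[ℂ] X)) : f ∈ LinearMap.range (A : H →ₗ[ℂ] H) := by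
  obtain ⟨x, hx⟩ := hf
  refine ⟨h.Q x + h.k f, ?_⟩
  have h1 := h.right f
  simp only [ContinuousLinearMap.coe_coe] at hx ⊢
  rw [map_add, h.comm, hx, ← h1]
  abel

theorem HomotopyRetract.mem_range_iff (h : HomotopyRetract A B) {f : H} :
    f ∈ LinearMap.range (A : H →ₗ[ℂ] H) ↔ h.L' f ∈ LinearMap.range (B : X →ₗ[ℂ] X) := by
  refine ⟨?_, h.mem_range⟩
  rintro ⟨u, rfl⟩
  exact ⟨h.L u, h.comm' u⟩

theorem HomotopyRetract.surjective (h : HomotopyRetract A B) (hB : Function.Surjective B) :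
    Function.Surjective A := fun f => h.mem_range (f := f) (hB _)

/-- Fredholm operators, for bounded operators. -/
def IsFredholmCLM (A : H →L[ℂ] H) : Prop :=
  FiniteDimensional ℂ (LinearMap.ker (A : H →ₗ[ℂ] H)) ∧
  IsClosed (LinearMap.range (A : H →ₗ[ℂ] H) : Set H) ∧
  FiniteDimensional ℂ (H ⧸ LinearMap.range (A : H →ₗ[ℂ] H))

/-- `L` embeds `ker A` into `ker B`. The range of `A` is the preimage of the range of `B` under the
continuous map `L'`, so closedness pulls back and `L'` induces an injection of cokernels. -/
theorem HomotopyRetract.isFredholmCLM (h : HomotopyRetract A B) (hB : IsFredholmCLM B) :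
    IsFredholmCLM A := by
  obtain ⟨h1, h2, h3⟩ := hB
  refine ⟨?_, ?_, ?_⟩
  · have hmaps : ∀ u ∈ LinearMap.ker (A : H →ₗ[ℂ] H),
        (h.L : H →ₗ[ℂ] X) u ∈ LinearMap.ker (B : X →ₗ[ℂ] X) := by
      intro u hu
      have hu' : A u = 0 := hu
      change B (h.L u) = 0
      rw [h.comm', hu', map_zero]
    refine FiniteDimensional.of_injective ((h.L : H →ₗ[ℂ] X).restrict hmaps) ?_
    rw [injective_iff_map_eq_zero]
    rintro ⟨u, hu⟩ hu2
    have hu' : A u = 0 := hu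
    have hu3 : h.L u = 0 := congrArg Subtype.val hu2
    have h4 := h.left u
    rw [hu', hu3, map_zero, map_zero, sub_zero] at h4
    exact Subtype.ext h4
  · have : (LinearMap.range (A : H →ₗ[ℂ] H) : Set H) =
        h.L' ⁻¹' (LinearMap.range (B : X →ₗ[ℂ] X) : Set X) := by
      ext f
      exact h.mem_range_iff
    rw [this]
    exact h2.preimage h.L'.continuous
  · have hle : LinearMap.range (A : H →ₗ[ℂ] H) ≤
        (LinearMap.range (B : X →ₗ[ℂ] X)).comap (h.L' : H →ₗ[ℂ] X) :=
      fun f hf => h.mem_range_iff.1 hf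
    refine FiniteDimensional.of_injective (Submodule.mapQ _ _ (h.L' : H →ₗ[ℂ] X) hle) ?_
    rw [← LinearMap.ker_eq_bot, Submodule.ker_mapQ, eq_bot_iff]
    rintro _ ⟨f, hf, rfl⟩
    exact (Submodule.Quotient.mk_eq_zero _).2 (h.mem_range hf)

end Homotopy

/-! ### Spectra in terms of bounded operators -/

section Parametrization

variable {H : Type*} [NormedAddCommGroup H] [NormedSpace ℂ H]
  {A : H →ₗ.[ℂ] H} {z : ℂ} {G B : H →L[ℂ] H}

/-- `G` parametrises the domain, so `A - z` is `B G⁻¹`. When `B` is bijective, the open mapping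
theorem bounds `B⁻¹`, and `G B⁻¹` is then the bounded inverse of `A - z`. -/
theorem mem_opSpectrum_iff_of_graph [CompleteSpace H] (hG : Function.Injective G)
    (h : ∀ u v, (u, v) ∈ (shift A z).graph ↔ ∃ f, u = G f ∧ v = B f) :
    z ∈ opSpectrum A ↔ ¬ (Function.Injective B ∧ Function.Surjective B) := by
  refine not_congr ⟨?_, ?_⟩
  · rintro ⟨-, h2, C, h3⟩
    constructor
    · rw [injective_iff_map_eq_zero]
      intro f hf
      obtain ⟨hu, hu2⟩ := mem_graph_iff_exists.1 ((h (G f) 0).2 ⟨f, rfl, hf.symm⟩)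
      have h4 := h3 ⟨G f, hu⟩ trivial
      rw [hu2, norm_zero, mul_zero] at h4
      exact hG ((norm_le_zero_iff.1 h4).trans (map_zero G).symm)
    · intro f
      obtain ⟨u, -, hu⟩ := h2 f trivial
      obtain ⟨e, -, he⟩ := (h _ _).1 ((shift A z).mem_graph u)
      exact ⟨e, he.symm.trans hu⟩
  · rintro ⟨h1, h2⟩
    let e := ContinuousLinearEquiv.ofBijective B (LinearMap.ker_eq_bot.2 h1)
      (LinearMap.range_eq_top.2 h2)
    refine ⟨fun _ _ => trivial, fun f _ => ?_, ‖G‖ * ‖(e.symm : H →L[ℂ] H)‖, fun u _ => ?_⟩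
    · obtain ⟨x, rfl⟩ := h2 f
      obtain ⟨hu, hu2⟩ := mem_graph_iff_exists.1 ((h (G x) (B x)).2 ⟨x, rfl, rfl⟩)
      exact ⟨⟨G x, hu⟩, trivial, hu2⟩
    · obtain ⟨x, hx, hx2⟩ := (h _ _).1 ((shift A z).mem_graph u)
      rw [hx, hx2]
      have hxe : x = (e.symm : H →L[ℂ] H) (B x) := (e.symm_apply_apply x).symm
      calc ‖G x‖ ≤ ‖G‖ * ‖x‖ := G.le_opNorm x
        _ ≤ ‖G‖ * (‖(e.symm : H →L[ℂ] H)‖ * ‖B x‖) := by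
            gcongr
            conv_lhs => rw [hxe]
            exact ContinuousLinearMap.le_opNorm _ _
        _ = _ := by ring

theorem mem_pointSpectrum_iff_of_graph (hG : Function.Injective G)
    (h : ∀ u v, (u, v) ∈ (shift A z).graph ↔ ∃ f, u = G f ∧ v = B f) :
    z ∈ pointSpectrum A ↔ ¬ Function.Injective B := by
  rw [injective_iff_map_eq_zero]
  push Not
  constructor
  · rintro ⟨u, hu, hu2⟩
    have h1 : ((u : H), (0 : H)) ∈ (shift A z).graph := by
      rw [mem_graph_shift, zero_add, ← hu2]
      exact A.mem_graph u
    obtain ⟨f, hf, hf2⟩ := (h _ _).1 h1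
    refine ⟨f, hf2.symm, ?_⟩
    rintro rfl
    exact hu (hf.trans (map_zero G))
  · rintro ⟨f, hf, hf2⟩
    have h1 := mem_graph_shift.1 ((h (G f) 0).2 ⟨f, rfl, hf.symm⟩)
    obtain ⟨hu, hu2⟩ := mem_graph_iff_exists.1 h1
    refine ⟨⟨G f, hu⟩, ?_, by rw [hu2, zero_add]⟩
    intro h3
    exact hf2 (hG (h3.trans (map_zero G).symm))

/-- `G` is a linear bijection onto the domain, so `B` and `A - z` have the same range and isomorphic
kernels. The Fredholm property involves nothing else. -/
theorem mem_essSpectrum_iff_of_graph (hG : Function.Injective G)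
    (h : ∀ u v, (u, v) ∈ (shift A z).graph ↔ ∃ f, u = G f ∧ v = B f) :
    z ∈ essSpectrum A ↔ ¬ IsFredholmCLM B := by
  have hd : ∀ f, G f ∈ (shift A z).domain := fun f =>
    (mem_graph_iff_exists.1 ((h (G f) (B f)).2 ⟨f, rfl, rfl⟩)).1
  have hv : ∀ f, (shift A z).toFun ⟨G f, hd f⟩ = B f := fun f =>
    (mem_graph_iff_exists.1 ((h (G f) (B f)).2 ⟨f, rfl, rfl⟩)).2
  let e : H ≃ₗ[ℂ] (shift A z).domain := LinearEquiv.ofBijective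
    ((G : H →ₗ[ℂ] H).codRestrict _ hd) ⟨fun a b hab => hG (congrArg Subtype.val hab), fun u => by
      obtain ⟨x, hx, -⟩ := (h _ _).1 ((shift A z).mem_graph u)
      exact ⟨x, Subtype.ext hx.symm⟩⟩
  have hB : (B : H →ₗ[ℂ] H) = (shift A z).toFun ∘ₗ (e : H →ₗ[ℂ] (shift A z).domain) := by
    ext f
    exact (hv f).symm
  have hr : LinearMap.range (B : H →ₗ[ℂ] H) = LinearMap.range (shift A z).toFun := by
    rw [hB, LinearEquiv.range_comp]
  have hk : LinearMap.ker (B : H →ₗ[ℂ] H) =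
      (LinearMap.ker (shift A z).toFun).comap (e : H →ₗ[ℂ] (shift A z).domain) := by
    rw [hB, LinearMap.ker_comp]
  refine not_congr ?_
  unfold IsFredholm IsFredholmCLM
  rw [hr]
  refine and_congr_left fun _ => ?_
  let e2 : LinearMap.ker (B : H →ₗ[ℂ] H) ≃ₗ[ℂ] LinearMap.ker (shift A z).toFun :=
    e.ofSubmodules _ _ (by
      rw [hk]
      exact Submodule.map_comap_eq_of_surjective e.surjective _)
  exact ⟨fun _ => Module.Finite.equiv e2.symm, fun _ => Module.Finite.equiv e2⟩

end Parametrization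

/-! ### The algebra of the smooth Feshbach-Schur map -/

section FeshbachAlgebra

variable {R : Type*} [Ring R]

/-- The algebraic data of the smooth Feshbach-Schur map: `p` and `q` with `p² + q² = 1` commute
with the free part `τ`; `t` and `s` invert `τ` and `τ + q w q` on the range of the projection
`y`. -/
structure FeshbachData (p q y τ w t s : R) : Prop where
  sq_add : p * p + q * q = 1
  p_τ : p * τ = τ * p
  q_τ : q * τ = τ * q
  p_q : p * q = q * p
  p_t : p * t = t * p
  y_q : y * q = q
  q_y : q * y = q
  τ_t : τ * t = y
  t_τ : t * τ = y
  y_s : y * s = s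
  s_y : s * y = s
  mul_s : (τ + q * w * q) * s = y
  s_mul : s * (τ + q * w * q) = y

/-- The Feshbach-Schur complement. -/
def feshF (p q τ w s : R) : R := τ + p * w * p - p * w * q * s * q * w * p

variable {p q y τ w t s : R} (h : FeshbachData p q y τ w t s)
include h

/-- This identity and the next three say that `p - q s q w p`, `p - p w q s q` and two copies of `p`
are the chain maps between `τ + w` and the Feshbach complement, with homotopy `q s q`. The mechanism
is the same in all of them: insert `p² + q² = 1` next to `w` and eliminate `q w q s` through `(τ + q
w q) s = y`. -/
theorem FeshbachData.comm : (τ + w) * (p - q * s * q * w * p) = p * feshF p q τ w s := by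
  unfold feshF
  linear_combination (norm := noncomm_ring) -h.p_τ - h.sq_add * w * p + h.q_τ * s * q * w * p
    - q * h.mul_s * q * w * p - q * h.y_q * w * p + h.sq_add * w * q * s * q * w * p

theorem FeshbachData.comm' : feshF p q τ w s * p = (p - p * w * q * s * q) * (τ + w) := by
  unfold feshF
  linear_combination (norm := noncomm_ring) -h.p_τ + p * w * h.sq_add + p * w * q * s * h.q_τ
    + p * w * q * h.s_mul * q + p * w * h.q_y * q - p * w * q * s * q * w * h.sq_add

theorem FeshbachData.left : 1 - (p - q * s * q * w * p) * p = q * s * q * (τ + w) := by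
  linear_combination (norm := noncomm_ring) -h.sq_add - q * s * h.q_τ - q * h.s_mul * q
    - h.q_y * q + q * s * q * w * h.sq_add

theorem FeshbachData.right : 1 - p * (p - p * w * q * s * q) = (τ + w) * (q * s * q) := by
  linear_combination (norm := noncomm_ring) -h.sq_add + h.q_τ * s * q - q * h.mul_s * q
    - q * h.y_q + h.sq_add * w * q * s * q

/-- The second resolvent identity for the inverses `t` of `τ` and `s` of `τ + q w q`. Together with
`mul_t` it lets the homotopy on the Feshbach side be written with the free inverse `t` alone. -/
theorem FeshbachData.t_mul : t * (q - q * w * q * s * q) = s * q := by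
  linear_combination (norm := noncomm_ring) -t * h.mul_s * q - t * h.y_q + h.t_τ * s * q
    + h.y_s * q

theorem FeshbachData.mul_t : (q - q * s * q * w * q) * t = q * s := by
  linear_combination (norm := noncomm_ring) -q * h.s_mul * t - h.q_y * t + q * s * h.τ_t
    + q * h.s_y

/-- The homotopy identity on the Feshbach side. The element `q t q` appears because moving `p` past
`t` and applying `t_mul` turns the terms with `t` into terms with `s`. -/
theorem FeshbachData.left_compl :
    1 - p * (p - q * s * q * w * p) = q * t * q * feshF p q τ w s := by
  unfold feshF
  linear_combination (norm := noncomm_ring) -h.sq_add - q * t * h.q_τ - q * h.t_τ * q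
    - h.q_y * q - p * q * h.t_mul * w * p
    + h.p_q * t * q * w * p + q * h.p_t * q * w * p + q * t * h.p_q * w * p
    - h.p_q * t * q * w * q * s * q * w * p - q * h.p_t * q * w * q * s * q * w * p
    - q * t * h.p_q * w * q * s * q * w * p

theorem FeshbachData.right_compl :
    1 - (p - p * w * q * s * q) * p = feshF p q τ w s * (q * t * q) := by
  unfold feshF
  linear_combination (norm := noncomm_ring) -h.sq_add + h.q_τ * t * q - q * h.τ_t * q
    - q * h.y_q
    - p * w * h.p_q * t * q - p * w * q * h.p_t * q - p * w * q * t * h.p_q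
    - p * w * h.mul_t * q * p
    + p * w * q * s * q * w * h.p_q * t * q + p * w * q * s * q * w * q * h.p_t * q
    + p * w * q * s * q * w * q * t * h.p_q

end FeshbachAlgebra

/-- The Neumann series gives the inverse `s` of `τ + q w q` on the range of `y`. -/
theorem exists_feshbachData {R : Type*} [Ring R] {p q y τ w t : R} (hpq : p * p + q * q = 1)
    (hpτ : p * τ = τ * p) (hqτ : q * τ = τ * q) (hpq' : p * q = q * p) (hpt : p * t = t * p)
    (hyq : y * q = q) (hqy : q * y = q) (hτt : τ * t = y)
    (htτ : t * τ = y) (hyt : y * t = t) (hty : t * y = t) (hu : IsUnit (1 + q * w * q * t)) :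
    ∃ s, FeshbachData p q y τ w t s := by
  obtain ⟨⟨u, v, huv, hvu⟩, rfl⟩ := hu
  change v * (1 + q * w * q * t) = 1 at hvu
  -- Here `v = (1 + q w q t)⁻¹`, and `(1 - y) q = 0`, so `v` differs from `1` only by elements with
  -- left factor `y`.
  have e1 : (1 - y) * v = 1 - y := by
    linear_combination (norm := noncomm_ring) (1 - y) * huv
      + hyq * w * q * t * v
  -- The inverse `s = t v` written with `t` on the right; this form gives the identities where `y`
  -- or `τ + q w q` multiplies `s` from the right.
  have e2 : t * v = (1 - t * v * (q * w * q)) * t := by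
    linear_combination (norm := noncomm_ring) t * hvu
  refine ⟨t * v, hpq, hpτ, hqτ, hpq', hpt, hyq, hqy, hτt, htτ, ?_, ?_, ?_, ?_⟩
  · linear_combination (norm := noncomm_ring) hyt * v
  · rw [e2]
    linear_combination (norm := noncomm_ring) (1 - t * v * (q * w * q)) * hty
  · linear_combination (norm := noncomm_ring) hτt * v + huv - e1
  · linear_combination (norm := noncomm_ring) e2 * (τ + q * w * q)
      + (1 - t * v * (q * w * q)) * htτ - t * hvu * q * w * q
      - t * v * q * w * hqy

/-! ### Homotopy equivalence of `τ + w` with the compressed and rescaled Feshbach operator. -/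

section Retract

variable {H X : Type*} [NormedAddCommGroup H] [NormedSpace ℂ H] [NormedAddCommGroup X]
  [NormedSpace ℂ X] {p q y τ w t s : H →L[ℂ] H} (h : FeshbachData p q y τ w t s)
  {U : X →L[ℂ] H} {U' : H →L[ℂ] X} {c : ℂ} (hc : c ≠ 0) (hU : U' ∘L U = 1)
  (hp : (U ∘L U') * p = p) (hp' : p * (U ∘L U') = p) (hτ : (U ∘L U') * τ = τ * (U ∘L U'))

include h hc hp hp' in
-- Since `U U'` fixes `p` from both sides, inserting it next to `p` changes nothing in the
-- identities for `τ + w`. The scalar `c` is absorbed in the two maps of targets.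
theorem nonempty_homotopyRetract_feshF :
    Nonempty (HomotopyRetract (τ + w) (c • (U' ∘L feshF p q τ w s ∘L U))) := by
  have hp1 : ∀ v, U (U' (p v)) = p v := fun v => DFunLike.congr_fun hp v
  have hp2 : ∀ v, p (U (U' v)) = p v := fun v => DFunLike.congr_fun hp' v
  refine ⟨⟨(p - q * s * q * w * p) ∘L U, c⁻¹ • (p ∘L U), U' ∘L p,
    c • (U' ∘L (p - p * w * q * s * q)), q * s * q, fun x => ?_, fun u => ?_, fun u => ?_,
    fun f => ?_⟩⟩
  · have := DFunLike.congr_fun h.comm (U x)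
    simp only [mul_apply_eq_comp, _root_.smul_apply,
      ContinuousLinearMap.comp_apply, map_smul, smul_smul, mul_inv_cancel₀ hc, one_smul, hp2] at *
    exact this
  · have := DFunLike.congr_fun h.comm' u
    simp only [mul_apply_eq_comp, _root_.smul_apply,
      ContinuousLinearMap.comp_apply, hp1] at *
    rw [this]
  · have := DFunLike.congr_fun h.left u
    simp only [mul_apply_eq_comp, _root_.sub_apply,
      one_apply_eq_self, ContinuousLinearMap.comp_apply, hp1] at *
    exact this
  · have := DFunLike.congr_fun h.right f
    simp only [mul_apply_eq_comp, _root_.sub_apply,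
      one_apply_eq_self, _root_.smul_apply,
      ContinuousLinearMap.comp_apply, map_smul, smul_smul, mul_inv_cancel₀ hc, one_smul,
      hp2] at *
    exact this

include hU hp hτ in
-- `τ` commutes with `U U'`, and all other terms of the Feshbach operator begin with `p`, so the
-- range of `U` is invariant and compressing to it loses nothing.
theorem feshF_apply_range (x : X) :
    U (U' (feshF p q τ w s (U x))) = feshF p q τ w s (U x) := by
  have hp1 : ∀ v, U (U' (p v)) = p v := fun v => DFunLike.congr_fun hp v
  have hU' : U' (U x) = x := DFunLike.congr_fun hU x
  have hτ' : U (U' (τ (U x))) = τ (U x) := by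
    have := DFunLike.congr_fun hτ (U x)
    simp only [mul_apply_eq_comp, ContinuousLinearMap.comp_apply, hU'] at this
    exact this
  simp only [feshF, mul_apply_eq_comp, _root_.sub_apply,
    _root_.add_apply, map_sub, map_add, hτ', hp1]

include h hc hU hp hp' hτ in
-- The reverse direction, with the compression of `q t q` as homotopy. It needs that the Feshbach
-- operator commutes with `U U'`, which enters as `hF` and `hF1`.
theorem nonempty_homotopyRetract_feshF' :
    Nonempty (HomotopyRetract (c • (U' ∘L feshF p q τ w s ∘L U)) (τ + w)) := by
  have hp1 : ∀ v, U (U' (p v)) = p v := fun v => DFunLike.congr_fun hp v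
  have hp2 : ∀ v, p (U (U' v)) = p v := fun v => DFunLike.congr_fun hp' v
  have hU1 : ∀ x, U' (U x) = x := fun x => DFunLike.congr_fun hU x
  have hF := feshF_apply_range (q := q) (w := w) (s := s) hU hp hτ
  have hτ1 : ∀ v, U' (τ (U (U' v))) = U' (τ v) := fun v => by
    have := DFunLike.congr_fun hτ v
    simp only [mul_apply_eq_comp, ContinuousLinearMap.comp_apply] at this
    rw [← this, hU1]
  have hF1 : ∀ v, U' (feshF p q τ w s (U (U' v))) = U' (feshF p q τ w s v) := fun v => by
    simp only [feshF, mul_apply_eq_comp, _root_.sub_apply,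
      _root_.add_apply, map_sub, map_add, hp2, hτ1]
  refine ⟨⟨U' ∘L p, c • (U' ∘L (p - p * w * q * s * q)), (p - q * s * q * w * p) ∘L U,
    c⁻¹ • (p ∘L U), c⁻¹ • (U' ∘L (q * t * q) ∘L U), fun u => ?_, fun x => ?_, fun x => ?_,
    fun x => ?_⟩⟩
  · have := DFunLike.congr_fun h.comm' u
    simp only [mul_apply_eq_comp, _root_.smul_apply,
      ContinuousLinearMap.comp_apply, hp1] at *
    rw [this]
  · have := DFunLike.congr_fun h.comm (U x)
    simp only [mul_apply_eq_comp, _root_.smul_apply,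
      ContinuousLinearMap.comp_apply, map_smul, smul_smul, mul_inv_cancel₀ hc, one_smul, hp2] at *
    exact this
  · have := congrArg U' (DFunLike.congr_fun h.left_compl (U x))
    simp only [mul_apply_eq_comp, _root_.smul_apply,
      one_apply_eq_self, _root_.sub_apply, map_sub, hU1,
      ContinuousLinearMap.comp_apply, map_smul, smul_smul, mul_inv_cancel₀ hc, one_smul, hF] at *
    exact this
  · have := congrArg U' (DFunLike.congr_fun h.right_compl (U x))
    simp only [mul_apply_eq_comp, _root_.smul_apply,
      one_apply_eq_self, _root_.sub_apply, map_sub, hU1,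
      ContinuousLinearMap.comp_apply, map_smul, smul_smul, inv_mul_cancel₀ hc, one_smul, hF1] at *
    exact this

end Retract

/-! ### Vectors of the Fock space -/

section FockBasics

variable {d : ℕ} {E : Type*} [NormedAddCommGroup E]

theorem Lp_enorm_sq {α : Type*} [MeasurableSpace α] {ν : Measure α} (f : Lp E 2 ν) :
    ‖f‖ₑ ^ 2 = ∫⁻ x, ‖f x‖ₑ ^ 2 ∂ν := by
  rw [Lp.enorm_def]
  have := eLpNorm_nnreal_pow_eq_lintegral (f := f) (μ := ν) (p := 2) (by norm_num)
  simpa using this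

theorem memLp_two_of_lintegral {α : Type*} [MeasurableSpace α] {ν : Measure α} {f : α → E}
    (hf : AEStronglyMeasurable f ν) (h : ∫⁻ x, ‖f x‖ₑ ^ 2 ∂ν ≠ ∞) : MemLp f 2 ν := by
  refine ⟨hf, ?_⟩
  have h1 := eLpNorm_nnreal_pow_eq_lintegral (f := f) (μ := ν) (p := 2) (by norm_num)
  have h2 : eLpNorm f 2 ν ^ 2 ≠ ∞ := by
    have h3 : eLpNorm f 2 ν ^ 2 = ∫⁻ x, ‖f x‖ₑ ^ 2 ∂ν := by simpa using h1
    rwa [h3]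
  rw [lt_top_iff_ne_top]
  intro h3
  rw [h3] at h2
  simp at h2

variable [NormedSpace ℂ E]

theorem fock_enorm_sq (Ψ : Fock d E) :
    ‖Ψ‖ₑ ^ 2 = ∑' n, ∫⁻ k, ‖sector Ψ n k‖ₑ ^ 2 ∂photonMeasureN d n := by
  have h := lp.hasSum_norm (p := 2) (by norm_num)
    (Ψ : lp (fun n : ℕ => Lp E 2 (photonMeasureN d n)) 2)
  simp only [ENNReal.toReal_ofNat, Real.rpow_ofNat] at h
  have h1 : ‖Ψ‖ₑ ^ 2 = ENNReal.ofReal (‖Ψ‖ ^ 2) := by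
    rw [ENNReal.ofReal_pow (norm_nonneg _), ofReal_norm]
  rw [h1]
  change ENNReal.ofReal (‖(Ψ : lp (fun n : ℕ => Lp E 2 (photonMeasureN d n)) 2)‖ ^ 2) = _
  rw [← h.tsum_eq, ENNReal.ofReal_tsum_of_nonneg (fun n => by positivity) h.summable]
  refine tsum_congr fun n => ?_
  rw [ENNReal.ofReal_pow (norm_nonneg _), ofReal_norm]
  exact Lp_enorm_sq _

theorem fock_ext {Ψ Φ : Fock d E}
    (h : ∀ n, ∀ᵐ k ∂photonMeasureN d n, sector Ψ n k = sector Φ n k) : Ψ = Φ := by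
  apply Subtype.ext
  apply lp.ext
  funext n
  exact Lp.ext (h n)

theorem sector_aestronglyMeasurable (Ψ : Fock d E) (n : ℕ) :
    AEStronglyMeasurable (sector Ψ n) (photonMeasureN d n) :=
  Lp.aestronglyMeasurable _

theorem sector_symm (Ψ : Fock d E) (n : ℕ) (σ : Equiv.Perm (Fin n)) :
    ∀ᵐ k ∂photonMeasureN d n, sector Ψ n (k ∘ σ) = sector Ψ n k := Ψ.2 n σ

/-- A square summable sequence of symmetric functions defines a vector of the Fock space. -/
theorem exists_fock {F : ∀ n, (Fin n → Photon d) → E}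
    (hF : ∀ n, AEStronglyMeasurable (F n) (photonMeasureN d n))
    (hs : ∀ n (σ : Equiv.Perm (Fin n)), ∀ᵐ k ∂photonMeasureN d n, F n (k ∘ σ) = F n k)
    (hb : ∑' n, ∫⁻ k, ‖F n k‖ₑ ^ 2 ∂photonMeasureN d n ≠ ∞) :
    ∃ Ψ : Fock d E, ∀ n, ∀ᵐ k ∂photonMeasureN d n, sector Ψ n k = F n k := by
  have hm : ∀ n, MemLp (F n) 2 (photonMeasureN d n) := fun n =>
    memLp_two_of_lintegral (hF n) (ENNReal.ne_top_of_tsum_ne_top hb n)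
  have hsum : Memℓp (fun n => (hm n).toLp (F n)) 2 := by
    apply memℓp_gen
    have h1 : ∀ n, ‖(hm n).toLp (F n)‖ ^ (2 : ℝ≥0∞).toReal =
        (∫⁻ k, ‖F n k‖ₑ ^ 2 ∂photonMeasureN d n).toReal := by
      intro n
      have h2 := Lp_enorm_sq ((hm n).toLp (F n))
      have h3 : ∫⁻ k, ‖(hm n).toLp (F n) k‖ₑ ^ 2 ∂photonMeasureN d n =
          ∫⁻ k, ‖F n k‖ₑ ^ 2 ∂photonMeasureN d n := by
        refine lintegral_congr_ae ?_
        filter_upwards [(hm n).coeFn_toLp] with k hk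
        rw [hk]
      rw [← h3, ← h2]
      simp
    simp_rw [h1]
    exact ENNReal.summable_toReal hb
  refine ⟨⟨⟨fun n => (hm n).toLp (F n), hsum⟩, ?_⟩, ?_⟩
  · intro n σ
    change ∀ᵐ k ∂photonMeasureN d n, (hm n).toLp (F n) (k ∘ σ) = (hm n).toLp (F n) k
    filter_upwards [(hm n).coeFn_toLp, (quasiMeasurePreserving_perm d σ).ae (hm n).coeFn_toLp,
      hs n σ] with k h1 h2 h3
    rw [h1, h2, h3]
  · intro n
    exact (hm n).coeFn_toLp

theorem measurePreserving_perm (d : ℕ) {n : ℕ} (σ : Equiv.Perm (Fin n)) :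
    MeasurePreserving (fun k : Fin n → Photon d => k ∘ σ)
      (photonMeasureN d n) (photonMeasureN d n) := by
  have h := measurePreserving_piCongrLeft (fun _ : Fin n => photonMeasure d) σ.symm
  have h' : (fun k : Fin n → Photon d => k ∘ σ) =
      MeasurableEquiv.piCongrLeft (fun _ : Fin n => Photon d) σ.symm := by
    funext k i
    rw [MeasurableEquiv.coe_piCongrLeft]
    have := Equiv.piCongrLeft_apply (P := fun _ : Fin n => Photon d) σ.symm k i
    simpa using this.symm
  rw [h']
  exact h

/-- Each symmetry condition is the fixed-point equation of an isometry of a sector. Closedness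
yields completeness, which the Neumann series and the open mapping theorem require. -/
theorem isClosed_fock (d : ℕ) (E : Type*) [NormedAddCommGroup E] [NormedSpace ℂ E] :
    IsClosed (Fock d E : Set (lp (fun n : ℕ => Lp E 2 (photonMeasureN d n)) 2)) := by
  have : (Fock d E : Set (lp (fun n : ℕ => Lp E 2 (photonMeasureN d n)) 2)) =
      ⋂ (n : ℕ) (σ : Equiv.Perm (Fin n)),
        {Ψ | Lp.compMeasurePreserving _ (measurePreserving_perm d σ) (Ψ n) = Ψ n} := by
    ext Ψ
    simp only [Set.mem_iInter, Set.mem_ofPred_eq]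
    refine forall_congr' fun n => forall_congr' fun σ => ?_
    rw [Lp.ext_iff]
    have h := Lp.coeFn_compMeasurePreserving (Ψ n) (measurePreserving_perm d σ)
    constructor
    · intro h2
      filter_upwards [h, h2] with k h3 h4
      rw [h3]
      exact h4
    · intro h2
      filter_upwards [h, h2] with k h3 h4
      rw [← h4, h3]
      rfl
  rw [this]
  refine isClosed_iInter fun n => isClosed_iInter fun σ => ?_
  have hc : Continuous fun Ψ : lp (fun n : ℕ => Lp E 2 (photonMeasureN d n)) 2 => Ψ n :=
    (lp.lipschitzWith_one_eval 2 n).continuous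
  exact isClosed_eq
    ((Lp.isometry_compMeasurePreserving (measurePreserving_perm d σ)).continuous.comp hc) hc

instance instCompleteSpaceFock [CompleteSpace E] : CompleteSpace (Fock d E) :=
  (isClosed_fock d E).completeSpace_coe

theorem fock_norm_le_of_enorm_sq {F : Type*} [NormedAddCommGroup F] [NormedSpace ℂ F]
    {Ψ : Fock d E} {Φ : Fock d F} {C : ℝ} (hC : 0 ≤ C)
    (h : ∀ n, ∀ᵐ k ∂photonMeasureN d n, ‖sector Φ n k‖ ≤ C * ‖sector Ψ n k‖) :
    ‖Φ‖ ≤ C * ‖Ψ‖ := by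
  have h1 : ‖Φ‖ₑ ^ 2 ≤ (ENNReal.ofReal C * ‖Ψ‖ₑ) ^ 2 := by
    rw [mul_pow, fock_enorm_sq, fock_enorm_sq, ← ENNReal.tsum_mul_left]
    refine ENNReal.tsum_le_tsum fun n => ?_
    rw [← lintegral_const_mul']
    · refine lintegral_mono_ae ?_
      filter_upwards [h n] with k hk
      rw [← mul_pow]
      gcongr
      rw [← ofReal_norm, ← ofReal_norm, ← ENNReal.ofReal_mul hC]
      exact ENNReal.ofReal_le_ofReal hk
    · exact ENNReal.pow_ne_top ENNReal.ofReal_ne_top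
  have h2 : ‖Φ‖ₑ ≤ ENNReal.ofReal C * ‖Ψ‖ₑ :=
    (ENNReal.pow_right_strictMono (n := 2) (by norm_num)).le_iff_le.1 h1
  rw [← ofReal_norm, ← ofReal_norm, ← ENNReal.ofReal_mul hC] at h2
  exact (ENNReal.ofReal_le_ofReal_iff (by positivity)).1 h2

end FockBasics

/-! ### Fibre operators -/

section Fibre

variable {d : ℕ} {E E' E'' : Type*} [NormedAddCommGroup E] [NormedSpace ℂ E]
  [NormedAddCommGroup E'] [NormedSpace ℂ E'] [NormedAddCommGroup E''] [NormedSpace ℂ E'']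

/-- The photon energy as a nonnegative number. -/
def photonEnergyNN {n : ℕ} (k : Fin n → Photon d) : ℝ≥0 := ∑ j, ‖(k j).1‖₊

theorem coe_photonEnergyNN {n : ℕ} (k : Fin n → Photon d) :
    (photonEnergyNN k : ℝ) = photonEnergy k := by
  simp [photonEnergyNN, photonEnergy]

theorem measurable_photonEnergyNN {n : ℕ} :
    Measurable (photonEnergyNN : (Fin n → Photon d) → ℝ≥0) := by
  unfold photonEnergyNN
  fun_prop

theorem photonEnergyNN_perm {n : ℕ} (k : Fin n → Photon d) (σ : Equiv.Perm (Fin n)) :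
    photonEnergyNN (k ∘ σ) = photonEnergyNN k :=
  Equiv.sum_comp σ fun j => ‖(k j).1‖₊

/-- A bounded strongly measurable family of bounded operators that depends on the photon
energy. -/
structure IsFibre (B : ℝ≥0 → E →L[ℂ] E') : Prop where
  stronglyMeasurable : StronglyMeasurable B
  bounded : ∃ C, ∀ r, ‖B r‖ ≤ C

theorem IsFibre.const (L : E →L[ℂ] E') : IsFibre fun _ => L :=
  ⟨stronglyMeasurable_const, ‖L‖, fun _ => le_rfl⟩

theorem IsFibre.add {B C : ℝ≥0 → E →L[ℂ] E'} (hB : IsFibre B) (hC : IsFibre C) :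
    IsFibre fun r => B r + C r := by
  obtain ⟨b, hb⟩ := hB.bounded
  obtain ⟨c, hc⟩ := hC.bounded
  exact ⟨hB.1.add hC.1, b + c, fun r => (norm_add_le _ _).trans (add_le_add (hb r) (hc r))⟩

theorem IsFibre.comp {B : ℝ≥0 → E' →L[ℂ] E''} {C : ℝ≥0 → E →L[ℂ] E'} (hB : IsFibre B)
    (hC : IsFibre C) : IsFibre fun r => B r ∘L C r := by
  obtain ⟨b, hb⟩ := hB.bounded
  obtain ⟨c, hc⟩ := hC.bounded
  refine ⟨?_, b * c, fun r => (ContinuousLinearMap.opNorm_comp_le _ _).trans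
    (mul_le_mul (hb r) (hc r) (norm_nonneg _) ((norm_nonneg _).trans (hb r)))⟩
  exact (ContinuousLinearMap.compL ℂ E E' E'').continuous₂.comp_stronglyMeasurable
    (hB.1.prodMk hC.1)

theorem IsFibre.smul {a : ℝ≥0 → ℂ} {C : ℝ≥0 → E →L[ℂ] E'} (ha : Measurable a) {b : ℝ}
    (hb : ∀ r, ‖a r‖ ≤ b) (hC : IsFibre C) : IsFibre fun r => a r • C r := by
  obtain ⟨c, hc⟩ := hC.bounded
  exact ⟨ha.stronglyMeasurable.smul hC.1, b * c, fun r => (norm_smul_le _ _).trans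
    (mul_le_mul (hb r) (hc r) (norm_nonneg _) ((norm_nonneg _).trans (hb r)))⟩

/-- Norm measurability of the fibres makes the pointwise product measurable, and the permutation
invariance of the photon energy preserves the symmetry of the sectors. -/
theorem IsFibre.exists_apply {B : ℝ≥0 → E →L[ℂ] E'} (hB : IsFibre B) (f : Fock d E) :
    ∃ g : Fock d E', ∀ n, ∀ᵐ k ∂photonMeasureN d n,
      sector g n k = B (photonEnergyNN k) (sector f n k) := by
  obtain ⟨c, hc⟩ := hB.bounded
  refine exists_fock (fun n => ?_) (fun n σ => ?_) ?_
  · have h1 : AEStronglyMeasurable (fun k : Fin n → Photon d => B (photonEnergyNN k))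
        (photonMeasureN d n) :=
      (hB.1.comp_measurable measurable_photonEnergyNN).aestronglyMeasurable
    exact isBoundedBilinearMap_apply.continuous.comp_aestronglyMeasurable
      (h1.prodMk (sector_aestronglyMeasurable f n))
  · filter_upwards [sector_symm f n σ] with k hk
    rw [hk, photonEnergyNN_perm]
  · have h0 : ∀ n (k : Fin n → Photon d), ‖B (photonEnergyNN k) (sector f n k)‖ₑ ^ 2 ≤
        ENNReal.ofReal c ^ 2 * ‖sector f n k‖ₑ ^ 2 := by
      intro n k
      rw [← mul_pow]
      gcongr
      have hc0 : 0 ≤ c := (norm_nonneg _).trans (hc 0)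
      rw [← ofReal_norm, ← ofReal_norm, ← ENNReal.ofReal_mul hc0]
      exact ENNReal.ofReal_le_ofReal ((B _).le_of_opNorm_le (hc _) _)
    refine ne_top_of_le_ne_top (b := ENNReal.ofReal c ^ 2 * ‖f‖ₑ ^ 2) (by finiteness) ?_
    rw [fock_enorm_sq, ← ENNReal.tsum_mul_left]
    refine ENNReal.tsum_le_tsum fun n => ?_
    rw [← lintegral_const_mul' _ _ (by finiteness)]
    exact lintegral_mono (h0 n)

theorem mem_graph_decomposable {a : ∀ n, (Fin n → Photon d) → (E →ₗ.[ℂ] E')} {u : Fock d E}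
    {v : Fock d E'} : (u, v) ∈ (decomposable a).graph ↔
      ∀ n, ∀ᵐ k ∂photonMeasureN d n, (sector u n k, sector v n k) ∈ (a n k).graph := by
  refine mem_graph_toLinearPMap fun v hv => fock_eq_zero fun n => ?_
  have hv' : ∀ᵐ k ∂photonMeasureN d n, (sector (0 : Fock d E) n k, sector v n k) ∈
    (a n k).graph := hv n
  filter_upwards [hv', sector_zero (d := d) (E := E) n] with k h1 h2
  rw [h2] at h1
  exact LinearPMap.graph_fst_eq_zero_snd _ h1 rfl

theorem IsFibre.exists_fibreOp (d : ℕ) {B : ℝ≥0 → E →L[ℂ] E'} (hB : IsFibre B) :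
    ∃ T : Fock d E →L[ℂ] Fock d E', ∀ f n, ∀ᵐ k ∂photonMeasureN d n,
      sector (T f) n k = B (photonEnergyNN k) (sector f n k) := by
  obtain ⟨c, hc⟩ := hB.bounded
  obtain ⟨T, hT⟩ := exists_clm_of_graph (decomposable (d := d) fun n k =>
    (B (photonEnergyNN k) : E →ₗ[ℂ] E').toPMap ⊤) 1 c fun f => by
      obtain ⟨g, hg⟩ := hB.exists_apply f
      refine ⟨g, mem_graph_decomposable.2 fun n => ?_, ?_⟩
      · filter_upwards [hg n] with k hk
        rw [one_apply_eq_self]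
        exact mem_graph_toPMap_top.2 hk
      · refine fock_norm_le_of_enorm_sq ((norm_nonneg _).trans (hc 0)) fun n => ?_
        filter_upwards [hg n] with k hk
        rw [hk]
        exact (B _).le_of_opNorm_le (hc _) _
  refine ⟨T, fun f n => ?_⟩
  filter_upwards [mem_graph_decomposable.1 (hT f) n] with k hk
  exact mem_graph_toPMap_top.1 hk

variable (d) in
/-- The operator on the Fock space that acts on `Ψ_n(k)` by `B (|k₁| + … + |k_n|)`. -/
def fibreOp (B : ℝ≥0 → E →L[ℂ] E') (hB : IsFibre B) : Fock d E →L[ℂ] Fock d E' :=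
  (hB.exists_fibreOp d).choose

theorem sector_fibreOp {B : ℝ≥0 → E →L[ℂ] E'} (hB : IsFibre B) (f : Fock d E) (n : ℕ) :
    ∀ᵐ k ∂photonMeasureN d n,
      sector (fibreOp d B hB f) n k = B (photonEnergyNN k) (sector f n k) :=
  (hB.exists_fibreOp d).choose_spec f n

theorem norm_fibreOp_le {B : ℝ≥0 → E →L[ℂ] E'} (hB : IsFibre B) {C : ℝ} (hC : 0 ≤ C)
    (h : ∀ r, ‖B r‖ ≤ C) : ‖fibreOp d B hB‖ ≤ C := by
  refine ContinuousLinearMap.opNorm_le_bound _ hC fun f => fock_norm_le_of_enorm_sq hC fun n => ?_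
  filter_upwards [sector_fibreOp hB f n] with k hk
  rw [hk]
  exact (B _).le_of_opNorm_le (h _) _

theorem fibreOp_comp {B : ℝ≥0 → E' →L[ℂ] E''} {C : ℝ≥0 → E →L[ℂ] E'} {D : ℝ≥0 → E →L[ℂ] E''}
    (hB : IsFibre B) (hC : IsFibre C) (hD : IsFibre D) (h : ∀ r, B r ∘L C r = D r) :
    fibreOp d B hB ∘L fibreOp d C hC = fibreOp d D hD := by
  ext1 f
  refine fock_ext fun n => ?_
  filter_upwards [sector_fibreOp hB (fibreOp d C hC f) n, sector_fibreOp hC f n,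
    sector_fibreOp hD f n] with k h1 h2 h3
  rw [ContinuousLinearMap.comp_apply, h1, h2, h3, ← h]
  rfl

theorem fibreOp_add {B C D : ℝ≥0 → E →L[ℂ] E'}
    (hB : IsFibre B) (hC : IsFibre C) (hD : IsFibre D) (h : ∀ r, B r + C r = D r) :
    fibreOp d B hB + fibreOp d C hC = fibreOp d D hD := by
  ext1 f
  refine fock_ext fun n => ?_
  filter_upwards [sector_add (fibreOp d B hB f) (fibreOp d C hC f) n, sector_fibreOp hB f n,
    sector_fibreOp hC f n, sector_fibreOp hD f n] with k h1 h2 h3 h4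
  change sector (fibreOp d B hB f + fibreOp d C hC f) n k = _
  rw [h1, h2, h3, h4, ← h]
  rfl

theorem fibreOp_one {B : ℝ≥0 → E →L[ℂ] E} (hB : IsFibre B)
    (h : ∀ r, B r = 1) : fibreOp d B hB = 1 := by
  ext1 f
  refine fock_ext fun n => ?_
  filter_upwards [sector_fibreOp hB f n] with k hk
  rw [hk, h]
  rfl

theorem mem_graph_decomposable_toPMap {a : ∀ n, (Fin n → Photon d) → (E →ₗ[ℂ] E')}
    {B : ℝ≥0 → E →L[ℂ] E'} (hB : IsFibre B)
    (h : ∀ n (k : Fin n → Photon d) x, a n k x = B (photonEnergyNN k) x)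
    {u : Fock d E} {v : Fock d E'} :
    (u, v) ∈ (decomposable fun n k => (a n k).toPMap ⊤).graph ↔ v = fibreOp d B hB u := by
  rw [mem_graph_decomposable]
  simp only [mem_graph_toPMap_top, h]
  constructor
  · intro h1
    refine fock_ext fun n => ?_
    filter_upwards [h1 n, sector_fibreOp hB u n] with k h2 h3
    rw [h2, h3]
  · rintro rfl n
    exact sector_fibreOp hB u n

end Fibre

/-! ### Photon dilations -/

section Dilation

variable {d : ℕ} {E E' : Type*} [NormedAddCommGroup E] [NormedSpace ℂ E]
  [NormedAddCommGroup E'] [NormedSpace ℂ E']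

/-- The Jacobian is needed explicitly, since the dilation is to be isometric. -/
theorem map_photonScale (d : ℕ) (θ : ℝ) :
    MeasurePreserving (photonScale (d := d) θ) (photonMeasure d)
      (Real.toNNReal (Real.exp (3 * θ)) • photonMeasure d) := by
  refine ⟨by unfold photonScale; fun_prop, ?_⟩
  have h : (photonScale (d := d) θ) = Prod.map (fun y : Pos => Real.exp (-θ) • y) id := rfl
  have h2 : |(Real.exp (-θ) ^ Module.finrank ℝ Pos)⁻¹| = Real.exp (3 * θ) := by
    rw [finrank_euclideanSpace_fin, abs_of_pos (by positivity), ← Real.exp_nat_mul,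
      ← Real.exp_neg]
    congr 1
    push_cast
    ring
  rw [h, photonMeasure, ← Measure.map_prod_map _ _ (by fun_prop) measurable_id, Measure.map_id,
    Measure.map_addHaar_smul _ (Real.exp_pos _).ne', Measure.prod_smul_left, h2]
  rfl

theorem lintegral_photonScale (d n : ℕ) (θ : ℝ) {f : (Fin n → Photon d) → ℝ≥0∞}
    (hf : AEMeasurable f (photonMeasureN d n)) :
    ∫⁻ k, f (fun j => photonScale θ (k j)) ∂photonMeasureN d n =
      ENNReal.ofReal (Real.exp (3 * θ)) ^ n * ∫⁻ k, f k ∂photonMeasureN d n := by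
  have h1 := measurePreserving_pi (fun _ : Fin n => photonMeasure d)
    (fun _ : Fin n => Real.toNNReal (Real.exp (3 * θ)) • photonMeasure d)
    (fun _ => map_photonScale d θ)
  have h2 : Measure.pi (fun _ : Fin n => Real.toNNReal (Real.exp (3 * θ)) • photonMeasure d) =
      (ENNReal.ofReal (Real.exp (3 * θ)) ^ n) • photonMeasureN d n := by
    refine Measure.pi_eq fun s _ => ?_
    have h3 : ∀ (c : ℝ≥0) (ν : Measure (Photon d)) (t : Set (Photon d)),
      (c • ν) t = (c : ℝ≥0∞) * ν t := fun _ _ _ => rfl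
    simp only [h3, photonMeasureN, Measure.smul_apply, Measure.pi_pi, Finset.prod_mul_distrib,
      Finset.prod_const, Finset.card_univ, Fintype.card_fin, smul_eq_mul]
    rfl
  rw [h2] at h1
  have h4 : AEMeasurable f (Measure.map (fun (k : Fin n → Photon d) j => photonScale θ (k j))
      (photonMeasureN d n)) := by
    rw [photonMeasureN, h1.map_eq]
    exact hf.smul_measure _
  have h5 := lintegral_map' h4 h1.measurable.aemeasurable
  rw [← h5]
  conv_lhs => rw [photonMeasureN, h1.map_eq, lintegral_smul_measure, smul_eq_mul]

theorem mem_graph_photonDilation {θ : ℝ} {u v : Fock d E} :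
    (u, v) ∈ (photonDilation d E θ).graph ↔ ∀ n, ∀ᵐ k ∂photonMeasureN d n,
        sector v n k = ((Real.exp (-(3 * θ / 2)) ^ n : ℝ) : ℂ) •
          sector u n (fun j => photonScale θ (k j)) := by
  refine mem_graph_toLinearPMap fun v hv => fock_eq_zero fun n => ?_
  have hv' : ∀ᵐ k ∂photonMeasureN d n, sector v n k = ((Real.exp (-(3 * θ / 2)) ^ n : ℝ) : ℂ) •
          sector (0 : Fock d E) n (fun j => photonScale θ (k j)) := hv n
  filter_upwards [hv', (quasiMeasurePreserving_photonScale d n θ).ae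
    (sector_zero (d := d) (E := E) n)] with k h1 h2
  rw [h1, h2, smul_zero]

theorem exists_dilation (d : ℕ) (E : Type*) [NormedAddCommGroup E] [NormedSpace ℂ E] (θ : ℝ) :
    ∃ D : Fock d E →L[ℂ] Fock d E, ∀ u, (u, D u) ∈ (photonDilation d E θ).graph := by
  refine exists_clm_of_graph (photonDilation d E θ) 1 1 fun u => ?_
  have hint : ∀ n, ∫⁻ k, ‖((Real.exp (-(3 * θ / 2)) ^ n : ℝ) : ℂ) •
      sector u n (fun j => photonScale θ (k j))‖ₑ ^ 2 ∂photonMeasureN d n =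
      ∫⁻ k, ‖sector u n k‖ₑ ^ 2 ∂photonMeasureN d n := by
    intro n
    simp_rw [enorm_smul, mul_pow]
    rw [lintegral_const_mul' _ _ (by finiteness), lintegral_photonScale d n θ
      (f := fun k => ‖sector u n k‖ₑ ^ 2) ((sector_aestronglyMeasurable u n).enorm.pow_const 2),
      ← mul_assoc]
    -- The squared normalisation `e^{-3θn}` cancels the Jacobian `e^{3θn}` of `n` photon variables.
    have : ‖((Real.exp (-(3 * θ / 2)) ^ n : ℝ) : ℂ)‖ₑ ^ 2 *
        ENNReal.ofReal (Real.exp (3 * θ)) ^ n = 1 := by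
      rw [← ofReal_norm, Complex.norm_real, Real.norm_of_nonneg (by positivity),
        ← ENNReal.ofReal_pow (by positivity), ← ENNReal.ofReal_pow (by positivity),
        ← ENNReal.ofReal_mul (by positivity), ← pow_mul, mul_comm n 2, pow_mul, ← mul_pow,
        ← Real.exp_nat_mul, ← Real.exp_add]
      have h0 : ((2 : ℕ) : ℝ) * -(3 * θ / 2) + 3 * θ = 0 := by push_cast; ring
      rw [h0, Real.exp_zero, one_pow, ENNReal.ofReal_one]
    rw [this, one_mul]
  obtain ⟨v, hv⟩ := exists_fock (d := d) (E := E)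
    (F := fun n k => ((Real.exp (-(3 * θ / 2)) ^ n : ℝ) : ℂ) •
      sector u n (fun j => photonScale θ (k j)))
    (fun n => ((sector_aestronglyMeasurable u n).comp_quasiMeasurePreserving
      (quasiMeasurePreserving_photonScale d n θ)).const_smul _)
    (fun n σ => by
      filter_upwards [(quasiMeasurePreserving_photonScale d n θ).ae (sector_symm u n σ)]
        with k hk
      congr 1)
    (by
      simp_rw [hint]
      rw [← fock_enorm_sq]
      finiteness)
  refine ⟨v, mem_graph_photonDilation.2 hv, ?_⟩
  have h1 : ‖v‖ₑ ^ 2 = ‖u‖ₑ ^ 2 := by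
    rw [fock_enorm_sq, fock_enorm_sq]
    refine tsum_congr fun n => ?_
    rw [← hint]
    refine lintegral_congr_ae ?_
    filter_upwards [hv n] with k hk
    rw [hk]
  have h2 : ‖v‖ₑ = ‖u‖ₑ := by
    exact (ENNReal.pow_right_strictMono (n := 2) (by norm_num)).injective h1
  rw [one_mul, ← toReal_enorm, h2, toReal_enorm]

variable (d E) in
/-- The photon dilation as a bounded operator. -/
def dilation (θ : ℝ) : Fock d E →L[ℂ] Fock d E := (exists_dilation d E θ).choose

theorem mem_graph_photonDilation_iff {θ : ℝ} {u v : Fock d E} :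
    (u, v) ∈ (photonDilation d E θ).graph ↔ v = dilation d E θ u := by
  have h := (exists_dilation d E θ).choose_spec u
  constructor
  · intro h1
    exact LinearPMap.mem_graph_snd_inj _ h1 h rfl
  · rintro rfl
    exact h

theorem sector_dilation (θ : ℝ) (u : Fock d E) (n : ℕ) : ∀ᵐ k ∂photonMeasureN d n,
    sector (dilation d E θ u) n k = ((Real.exp (-(3 * θ / 2)) ^ n : ℝ) : ℂ) •
      sector u n (fun j => photonScale θ (k j)) :=
  mem_graph_photonDilation.1 (mem_graph_photonDilation_iff.2 rfl) n

theorem dilation_neg_apply (θ : ℝ) (u : Fock d E) :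
    dilation d E (-θ) (dilation d E θ u) = u := by
  refine fock_ext fun n => ?_
  filter_upwards [sector_dilation (-θ) (dilation d E θ u) n,
    (quasiMeasurePreserving_photonScale d n (-θ)).ae (sector_dilation θ u n)] with k h1 h2
  rw [h1, h2, smul_smul, ← Complex.ofReal_mul, ← mul_pow, ← Real.exp_add]
  have h3 : -(3 * -θ / 2) + -(3 * θ / 2) = 0 := by ring
  have h4 : (fun j => photonScale θ (photonScale (-θ) (k j))) = k := by
    funext j
    simp only [photonScale, smul_smul, ← Real.exp_add]
    simp
  rw [h3, h4, Real.exp_zero, one_pow, Complex.ofReal_one, one_smul]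

theorem dilation_apply_neg (θ : ℝ) (u : Fock d E) :
    dilation d E θ (dilation d E (-θ) u) = u := by
  have := dilation_neg_apply (-θ) u
  rwa [neg_neg] at this

theorem mem_graph_photonDilation_inverse {θ : ℝ} {u v : Fock d E} :
    (u, v) ∈ (photonDilation d E θ).inverse.graph ↔ v = dilation d E (-θ) u := by
  rw [mem_graph_inverse, mem_graph_photonDilation_iff]
  · constructor
    · rintro rfl
      rw [dilation_neg_apply]
    · rintro rfl
      rw [dilation_apply_neg]
  · refine ker_eq_bot_of_graph fun u hu => ?_
    rw [mem_graph_photonDilation_iff] at hu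
    rw [← dilation_neg_apply θ u, ← hu, map_zero]

theorem dilation_fibreOp_const (θ : ℝ) (L : E →L[ℂ] E') (u : Fock d E) :
    dilation d E' θ (fibreOp d _ (IsFibre.const L) u) =
      fibreOp d _ (IsFibre.const L) (dilation d E θ u) := by
  refine fock_ext fun n => ?_
  filter_upwards [sector_dilation θ (fibreOp d _ (IsFibre.const L) u) n, sector_dilation θ u n,
    (quasiMeasurePreserving_photonScale d n θ).ae (sector_fibreOp (IsFibre.const L) u n),
    sector_fibreOp (IsFibre.const L) (dilation d E θ u) n] with k h1 h2 h3 h4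
  rw [h1, h4, h2, h3, map_smul]

end Dilation

/-! ### Multiplication operators and Fourier multipliers -/

section Particle

theorem mem_graph_mulOp {V : Pos → ℂ} {u v : Particle} :
    (u, v) ∈ (mulOp V).graph ↔ ∀ᵐ x, v x = V x * u x := by
  refine mem_graph_toLinearPMap fun v hv => ?_
  have hv' : ∀ᵐ x, v x = V x * (0 : Particle) x := hv
  refine Lp.ext ?_
  filter_upwards [hv', Lp.coeFn_zero ℂ 2 (volume : Measure Pos)] with x h1 h2
  rw [h1, h2]
  simp

theorem exists_mul {m : Pos → ℂ} (hm : Measurable m) (hb : ∀ ξ, ‖m ξ‖ ≤ 1) :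
    ∃ T : Particle →L[ℂ] Particle, ∀ u : Particle, ∀ᵐ ξ, T u ξ = m ξ * u ξ := by
  obtain ⟨T, hT⟩ := exists_clm_of_graph (mulOp m) 1 1 fun (u : Particle) => by
    have h1 : MemLp (fun ξ => m ξ * u ξ) 2 volume := by
      refine (Lp.memLp u).of_le (hm.aestronglyMeasurable.mul (Lp.aestronglyMeasurable u)) ?_
      refine Filter.Eventually.of_forall fun ξ => ?_
      rw [norm_mul]
      exact mul_le_of_le_one_left (norm_nonneg _) (hb ξ)
    refine ⟨h1.toLp _, ?_, ?_⟩
    · rw [one_apply_eq_self, mem_graph_mulOp]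
      exact h1.coeFn_toLp
    · rw [one_mul]
      refine Lp.norm_le_norm_of_ae_le ?_
      filter_upwards [h1.coeFn_toLp] with ξ hξ
      rw [hξ, norm_mul]
      exact mul_le_of_le_one_left (norm_nonneg _) (hb ξ)
  exact ⟨T, fun u => mem_graph_mulOp.1 (hT u)⟩

theorem exists_fourierMul {m : Pos → ℂ} (hm : Measurable m) (hb : ∀ ξ, ‖m ξ‖ ≤ 1) :
    ∃ T : Particle →L[ℂ] Particle,
      ∀ u, ∀ᵐ ξ, (𝓕 (T u) : Particle) ξ = m ξ * (𝓕 u : Particle) ξ := by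
  obtain ⟨T, hT⟩ := exists_mul hm hb
  let F := (Lp.fourierTransformₗᵢ Pos ℂ).toContinuousLinearEquiv
  refine ⟨(F.symm : Particle →L[ℂ] Particle) ∘L T ∘L (F : Particle →L[ℂ] Particle), fun u => ?_⟩
  have h1 : (𝓕 (((F.symm : Particle →L[ℂ] Particle) ∘L T ∘L
      (F : Particle →L[ℂ] Particle)) u) : Particle) = T (𝓕 u : Particle) :=
    F.apply_symm_apply (T (F u))
  rw [h1]
  exact hT _

theorem fourier_injective {u v : Particle}
    (h : ∀ᵐ ξ, (𝓕 u : Particle) ξ = (𝓕 v : Particle) ξ) : u = v :=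
  (Lp.fourierTransformₗᵢ Pos ℂ).injective (Lp.ext h)

theorem norm_fourier (u : Particle) : ‖(𝓕 u : Particle)‖ = ‖u‖ :=
  (Lp.fourierTransformₗᵢ Pos ℂ).norm_map u

theorem inner_fourier (u v : Particle) :
    inner ℂ (𝓕 u : Particle) (𝓕 v : Particle) = inner ℂ u v :=
  (Lp.fourierTransformₗᵢ Pos ℂ).inner_map_map u v

theorem one_le_japanese (y : Pos) : 1 ≤ japanese y := by
  unfold japanese
  rw [Real.one_le_sqrt]
  nlinarith [sq_nonneg ‖y‖]

theorem continuous_japanese : Continuous japanese := by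
  unfold japanese
  fun_prop

/-- The multiplier `⟨p⟩^s` in Mathlib's normalisation of the Fourier transform. -/
def besselWeight (s : ℝ) (ξ : Pos) : ℝ := japanese ((2 * Real.pi) • ξ) ^ s

theorem besselWeight_pos (s : ℝ) (ξ : Pos) : 0 < besselWeight s ξ :=
  Real.rpow_pos_of_pos (one_pos.trans_le (one_le_japanese _)) _

theorem besselWeight_mul (s t : ℝ) (ξ : Pos) :
    besselWeight s ξ * besselWeight t ξ = besselWeight (s + t) ξ :=
  (Real.rpow_add (one_pos.trans_le (one_le_japanese _)) _ _).symm

theorem measurable_besselWeight (s : ℝ) : Measurable (besselWeight s) := by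
  unfold besselWeight
  have := continuous_japanese
  exact (Continuous.measurable (by fun_prop)).pow_const s

theorem exists_besselOp (s : ℝ) (hs : 0 ≤ s) : ∃ T : Particle →L[ℂ] Particle, ∀ u, ∀ᵐ ξ,
    (𝓕 (T u) : Particle) ξ = (besselWeight (-s) ξ : ℂ) * (𝓕 u : Particle) ξ := by
  refine exists_fourierMul (m := fun ξ => (besselWeight (-s) ξ : ℂ))
    (Complex.measurable_ofReal.comp (measurable_besselWeight _)) fun ξ => ?_
  rw [Complex.norm_real, Real.norm_of_nonneg (besselWeight_pos _ _).le]
  exact Real.rpow_le_one_of_one_le_of_nonpos (one_le_japanese _) (by linarith)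

/-- The operator `⟨p⟩^{-s}`. -/
def besselOp (s : ℝ) (hs : 0 ≤ s) : Particle →L[ℂ] Particle := (exists_besselOp s hs).choose

theorem fourier_besselOp (s : ℝ) (hs : 0 ≤ s) (u : Particle) : ∀ᵐ ξ,
    (𝓕 (besselOp s hs u) : Particle) ξ = (besselWeight (-s) ξ : ℂ) * (𝓕 u : Particle) ξ :=
  (exists_besselOp s hs).choose_spec u

theorem momentumWeight_besselOp (s : ℝ) (hs : 0 ≤ s) (u : Particle) :
    momentumWeight s (besselOp s hs u) =ᵐ[volume] (𝓕 u : Particle) := by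
  filter_upwards [fourier_besselOp s hs u] with ξ hξ
  change (besselWeight s ξ : ℂ) * _ = _
  rw [hξ, ← mul_assoc, ← Complex.ofReal_mul, besselWeight_mul, add_neg_cancel]
  simp [besselWeight]

theorem besselOp_mem (s : ℝ) (hs : 0 ≤ s) (u : Particle) : besselOp s hs u ∈ sobolev s :=
  (memLp_congr_ae (momentumWeight_besselOp s hs u)).2 (Lp.memLp _)

theorem sobolevENorm_besselOp (s : ℝ) (hs : 0 ≤ s) (u : Particle) :
    sobolevENorm s (besselOp s hs u) = ‖u‖ₑ := by
  rw [sobolevENorm, eLpNorm_congr_ae (momentumWeight_besselOp s hs u), ← Lp.enorm_def,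
    ← ofReal_norm, norm_fourier, ofReal_norm]

theorem besselOp_injective (s : ℝ) (hs : 0 ≤ s) : Function.Injective (besselOp s hs) := by
  intro u v huv
  refine fourier_injective ?_
  filter_upwards [fourier_besselOp s hs u, fourier_besselOp s hs v] with ξ h1 h2
  rw [huv, h2] at h1
  exact (mul_left_cancel₀ (Complex.ofReal_ne_zero.2 (besselWeight_pos _ _).ne') h1).symm

theorem besselOp_comp {s t r : ℝ} (hs : 0 ≤ s) (ht : 0 ≤ t) (hr : 0 ≤ r) (h : s + t = r)
    (u : Particle) : besselOp s hs (besselOp t ht u) = besselOp r hr u := by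
  refine fourier_injective ?_
  filter_upwards [fourier_besselOp s hs (besselOp t ht u), fourier_besselOp t ht u,
    fourier_besselOp r hr u] with ξ h1 h2 h3
  rw [h1, h2, h3, ← mul_assoc, ← Complex.ofReal_mul, besselWeight_mul, ← h]
  congr 3
  ring

theorem inner_besselOp {s t : ℝ} (hs : 0 ≤ s) (ht : 0 ≤ t) (h : s + s = t) (u : Particle) :
    inner ℂ (besselOp s hs u) (besselOp s hs u) = inner ℂ u (besselOp t ht u) := by
  rw [← inner_fourier, ← inner_fourier u, L2.inner_def, L2.inner_def]
  refine integral_congr_ae ?_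
  filter_upwards [fourier_besselOp s hs u, fourier_besselOp t ht u] with ξ h1 h2
  rw [h1, h2]
  have h3 : besselWeight (-t) ξ = besselWeight (-s) ξ * besselWeight (-s) ξ := by
    rw [besselWeight_mul, ← h]
    congr 1
    ring
  rw [h3]
  simp only [RCLike.inner_apply, map_mul, Complex.conj_ofReal]
  push_cast
  ring

/-- Interpolation between `1` and `⟨p⟩^{-2s}`. It serves the linear couplings, where half of the
available two powers of `⟨p⟩` is traded for half a power of `H_f`. -/
theorem norm_besselOp_sq_le {s t : ℝ} (hs : 0 ≤ s) (ht : 0 ≤ t) (h : s + s = t) (u : Particle) :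
    ‖besselOp s hs u‖ ^ 2 ≤ ‖u‖ * ‖besselOp t ht u‖ := by
  have h1 : ‖(inner ℂ (besselOp s hs u) (besselOp s hs u) : ℂ)‖ = ‖besselOp s hs u‖ ^ 2 := by
    rw [inner_self_eq_norm_sq_to_K]
    simp
  rw [← h1, inner_besselOp hs ht h]
  exact norm_inner_le_norm _ _

/-! ### The particle Hamiltonian -/

theorem mem_graph_laplacianOp {u v : Particle} : (u, v) ∈ laplacianOp.graph ↔
    ∀ᵐ ξ, (𝓕 v : Particle) ξ = -(((2 * Real.pi) ^ 2 * ‖ξ‖ ^ 2 : ℝ) : ℂ) * (𝓕 u : Particle) ξ := by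
  unfold laplacianOp
  simp only [mem_graph_opComp, mem_graph_toPMap_top]
  constructor
  · rintro ⟨y, ⟨a, rfl, h1⟩, rfl⟩
    rw [mem_graph_mulOp] at h1
    have h2 : (𝓕 ((Lp.fourierTransformₗᵢ Pos ℂ).symm y) : Particle) = y :=
      (Lp.fourierTransformₗᵢ Pos ℂ).apply_symm_apply y
    change ∀ᵐ ξ, (𝓕 ((Lp.fourierTransformₗᵢ Pos ℂ).symm y) : Particle) ξ = _
    rw [h2]
    exact h1
  · intro h
    refine ⟨𝓕 v, ⟨𝓕 u, rfl, mem_graph_mulOp.2 h⟩, ?_⟩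
    exact ((Lp.fourierTransformₗᵢ Pos ℂ).symm_apply_apply v).symm

/-- `⟨p⟩² = 1 - Δ`; this turns membership in `H²` into a factorisation through `⟨p⟩^{-2}`. -/
theorem besselOp_two_sub_laplacian {u a : Particle} (h : (u, a) ∈ laplacianOp.graph) :
    besselOp 2 (by norm_num) (u - a) = u := by
  rw [mem_graph_laplacianOp] at h
  refine fourier_injective ?_
  have h0 : (𝓕 (u - a) : Particle) = 𝓕 u - 𝓕 a := map_sub (Lp.fourierTransformₗᵢ Pos ℂ) u a
  filter_upwards [fourier_besselOp 2 (by norm_num) (u - a), h,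
    Lp.coeFn_sub (𝓕 u : Particle) (𝓕 a : Particle)] with ξ h1 h2 h3
  have h4 : besselWeight 2 ξ = 1 + (2 * Real.pi) ^ 2 * ‖ξ‖ ^ 2 := by
    rw [besselWeight, japanese, norm_smul]
    rw [Real.rpow_two, Real.sq_sqrt (by positivity), mul_pow, Real.norm_of_nonneg (by positivity)]
  have h5 : besselWeight (-2) ξ * besselWeight 2 ξ = 1 := by
    rw [besselWeight_mul, neg_add_cancel]
    simp [besselWeight]
  rw [h1, h0, h3, Pi.sub_apply, h2]
  have h6 : (𝓕 u : Particle) ξ - -(((2 * Real.pi) ^ 2 * ‖ξ‖ ^ 2 : ℝ) : ℂ) * (𝓕 u : Particle) ξ =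
      (besselWeight 2 ξ : ℂ) * (𝓕 u : Particle) ξ := by
    rw [h4]
    push_cast
    ring
  rw [h6, ← mul_assoc, ← Complex.ofReal_mul, h5, Complex.ofReal_one, one_mul]

theorem exists_inner_laplacian {u a : Particle} (h : (u, a) ∈ laplacianOp.graph) :
    ∃ s : ℝ, 0 ≤ s ∧ inner ℂ a u = -(s : ℂ) := by
  rw [mem_graph_laplacianOp] at h
  refine ⟨∫ ξ : Pos, (2 * Real.pi) ^ 2 * ‖ξ‖ ^ 2 * ‖(𝓕 u : Particle) ξ‖ ^ 2,
    integral_nonneg fun ξ => by positivity, ?_⟩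
  rw [← inner_fourier, L2.inner_def, ← integral_complex_ofReal, ← integral_neg]
  refine integral_congr_ae ?_
  filter_upwards [h] with ξ hξ
  rw [hξ]
  simp only [RCLike.inner_apply, map_mul, map_neg, Complex.conj_ofReal]
  have h1 : (𝓕 u : Particle) ξ * (starRingEnd ℂ) ((𝓕 u : Particle) ξ) =
      ((‖(𝓕 u : Particle) ξ‖ ^ 2 : ℝ) : ℂ) := by
    rw [Complex.mul_conj, Complex.normSq_eq_norm_sq]
  push_cast at *
  rw [← h1]
  ring

/-- Expanding the square, the cross term is a nonnegative multiple of `Re κ ⟨u, -Δ u⟩`, hence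
nonnegative. This is where the sign of `Re κ` enters. -/
theorem norm_laplacian_add_sq {κ : ℂ} (hκ : 0 ≤ κ.re) {u a : Particle}
    (h : (u, a) ∈ laplacianOp.graph) {r : ℝ} (hr : 0 ≤ r) :
    (‖κ‖ * ‖a‖) ^ 2 + (r * ‖u‖) ^ 2 ≤ ‖(-κ) • a + (r : ℂ) • u‖ ^ 2 := by
  obtain ⟨s, hs, hsu⟩ := exists_inner_laplacian h
  rw [norm_add_sq (𝕜 := ℂ), norm_smul, norm_smul, norm_neg, Complex.norm_real,
    Real.norm_of_nonneg hr, inner_smul_left, inner_smul_right, hsu]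
  have : 0 ≤ RCLike.re ((starRingEnd ℂ) (-κ) * ((r : ℂ) * -(s : ℂ))) := by
    simp
    positivity
  linarith

theorem mem_graph_particleHam {κ : ℂ} {V : Pos → ℂ} {u v : Particle} :
    (u, v) ∈ (particleHam κ V).graph ↔ ∃ a b, (u, a) ∈ laplacianOp.graph ∧
      (u, b) ∈ (mulOp V).graph ∧ v = (-κ) • a + b := by
  unfold particleHam
  rw [mem_graph_add]
  simp only [mem_graph_smul]
  constructor
  · rintro ⟨_, b, ⟨a, ha, rfl⟩, hb, rfl⟩
    exact ⟨a, b, ha, hb, rfl⟩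
  · rintro ⟨a, b, ha, hb, rfl⟩
    exact ⟨_, b, ⟨a, ha, rfl⟩, hb, rfl⟩

/-- The graph norm of `-κ Δ + V - z` controls `κ Δ` and the negative part of `Re z`. -/
theorem particleHam_estimate {κ : ℂ} (hκ : 0 ≤ κ.re) {V : Pos → ℂ} (hV : PotentialBound κ V)
    {u v : Particle} (h : (u, v) ∈ (particleHam κ V).graph) {z : ℂ} {T : ℝ}
    (hz : z.re ≤ T) (hz' : |z.im| ≤ T) :
    ∃ a, (u, a) ∈ laplacianOp.graph ∧
      ‖κ‖ * ‖a‖ ≤ 2 * ‖v - z • u‖ + 2 * (1 + 2 * T) * ‖u‖ ∧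
      -z.re * ‖u‖ ≤ 2 * ‖v - z • u‖ + 2 * (1 + 2 * T) * ‖u‖ := by
  obtain ⟨a, b, ha, hb, rfl⟩ := mem_graph_particleHam.1 h
  refine ⟨a, ha, ?_⟩
  have hT : 0 ≤ T := (abs_nonneg _).trans hz'
  obtain ⟨hu, hua⟩ := mem_graph_iff_exists.1 ha
  obtain ⟨v', hv', hVb⟩ := hV ⟨u, hu⟩
  have hb' : b = mulOp V v' := by
    have h1 := (mulOp V).mem_graph v'
    rw [hv'] at h1
    exact LinearPMap.mem_graph_snd_inj _ hb h1 rfl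
  rw [← hb', hua] at hVb
  change ‖b‖ ≤ ‖κ‖ / 2 * ‖a‖ + ‖u‖ at hVb
  -- The part of `-z` that helps: `r ≥ 0` can join `-κ Δ` without cancellation, and the remainder
  -- `-z - r` is bounded by `2T`.
  set r : ℝ := max (-z.re) 0 with hr
  have hr0 : 0 ≤ r := le_max_right _ _
  have h1 := norm_laplacian_add_sq hκ ha hr0
  set N := ‖(-κ) • a + (r : ℂ) • u‖ with hN
  have hN0 : 0 ≤ N := norm_nonneg _
  have h2 : ‖κ‖ * ‖a‖ ≤ N := by
    refine le_of_sq_le_sq ?_ hN0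
    nlinarith [sq_nonneg (r * ‖u‖)]
  have h3 : r * ‖u‖ ≤ N := by
    refine le_of_sq_le_sq ?_ hN0
    nlinarith [sq_nonneg (‖κ‖ * ‖a‖)]
  have h4 : ‖-z - r‖ ≤ 2 * T := by
    refine (Complex.norm_le_abs_re_add_abs_im _).trans ?_
    have h5 : |(-z - r).re| ≤ T := by
      simp only [Complex.sub_re, Complex.neg_re, Complex.ofReal_re]
      rw [abs_le]
      rcases max_cases (-z.re) 0 with ⟨h6, h7⟩ | ⟨h6, h7⟩
      · constructor <;> linarith
      · constructor <;> linarith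
    have h6 : |(-z - r).im| ≤ T := by
      simpa using hz'
    linarith
  have h5 : (-κ) • a + (r : ℂ) • u = ((-κ) • a + b - z • u) - b - (-z - r) • u := by
    simp only [sub_smul, neg_smul]
    abel
  have h6 : N ≤ ‖(-κ) • a + b - z • u‖ + ‖b‖ + 2 * T * ‖u‖ := by
    rw [hN, h5]
    refine (norm_sub_le _ _).trans (add_le_add (norm_sub_le _ _) ?_)
    rw [norm_smul]
    gcongr
  -- The relative bound `1/2` gives `‖b‖ ≤ N/2 + ‖u‖`. Absorbing `N/2` on the left produces the
  -- factor `2`.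
  have h7 : N ≤ 2 * ‖(-κ) • a + b - z • u‖ + 2 * (1 + 2 * T) * ‖u‖ := by linarith
  refine ⟨h2.trans h7, le_trans ?_ h7⟩
  refine le_trans ?_ h3
  gcongr
  exact le_max_left _ _

end Particle

/-! ### Reduced resolvents -/

section ReducedResolvent

variable {E : Type*} [NormedAddCommGroup E] [NormedSpace ℂ E]
  {A : E →ₗ.[ℂ] E} {lam : ℂ} {P : E →L[ℂ] E} {ψ : E}

/-- `K` bounds the inverse of `A - ζ` on the kernel of `P`. -/
def HasReducedBound (A : E →ₗ.[ℂ] E) (P : E →L[ℂ] E) (ζ : ℂ) (K : ℝ) : Prop :=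
  ∀ u f, (u, f - P f + ζ • u) ∈ A.graph → P u = 0 → ‖u‖ ≤ K * ‖f‖

/-- `R` is the inverse of `A - ζ` on the kernel of `P`, composed with `1 - P`. -/
structure IsReducedResolvent (A : E →ₗ.[ℂ] E) (P : E →L[ℂ] E) (ζ : ℂ) (R : E →L[ℂ] E) : Prop where
  mem_graph : ∀ f, (R f, f - P f + ζ • R f) ∈ A.graph
  proj : ∀ f, P (R f) = 0
  unique : ∀ u v, (u, v) ∈ A.graph → P u = 0 → R (v - ζ • u) = u

theorem IsSimpleSpectralProjection.idem (h : IsSimpleSpectralProjection A lam P ψ) (u : E) :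
    P (P u) = P u := DFunLike.congr_fun h.1 u

theorem IsSimpleSpectralProjection.comm_graph (h : IsSimpleSpectralProjection A lam P ψ) {u v : E}
    (huv : (u, v) ∈ A.graph) : (P u, P v) ∈ A.graph := by
  obtain ⟨hu, rfl⟩ := mem_graph_iff_exists.1 huv
  obtain ⟨h1, h2⟩ := h.2.2.2.2.1 ⟨u, hu⟩
  exact mem_graph_iff_exists.2 ⟨h1, h2⟩

theorem IsSimpleSpectralProjection.mem_graph_proj (h : IsSimpleSpectralProjection A lam P ψ)
    (u : E) : (P u, lam • P u) ∈ A.graph := by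
  have h1 : P u ∈ Submodule.span ℂ {ψ} := by
    rw [← h.2.2.1]
    exact ⟨u, rfl⟩
  obtain ⟨c, hc⟩ := Submodule.mem_span_singleton.1 h1
  obtain ⟨h2, h3⟩ := h.2.2.2.1
  have h4 := A.graph.smul_mem c (mem_graph_iff_exists.2 ⟨h2, h3⟩)
  rw [← hc, smul_comm]
  exact h4

/-- The inverse is constructed from its graph `g`: the bound `K` makes `g` single-valued and the
resulting map continuous, and `hs` makes it everywhere defined. -/
theorem exists_isReducedResolvent (h : IsSimpleSpectralProjection A lam P ψ) {ζ : ℂ} {K : ℝ}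
    (hK : HasReducedBound A P ζ K)
    (hs : ∀ f, P f = 0 → ∃ u, (u, f + ζ • u) ∈ A.graph ∧ P u = 0) :
    ∃ R, IsReducedResolvent A P ζ R := by
  let g : Submodule ℂ (E × E) :=
    { carrier := {p | (p.2, p.1 - P p.1 + ζ • p.2) ∈ A.graph ∧ P p.2 = 0}
      zero_mem' := by
        refine ⟨?_, map_zero P⟩
        convert A.graph.zero_mem using 1
        simp
      add_mem' := by
        rintro ⟨f, u⟩ ⟨f', u'⟩ ⟨h1, h2⟩ ⟨h3, h4⟩
        refine ⟨?_, by simp_all⟩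
        have := A.graph.add_mem h1 h3
        simp only [Prod.mk_add_mk, map_add, smul_add] at this ⊢
        convert this using 2
        abel
      smul_mem' := by
        rintro c ⟨f, u⟩ ⟨h1, h2⟩
        refine ⟨?_, by simp_all⟩
        have := A.graph.smul_mem c h1
        simp only [Prod.smul_mk, map_smul, smul_add, smul_sub] at this ⊢
        rwa [smul_comm ζ c] }
  have hg : ∀ v, ((0 : E), v) ∈ g → v = 0 := by
    rintro v ⟨h1, h2⟩
    have := hK v 0 h1 h2
    rwa [norm_zero, mul_zero, norm_le_zero_iff] at this
  obtain ⟨R, hR⟩ := exists_clm_of_graph g.toLinearPMap 1 K fun f => by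
    have hPf : P (f - P f) = 0 := by rw [map_sub, h.idem, sub_self]
    obtain ⟨u, hu, hPu⟩ := hs (f - P f) hPf
    exact ⟨u, (mem_graph_toLinearPMap hg).2 ⟨hu, hPu⟩, hK u f hu hPu⟩
  have hR' : ∀ f, (R f, f - P f + ζ • R f) ∈ A.graph ∧ P (R f) = 0 := fun f =>
    (mem_graph_toLinearPMap hg).1 (hR f)
  refine ⟨R, fun f => (hR' f).1, fun f => (hR' f).2, fun u v huv hPu => ?_⟩
  have hPv : P v = 0 := by
    have := h.comm_graph huv
    rw [hPu] at this
    exact LinearPMap.graph_fst_eq_zero_snd _ this rfl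
  have h1 : ((v - ζ • u), u) ∈ g := by
    refine ⟨?_, hPu⟩
    simp only [map_sub, map_smul, hPu, hPv, smul_zero, sub_zero, sub_add_cancel]
    exact huv
  exact LinearPMap.mem_graph_snd_inj _ (hR _) ((mem_graph_toLinearPMap hg).2 h1) rfl

variable {ζ ζ' : ℂ} {R R' : E →L[ℂ] E} {K : ℝ}

theorem IsReducedResolvent.norm_le (hR : IsReducedResolvent A P ζ R)
    (hK : HasReducedBound A P ζ K) (f : E) : ‖R f‖ ≤ K * ‖f‖ :=
  hK _ _ (hR.mem_graph f) (hR.proj f)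

theorem IsReducedResolvent.apply_proj (h : IsSimpleSpectralProjection A lam P ψ)
    (hR : IsReducedResolvent A P ζ R) (f : E) : R (P f) = 0 := by
  have h1 := hR.mem_graph (P f)
  rw [h.idem, sub_self, zero_add] at h1
  have h2 := hR.unique _ _ h1 (hR.proj _)
  rw [sub_self, map_zero] at h2
  exact h2.symm

/-- The first resolvent identity; it is the source of the Lipschitz dependence on the photon energy.
-/
theorem IsReducedResolvent.sub (h : IsSimpleSpectralProjection A lam P ψ)
    (hR : IsReducedResolvent A P ζ R) (hR' : IsReducedResolvent A P ζ' R') :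
    R - R' = (ζ - ζ') • (R ∘L R') := by
  ext f
  have h1 := hR.unique _ _ (hR'.mem_graph f) (hR'.proj f)
  rw [map_sub, map_add, map_sub, hR.apply_proj h, map_smul, map_smul] at h1
  simp only [_root_.sub_apply, _root_.smul_apply, ContinuousLinearMap.comp_apply]
  have h2 : R f - R' f = R f - (R f - 0 + ζ' • R (R' f) - ζ • R (R' f)) := by rw [h1]
  rw [h2, sub_smul]
  abel

/-- The solution is `u = R y` with `y = (1 - (ζ' - ζ) R)⁻¹ f`, given by the Neumann series. Applying
`P` to the equation for `y` shows that `y` stays in `ker P`. -/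
theorem IsReducedResolvent.solvable [CompleteSpace E]
    (hR : IsReducedResolvent A P ζ R) (hRK : ‖(ζ' - ζ) • R‖ < 1) (f : E)
    (hf : P f = 0) : ∃ u, (u, f + ζ' • u) ∈ A.graph ∧ P u = 0 := by
  obtain ⟨y, hxy, -⟩ := isUnit_iff_exists.1 (isUnit_one_sub_of_norm_lt_one hRK)
  have h1 : y f - (ζ' - ζ) • R (y f) = f := DFunLike.congr_fun hxy f
  have h2 : P (y f) = 0 := by
    have := congrArg P h1
    rwa [map_sub, map_smul, hR.proj, smul_zero, sub_zero, hf] at this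
  refine ⟨R (y f), ?_, hR.proj _⟩
  have h3 := hR.mem_graph (y f)
  rw [h2, sub_zero] at h3
  convert h3 using 2
  generalize y f = x at h1 ⊢
  rw [← h1, sub_smul]
  abel

theorem IsReducedResolvent.opNorm_le (hR : IsReducedResolvent A P ζ R)
    (hK : HasReducedBound A P ζ K) (hK0 : 0 ≤ K) : ‖R‖ ≤ K :=
  R.opNorm_le_bound hK0 (hR.norm_le hK)

/-- The method of continuity for reduced resolvents. -/
theorem exists_isReducedResolvent_of_segment [CompleteSpace E]
    (h : IsSimpleSpectralProjection A lam P ψ) (hK0 : 0 ≤ K)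
    (hK : ∀ t : ℝ, 0 ≤ t → t ≤ 1 → HasReducedBound A P (lam + t * (ζ - lam)) K) :
    ∃ R, IsReducedResolvent A P ζ R := by
  -- The segment from `lam` to `ζ` is cut into `N` steps shorter than `1/K`, so the uniform bound
  -- `K` lets each step be made by a Neumann series.
  obtain ⟨N, hN⟩ := exists_nat_gt (‖ζ - lam‖ * K)
  have hN0 : (0 : ℝ) < N := (by positivity : 0 ≤ ‖ζ - lam‖ * K).trans_lt hN
  have hN1 : (N : ℂ) ≠ 0 := by exact_mod_cast hN0.ne'
  have key : ∀ j : ℕ, j ≤ N → ∃ R, IsReducedResolvent A P (lam + (j / N : ℝ) * (ζ - lam)) R := by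
    intro j
    induction j with
    | zero =>
      intro _
      have h0 := hK 0 le_rfl zero_le_one
      simp only [Nat.cast_zero, zero_div, Complex.ofReal_zero, zero_mul, add_zero] at h0 ⊢
      refine exists_isReducedResolvent h h0 fun f hf => ?_
      obtain ⟨-, h2, -⟩ := h.2.2.2.2.2
      obtain ⟨u, hu, hu2⟩ := h2 f hf
      refine ⟨u, ?_, hu⟩
      have := (shift A lam).mem_graph u
      rw [hu2] at this
      exact mem_graph_shift.1 this
    | succ j ih =>
      intro hj
      obtain ⟨R, hR⟩ := ih (by omega)
      have hj1 : ((j + 1 : ℕ) : ℝ) / N ≤ 1 := by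
        rw [div_le_one hN0]
        exact_mod_cast hj
      have hj2 : (j : ℝ) / N ≤ 1 := by
        rw [div_le_one hN0]
        exact_mod_cast (by omega : j ≤ N)
      refine exists_isReducedResolvent h (hK _ (by positivity) hj1) fun f hf =>
        hR.solvable ?_ f hf
      have hRK := hR.opNorm_le (hK _ (by positivity) hj2) hK0
      have h3 : lam + (((j + 1 : ℕ) / N : ℝ) : ℂ) * (ζ - lam) -
          (lam + ((j / N : ℝ) : ℂ) * (ζ - lam)) = (ζ - lam) / N := by
        push_cast
        field_simp
        ring
      rw [h3, norm_smul, norm_div, Complex.norm_natCast]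
      calc ‖ζ - lam‖ / N * ‖R‖ ≤ ‖ζ - lam‖ / N * K := by gcongr
        _ < 1 := by
          rw [div_mul_eq_mul_div, div_lt_one hN0]
          exact hN
  obtain ⟨R, hR⟩ := key N le_rfl
  rw [div_self hN0.ne', Complex.ofReal_one, one_mul, add_sub_cancel] at hR
  exact ⟨R, hR⟩

/-- A point close to a point where the reduced resolvent exists, and different from the eigenvalue,
is not in the spectrum. -/
theorem IsReducedResolvent.notMem_opSpectrum [CompleteSpace E]
    (h : IsSimpleSpectralProjection A lam P ψ) (hR : IsReducedResolvent A P ζ R)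
    (hRK : ‖(ζ' - ζ) • R‖ < 1) (hne : ζ' ≠ lam) : ζ' ∉ opSpectrum A := by
  have hne' : lam - ζ' ≠ 0 := sub_ne_zero.2 hne.symm
  simp only [opSpectrum, Set.mem_ofPred_eq, not_not]
  refine ⟨fun _ _ => trivial, fun f _ => ?_, ?_⟩
  · have hPf : P (f - P f) = 0 := by rw [map_sub, h.idem, sub_self]
    -- Solve on `ker P` by perturbation and on `Ran P` by dividing by `lam - ζ'`.
    obtain ⟨u, hu, -⟩ := hR.solvable hRK (f - P f) hPf
    have h1 := A.graph.add_mem hu (A.graph.smul_mem (lam - ζ')⁻¹ (h.mem_graph_proj f))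
    have h2 : (u + (lam - ζ')⁻¹ • P f, f) ∈ (shift A ζ').graph := by
      rw [mem_graph_shift]
      have h5 : ∀ v, v = f - P f + ζ' • u + (lam - ζ')⁻¹ • lam • P f →
          (u + (lam - ζ')⁻¹ • P f, v) ∈ A.graph := by
        rintro v rfl
        exact h1
      refine h5 _ ?_
      have h3 : (lam - ζ')⁻¹ • lam • P f = P f + ζ' • (lam - ζ')⁻¹ • P f := by
        have h4 : (lam - ζ')⁻¹ • (lam - ζ') • P f = P f := by
          rw [smul_smul, inv_mul_cancel₀ hne', one_smul]
        conv_rhs => lhs; rw [← h4]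
        rw [smul_comm ζ', ← smul_add, ← add_smul, sub_add_cancel]
      rw [h3, smul_add]
      abel
    obtain ⟨h3, h4⟩ := mem_graph_iff_exists.1 h2
    exact ⟨⟨_, h3⟩, trivial, h4⟩
  · set q := ‖(ζ' - ζ) • R‖ with hq
    refine ⟨‖lam - ζ'‖⁻¹ * ‖P‖ + ‖R‖ * (1 + ‖P‖) / (1 - q), ?_⟩
    rintro ⟨x, hx⟩ -
    have hu := (shift A ζ').mem_graph ⟨x, hx⟩
    set f := shift A ζ' ⟨x, hx⟩ with hf
    rw [mem_graph_shift] at hu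
    change ‖x‖ ≤ _
    have h1 := h.comm_graph hu
    have h2 := LinearPMap.mem_graph_snd_inj _ h1 (h.mem_graph_proj x) rfl
    rw [map_add, map_smul] at h2
    have h3 : P x = (lam - ζ')⁻¹ • P f := by
      rw [eq_inv_smul_iff₀ hne', sub_smul, ← h2]
      abel
    have h4 : P (x - P x) = 0 := by rw [map_sub, h.idem, sub_self]
    have h5 := hR.unique _ _ (A.graph.sub_mem hu h1) h4
    have h6 : f + ζ' • x - P (f + ζ' • x) - ζ • (x - P x) =
        (f - P f) + (ζ' - ζ) • (x - P x) := by
      simp only [map_add, map_smul, sub_smul, smul_sub]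
      abel
    have h7 : ‖x - P x‖ ≤ ‖R‖ * ‖f - P f‖ + q * ‖x - P x‖ := by
      change R (f + ζ' • x - P (f + ζ' • x) - ζ • (x - P x)) = x - P x at h5
      conv_lhs => rw [← h5, h6, map_add]
      refine (norm_add_le _ _).trans (add_le_add (R.le_opNorm _) ?_)
      rw [map_smul]
      exact ((ζ' - ζ) • R).le_opNorm _
    have h8 : ‖f - P f‖ ≤ (1 + ‖P‖) * ‖f‖ := by
      refine (norm_sub_le _ _).trans ?_
      rw [add_mul, one_mul]
      gcongr
      exact P.le_opNorm f
    -- Since `q < 1`, the term `q ‖x - P x‖` in `h7` can be absorbed on the left.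
    have h9 : ‖x - P x‖ ≤ ‖R‖ * (1 + ‖P‖) / (1 - q) * ‖f‖ := by
      rw [div_mul_eq_mul_div, le_div_iff₀ (by linarith)]
      have : ‖R‖ * ‖f - P f‖ ≤ ‖R‖ * ((1 + ‖P‖) * ‖f‖) := by gcongr
      nlinarith
    have h10 : ‖P x‖ ≤ ‖lam - ζ'‖⁻¹ * ‖P‖ * ‖f‖ := by
      rw [h3, norm_smul, norm_inv, mul_assoc]
      gcongr
      exact P.le_opNorm f
    calc ‖x‖ = ‖P x + (x - P x)‖ := by rw [add_sub_cancel]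
      _ ≤ ‖P x‖ + ‖x - P x‖ := norm_add_le _ _
      _ ≤ _ := by
        rw [add_mul]
        exact add_le_add h10 h9

end ReducedResolvent

/-! ### Reduced resolvents of the particle Hamiltonian on `Q_j` -/

section Region

variable {A : Particle →ₗ.[ℂ] Particle} {lam : ℂ} {P : Particle →L[ℂ] Particle} {ψ : Particle}

/-- The case `δ = 0` of the weighted bounds suffices. The infimum defining `κ_j⁻¹` need not be
attained, so some bound below `2/ρ` is taken instead of `1/ρ`. -/
theorem hasReducedBound_of_kappaParam {δ₀ ρ : ℝ} (hδ₀ : 0 < δ₀) (hρ : 0 < ρ)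
    (h : ENNReal.ofReal ρ ≤ kappaParam A lam P δ₀) :
    ∀ ζ ∈ regionQ A lam, HasReducedBound A P ζ (2 / ρ) := by
  unfold kappaParam at h
  have h1 : sInf {K | IsReducedResolventBound A lam P δ₀ K} < ENNReal.ofReal (2 / ρ) := by
    rw [ENNReal.le_inv_iff_le_inv, ← ENNReal.ofReal_inv_of_pos hρ] at h
    refine h.trans_lt ((ENNReal.ofReal_lt_ofReal_iff (by positivity)).2 ?_)
    rw [inv_eq_one_div]
    gcongr
    norm_num
  obtain ⟨K, hK, hK2⟩ := sInf_lt_iff.1 h1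
  intro ζ hζ u f hu hPu
  obtain ⟨hu1, hu2⟩ := mem_graph_iff_exists.1 hu
  have h2 := hK 0 le_rfl hδ₀.le ζ hζ ⟨u, hu1⟩ f hPu (by rw [hu2, add_sub_cancel_right])
  have h3 : ‖u‖ₑ ≤ K * ‖f‖ₑ := by
    rw [Lp.enorm_def, Lp.enorm_def]
    simpa using h2
  have h4 : ‖u‖ₑ ≤ ENNReal.ofReal (2 / ρ * ‖f‖) := by
    rw [ENNReal.ofReal_mul (by positivity), ofReal_norm]
    exact h3.trans (by gcongr)
  rw [← ofReal_norm] at h4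
  exact (ENNReal.ofReal_le_ofReal_iff (by positivity)).1 h4

/-- `Q_j` is star-shaped about `λ_j`, as the method of continuity requires. -/
theorem segment_mem_regionQ {ζ : ℂ} (hζ : ζ ∈ regionQ A lam) (hgap : 0 ≤ gap A lam) {t : ℝ}
    (ht : 0 ≤ t) (ht1 : t ≤ 1) : lam + t * (ζ - lam) ∈ regionQ A lam := by
  obtain ⟨h1, h2⟩ := hζ
  rw [regionQ]
  constructor
  · rw [add_sub_cancel_left, Complex.re_ofReal_mul]
    rcases le_total 0 (ζ - lam).re with h | h <;> nlinarith
  · rw [add_sub_cancel_left, Complex.im_ofReal_mul, abs_mul, abs_of_nonneg ht]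
    nlinarith [abs_nonneg (ζ - lam).im]

/-- Stability under translation to the left: photons of total energy `r` shift the spectral
parameter to `ζ - r`, and the reduced resolvent stays available there. -/
theorem sub_mem_regionQ {ζ : ℂ} (hζ : ζ ∈ regionQ A lam) {t : ℝ} (ht : 0 ≤ t) :
    ζ - t ∈ regionQ A lam := by
  obtain ⟨h1, h2⟩ := hζ
  constructor
  · simp only [Complex.sub_re, Complex.ofReal_re] at *
    linarith
  · simpa using h2

theorem self_mem_regionQ (hgap : 0 ≤ gap A lam) : lam ∈ regionQ A lam := by
  constructor <;> simp <;> positivity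

theorem exists_reducedResolvents (h : IsSimpleSpectralProjection A lam P ψ)
    (hgap : 0 < gap A lam) {K : ℝ} (hK0 : 0 ≤ K)
    (hK : ∀ ζ ∈ regionQ A lam, HasReducedBound A P ζ K) :
    ∃ R : ℂ → Particle →L[ℂ] Particle, ∀ ζ ∈ regionQ A lam, IsReducedResolvent A P ζ (R ζ) := by
  have h1 : ∀ ζ : ℂ, ∃ R : Particle →L[ℂ] Particle,
      ζ ∈ regionQ A lam → IsReducedResolvent A P ζ R := by
    intro ζ
    by_cases hζ : ζ ∈ regionQ A lam
    · obtain ⟨R, hR⟩ := exists_isReducedResolvent_of_segment (ζ := ζ) h hK0 fun t ht ht1 =>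
        hK _ (segment_mem_regionQ hζ hgap.le ht ht1)
      exact ⟨R, fun _ => hR⟩
    · exact ⟨0, fun h => absurd h hζ⟩
  choose R hR using h1
  exact ⟨R, hR⟩

/-- The distance to the rest of the spectrum limits the size of `κ_j`. -/
theorem le_of_gap (h : IsSimpleSpectralProjection A lam P ψ) {M ρ : ℝ} (hρ : 0 < ρ)
    (hgap : 0 < gap A lam) (hM : gap A lam ≤ M)
    (hK : ∀ ζ ∈ regionQ A lam, HasReducedBound A P ζ (2 / ρ)) : ρ ≤ 2 * (M + 1) := by
  obtain ⟨R, hR⟩ := exists_reducedResolvents h hgap (by positivity) hK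
  by_contra! hlt
  -- `Metric.infDist` to the empty set is `0`, so a positive gap forces this set to be nonempty.
  have hne : {y : ℂ | ∃ ν ∈ opSpectrum A \ {lam}, ∃ t : ℝ, 0 ≤ t ∧ y = ν + t}.Nonempty := by
    by_contra hemp
    rw [Set.not_nonempty_iff_eq_empty] at hemp
    unfold gap at hgap
    rw [hemp, Metric.infDist_empty] at hgap
    exact lt_irrefl _ hgap
  obtain ⟨y, ⟨ν, ⟨hν, hν2⟩, t, ht, rfl⟩, hy⟩ := (Metric.infDist_lt_iff hne).1
    (show gap A lam < M + 1 by linarith)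
  -- The spectral point `ν` lies within `M + 1` of `lam - t ∈ Q_j`. There the reduced resolvent is
  -- bounded by `2/ρ`, which for `ρ > 2(M + 1)` excludes spectrum that close, apart from `lam`
  -- itself.
  have hmem : lam - t ∈ regionQ A lam := sub_mem_regionQ (self_mem_regionQ hgap.le) ht
  refine (hR _ hmem).notMem_opSpectrum (ζ' := ν) h ?_ hν2 hν
  have h2 : ‖ν - (lam - t)‖ < M + 1 := by
    rw [dist_comm, dist_eq_norm] at hy
    rwa [sub_sub_eq_add_sub]
  rw [norm_smul]
  calc ‖ν - (lam - t)‖ * ‖R (lam - t)‖ ≤ (M + 1) * (2 / ρ) := by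
        gcongr
        · linarith
        exact (hR _ hmem).opNorm_le (hK _ hmem) (by positivity)
    _ < 1 := by
      rw [mul_div_assoc', div_lt_one hρ]
      linarith

end Region

/-! ### Sums over permutations -/

section Permutations

/-- Two permutations with the same values on the first `m` places differ by one that fixes these
places, and there are `l!` of those. -/
theorem card_perm_restrict_le (m l : ℕ) (g : Fin m → Fin (m + l)) :
    (Finset.univ.filter fun σ : Equiv.Perm (Fin (m + l)) => σ ∘ Fin.castAdd l = g).card ≤
      l.factorial := by
  classical
  rcases Finset.eq_empty_or_nonempty
    (Finset.univ.filter fun σ : Equiv.Perm (Fin (m + l)) => σ ∘ Fin.castAdd l = g) with h | ⟨σ₀, h⟩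
  · rw [h]
    simp
  · simp only [Finset.mem_filter, Finset.mem_univ, true_and] at h
    let p : Fin (m + l) → Prop := fun i => m ≤ (i : ℕ)
    have hcard : Fintype.card {i // p i} = l := by
      rw [Fintype.card_subtype]
      have : (Finset.univ.filter p) = Finset.univ.map (Fin.natAddEmb m) := by
        ext i
        simp only [Finset.mem_filter, Finset.mem_univ, true_and, Finset.mem_map, p]
        refine ⟨fun hi => ⟨⟨i - m, by omega⟩, Fin.ext (by simp; omega)⟩, ?_⟩
        rintro ⟨j, rfl⟩
        simp
      rw [this, Finset.card_map, Finset.card_univ, Fintype.card_fin]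
    have h2 : Fintype.card {f : Equiv.Perm (Fin (m + l)) // ∀ a, ¬p a → f a = a} =
        l.factorial := by
      rw [← Fintype.card_congr (Equiv.Perm.subtypeEquivSubtypePerm p), Fintype.card_perm, hcard]
    rw [← h2, Fintype.card_subtype]
    refine Finset.card_le_card_of_injOn (fun σ => σ₀⁻¹ * σ) ?_ ?_
    · intro σ hσ
      simp only [Finset.coe_filter, Finset.mem_univ, true_and, Set.mem_ofPred_eq] at hσ ⊢
      intro a ha
      have ha' : (a : ℕ) < m := not_le.1 ha
      have h3 : a = Fin.castAdd l ⟨a, ha'⟩ := rfl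
      rw [Equiv.Perm.mul_apply, Equiv.Perm.inv_eq_iff_eq]
      rw [h3]
      exact (congrFun hσ _).trans (congrFun h _).symm
    · intro σ _ τ _ h3
      exact mul_left_cancel h3

theorem sum_perm_le (m l : ℕ) (f : (Fin m → Fin (m + l)) → ℝ≥0∞) :
    ∑ σ : Equiv.Perm (Fin (m + l)), f (σ ∘ Fin.castAdd l) ≤
      l.factorial * ∑ g : Fin m → Fin (m + l), if Function.Injective g then f g else 0 := by
  classical
  rw [← Finset.sum_fiberwise Finset.univ
    (fun σ : Equiv.Perm (Fin (m + l)) => (σ ∘ Fin.castAdd l : Fin m → Fin (m + l))),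
    Finset.mul_sum]
  refine Finset.sum_le_sum fun g _ => ?_
  by_cases hg : Function.Injective g
  · rw [if_pos hg]
    calc _ = ∑ σ ∈ Finset.univ.filter
            (fun σ : Equiv.Perm (Fin (m + l)) => σ ∘ Fin.castAdd l = g), f g := by
          refine Finset.sum_congr rfl fun σ hσ => ?_
          rw [(Finset.mem_filter.1 hσ).2]
      _ ≤ _ := by
          rw [Finset.sum_const, nsmul_eq_mul]
          gcongr
          exact_mod_cast card_perm_restrict_le m l g
  · rw [Finset.sum_eq_zero]
    · simp
    · intro σ hσ
      refine absurd ?_ hg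
      rw [← (Finset.mem_filter.1 hσ).2]
      exact σ.injective.comp (Fin.castAdd_injective m l)

/-- Dropping the injectivity constraint completes the sum over `g` to the expansion of the `m`-th
power. -/
theorem sum_perm_prod_le (m l : ℕ) (x : Fin (m + l) → ℝ≥0∞) :
    ∑ σ : Equiv.Perm (Fin (m + l)), ∏ j, x (σ (Fin.castAdd l j)) ≤
      l.factorial * (∑ i, x i) ^ m := by
  refine (sum_perm_le m l fun g => ∏ j, x (g j)).trans ?_
  rw [Fintype.sum_pow]
  gcongr with g
  split_ifs
  · exact le_rfl
  · exact zero_le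

/-- A refinement for the created photons: an injective selection meets each `a_j` at most once, so
the `a_j` enter only to the first power. This matters because the ultraviolet condition pays for a
single factor `1 + |k_j|` per coupling variable. -/
theorem sum_perm_prod_append_le (m l : ℕ) (a : Fin m → ℝ≥0∞) (b : Fin l → ℝ≥0∞) :
    ∑ σ : Equiv.Perm (Fin (m + l)), ∏ j, (Fin.append a b : _ → ℝ≥0∞) (σ (Fin.castAdd l j)) ≤
      l.factorial * ((m : ℝ≥0∞) ^ m * ((∏ j, (1 + a j)) * (1 + ∑ i, b i) ^ m)) := by
  classical
  refine (sum_perm_le m l fun g => ∏ j, (Fin.append a b : _ → ℝ≥0∞) (g j)).trans ?_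
  gcongr
  let a' : Fin (m + l) → ℝ≥0∞ := Fin.append (fun j => 1 + a j) fun _ => 1
  let b' : Fin (m + l) → ℝ≥0∞ := Fin.append (fun _ => 1) b
  have hab : ∀ i, (Fin.append a b : _ → ℝ≥0∞) i ≤ a' i * b' i := by
    intro i
    refine Fin.addCases (fun j => ?_) (fun j => ?_) i
    · simp [a', b']
    · simp [a', b']
  have ha : ∀ i, 1 ≤ a' i := by
    intro i
    refine Fin.addCases (fun j => ?_) (fun j => ?_) i
    · simp [a']
    · simp [a']
  have hprod : ∏ i, a' i = ∏ j, (1 + a j) := by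
    rw [Fin.prod_univ_add]
    simp [a']
  have hsum : ∑ i, b' i = m + ∑ i, b i := by
    rw [Fin.sum_univ_add]
    simp [b']
  have key : ∀ g : Fin m → Fin (m + l),
      (if Function.Injective g then ∏ j, (Fin.append a b : _ → ℝ≥0∞) (g j) else 0) ≤
        (∏ j, (1 + a j)) * ∏ j, b' (g j) := by
    intro g
    split_ifs with hg
    · calc ∏ j, (Fin.append a b : _ → ℝ≥0∞) (g j) ≤ ∏ j, (a' (g j) * b' (g j)) :=
            Finset.prod_le_prod' fun j _ => hab _
        _ = (∏ j, a' (g j)) * ∏ j, b' (g j) := Finset.prod_mul_distrib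
        _ ≤ _ := by
          refine mul_le_mul' ?_ le_rfl
          -- Injectivity of `g` is used here: the selected factors form a subproduct of the full
          -- product, whose factors are all at least `1`.
          rw [← hprod, ← Finset.prod_image (f := a') (s := Finset.univ) (g := g) hg.injOn]
          exact Finset.prod_le_prod_of_subset_of_one_le' (Finset.subset_univ _)
            fun i _ _ => ha i
    · exact zero_le
  calc _ ≤ ∑ g : Fin m → Fin (m + l), (∏ j, (1 + a j)) * ∏ j, b' (g j) :=
        Finset.sum_le_sum fun g _ => key g
    _ = (∏ j, (1 + a j)) * (m + ∑ i, b i) ^ m := by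
        rw [← Finset.mul_sum, ← Fintype.sum_pow, hsum]
    _ ≤ (∏ j, (1 + a j)) * (m * (1 + ∑ i, b i)) ^ m := by
        rcases Nat.eq_zero_or_pos m with rfl | hm
        · simp
        · gcongr
          rw [mul_add, mul_one]
          gcongr
          refine le_mul_of_one_le_left zero_le ?_
          exact_mod_cast hm
    _ = _ := by
        rw [mul_pow]
        ring

end Permutations

/-! ### Cauchy-Schwarz inequalities -/

section CauchySchwarz

theorem lintegral_mul_sq_le {α : Type*} [MeasurableSpace α] {ν : Measure α} {f g : α → ℝ≥0∞}
    (hf : AEMeasurable f ν) (hg : AEMeasurable g ν) :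
    (∫⁻ x, f x * g x ∂ν) ^ 2 ≤ (∫⁻ x, f x ^ 2 ∂ν) * ∫⁻ x, g x ^ 2 ∂ν := by
  have h := ENNReal.lintegral_mul_le_Lp_mul_Lq ν Real.HolderConjugate.two_two hf hg
  have h2 : ∀ x : ℝ≥0∞, (x ^ (1 / (2 : ℝ))) ^ 2 = x := by
    intro x
    rw [← ENNReal.rpow_natCast, ← ENNReal.rpow_mul]
    norm_num
  calc (∫⁻ x, f x * g x ∂ν) ^ 2 ≤ _ := pow_le_pow_left₀ zero_le h 2
    _ = _ := by
      rw [mul_pow, h2, h2]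
      simp only [ENNReal.rpow_two]

theorem sum_mul_sq_le {ι : Type*} (s : Finset ι) (f g : ι → ℝ≥0∞) :
    (∑ i ∈ s, f i * g i) ^ 2 ≤ (∑ i ∈ s, f i ^ 2) * ∑ i ∈ s, g i ^ 2 := by
  have h := ENNReal.inner_le_Lp_mul_Lq s f g Real.HolderConjugate.two_two
  have h2 : ∀ x : ℝ≥0∞, (x ^ (1 / (2 : ℝ))) ^ 2 = x := by
    intro x
    rw [← ENNReal.rpow_natCast, ← ENNReal.rpow_mul]
    norm_num
  calc (∑ i ∈ s, f i * g i) ^ 2 ≤ _ := pow_le_pow_left₀ zero_le h 2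
    _ = _ := by
      rw [mul_pow, h2, h2]
      simp only [ENNReal.rpow_two]

end CauchySchwarz

/-! ### Concatenation of photon variables -/

section Append

variable {d : ℕ}

theorem measurePreserving_append (d n l : ℕ) :
    MeasurePreserving (fun z : (Fin n → Photon d) × (Fin l → Photon d) => Fin.append z.1 z.2)
      ((photonMeasureN d n).prod (photonMeasureN d l)) (photonMeasureN d (n + l)) := by
  have h1 := measurePreserving_sumPiEquivProdPi_symm
    (X := fun _ : Fin n ⊕ Fin l => Photon d) (fun _ => photonMeasure d)
  have h2 := measurePreserving_piCongrLeft (fun _ : Fin (n + l) => photonMeasure d)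
    (finSumFinEquiv (m := n) (n := l))
  have h4 : (fun z : (Fin n → Photon d) × (Fin l → Photon d) => Fin.append z.1 z.2) =
      (MeasurableEquiv.piCongrLeft (fun _ : Fin (n + l) => Photon d)
        (finSumFinEquiv (m := n) (n := l))) ∘
        (MeasurableEquiv.sumPiEquivProdPi fun _ : Fin n ⊕ Fin l => Photon d).symm := by
    funext z
    obtain ⟨q, r⟩ := z
    funext i
    rw [Function.comp_apply, MeasurableEquiv.coe_piCongrLeft]
    refine Fin.addCases (fun j => ?_) (fun j => ?_) i
    · have := Equiv.piCongrLeft_apply_apply (P := fun _ : Fin (n + l) => Photon d)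
        (finSumFinEquiv (m := n) (n := l))
        ((MeasurableEquiv.sumPiEquivProdPi fun _ : Fin n ⊕ Fin l => Photon d).symm (q, r))
        (Sum.inl j)
      simpa [MeasurableEquiv.sumPiEquivProdPi, Equiv.sumPiEquivProdPi] using this.symm
    · have := Equiv.piCongrLeft_apply_apply (P := fun _ : Fin (n + l) => Photon d)
        (finSumFinEquiv (m := n) (n := l))
        ((MeasurableEquiv.sumPiEquivProdPi fun _ : Fin n ⊕ Fin l => Photon d).symm (q, r))
        (Sum.inr j)
      simpa [MeasurableEquiv.sumPiEquivProdPi, Equiv.sumPiEquivProdPi] using this.symm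
  rw [h4]
  exact h2.comp h1

/-- The first `m` and the last `l` of `m + l` photon variables. -/
def splitPhotons (d m l : ℕ) (k : Fin (m + l) → Photon d) :
    (Fin m → Photon d) × (Fin l → Photon d) := (k ∘ Fin.castAdd l, k ∘ Fin.natAdd m)

theorem measurePreserving_split (d m l : ℕ) :
    MeasurePreserving (splitPhotons d m l) (photonMeasureN d (m + l))
      ((photonMeasureN d m).prod (photonMeasureN d l)) := by
  have h1 := measurePreserving_sumPiEquivProdPi
    (X := fun _ : Fin m ⊕ Fin l => Photon d) (fun _ => photonMeasure d)
  have h2 := measurePreserving_piCongrLeft (fun _ : Fin (m + l) => photonMeasure d)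
    (finSumFinEquiv (m := m) (n := l))
  exact h1.comp h2.symm

theorem ae_split {m l : ℕ} {p : (Fin m → Photon d) × (Fin l → Photon d) → Prop}
    (h : ∀ᵐ z ∂(photonMeasureN d m).prod (photonMeasureN d l), p z) :
    ∀ᵐ k ∂photonMeasureN d (m + l), ∀ σ : Equiv.Perm (Fin (m + l)),
      p (splitPhotons d m l (k ∘ σ)) := by
  rw [Filter.eventually_all]
  exact fun σ => (quasiMeasurePreserving_perm d σ).ae
    ((measurePreserving_split d m l).quasiMeasurePreserving.ae h)

theorem ae_ne_zero (d n : ℕ) : ∀ᵐ k ∂photonMeasureN d n, ∀ j, (k j).1 ≠ 0 := by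
  rw [Filter.eventually_all]
  intro j
  have h1 : ∀ᵐ x ∂photonMeasure d, x.1 ≠ 0 :=
    Measure.quasiMeasurePreserving_fst.ae (Measure.ae_ne volume (0 : Pos))
  exact (Measure.quasiMeasurePreserving_eval (fun _ : Fin n => photonMeasure d) j).ae h1

/-- `∏ |k_j|`. -/
def momentumProd {n : ℕ} (k : Fin n → Photon d) : ℝ≥0∞ := ∏ j, ‖(k j).1‖ₑ

theorem measurable_momentumProd {n : ℕ} :
    Measurable (momentumProd : (Fin n → Photon d) → ℝ≥0∞) := by
  unfold momentumProd
  fun_prop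

theorem measurable_photonFactor {n : ℕ} :
    Measurable (photonFactor : (Fin n → Photon d) → ℝ) := by
  unfold photonFactor
  fun_prop

theorem momentumProd_ne_top {n : ℕ} (k : Fin n → Photon d) : momentumProd k ≠ ∞ :=
  ENNReal.prod_ne_top fun _ _ => enorm_ne_top

theorem momentumProd_ne_zero {n : ℕ} {k : Fin n → Photon d} (hk : ∀ j, (k j).1 ≠ 0) :
    momentumProd k ≠ 0 :=
  Finset.prod_ne_zero_iff.2 fun j _ => enorm_ne_zero.2 (hk j)

theorem photonFactor_enorm_sq {n : ℕ} {k : Fin n → Photon d} (hk : ∀ j, (k j).1 ≠ 0) :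
    ‖photonFactor k‖ₑ ^ 2 = (momentumProd k)⁻¹ := by
  have h1 : photonFactor k ^ 2 = (∏ j, ‖(k j).1‖)⁻¹ := by
    unfold photonFactor
    rw [← Finset.prod_pow, ← Finset.prod_inv_distrib]
    refine Finset.prod_congr rfl fun j _ => ?_
    rw [← Real.rpow_natCast, ← Real.rpow_mul (norm_nonneg _), ← Real.rpow_neg_one]
    norm_num
  have h2 : momentumProd k = ENNReal.ofReal (∏ j, ‖(k j).1‖) := by
    rw [momentumProd, ENNReal.ofReal_prod_of_nonneg fun _ _ => norm_nonneg _]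
    simp only [ofReal_norm]
  have h3 : 0 < ∏ j, ‖(k j).1‖ := Finset.prod_pos fun j _ => norm_pos_iff.2 (hk j)
  rw [h2, ← ENNReal.ofReal_inv_of_pos h3, ← h1, ← enorm_pow,
    Real.enorm_of_nonneg (sq_nonneg _)]

/-- `1 + |k₁| + … + |k_n|`. -/
def energyWeight {n : ℕ} (k : Fin n → Photon d) : ℝ≥0∞ := 1 + ∑ j, ‖(k j).1‖ₑ

theorem measurable_energyWeight {n : ℕ} :
    Measurable (energyWeight : (Fin n → Photon d) → ℝ≥0∞) := by
  unfold energyWeight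
  fun_prop

theorem energyWeight_eq {n : ℕ} (k : Fin n → Photon d) :
    energyWeight k = 1 + (photonEnergyNN k : ℝ≥0∞) := by
  simp [energyWeight, photonEnergyNN, enorm_eq_nnnorm]

end Append

/-! ### Strongly measurable families of operators -/

section OperatorFamilies

variable {Ω E F : Type*} [MeasurableSpace Ω] {ν : Measure Ω} [NormedAddCommGroup E]
  [NormedSpace ℂ E] [NormedAddCommGroup F] [NormedSpace ℂ F]

/-- Replace `f` by approximating simple functions, for which only finitely many fixed vectors occur,
and pass to the limit by continuity of each `W ω`. -/
theorem aestronglyMeasurable_clm_apply {W : Ω → E →L[ℂ] F} {f : Ω → E}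
    (hW : ∀ c, AEStronglyMeasurable (fun ω => W ω c) ν) (hf : AEStronglyMeasurable f ν) :
    AEStronglyMeasurable (fun ω => W ω (f ω)) ν := by
  obtain ⟨f', hf', hff'⟩ := hf
  have h1 : ∀ n, AEStronglyMeasurable (fun ω => W ω (hf'.approx n ω)) ν := by
    intro n
    have h2 : (fun ω => W ω (hf'.approx n ω)) = fun ω => ∑ c ∈ (hf'.approx n).range,
        Set.indicator (hf'.approx n ⁻¹' {c}) (fun ω => W ω c) ω := by
      funext ω
      rw [Finset.sum_eq_single (hf'.approx n ω)]
      · simp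
      · intro c _ hc
        exact Set.indicator_of_notMem (fun h : hf'.approx n ω = c => hc h.symm) _
      · intro h
        exact absurd (SimpleFunc.mem_range_self _ ω) h
    rw [h2]
    exact Finset.aestronglyMeasurable_fun_sum _ fun c _ =>
      (hW c).indicator ((hf'.approx n).measurableSet_fiber c)
  have h3 : AEStronglyMeasurable (fun ω => W ω (f' ω)) ν :=
    aestronglyMeasurable_of_tendsto_ae Filter.atTop h1
      (Filter.Eventually.of_forall fun ω => ((W ω).continuous.tendsto _).comp
        (hf'.tendsto_approx ω))
  refine h3.congr ?_
  filter_upwards [hff'] with ω hω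
  rw [hω]

theorem enorm_clm_le {L : E →L[ℂ] F} {c : ℝ≥0∞} (h : ∀ x, ‖L x‖ₑ ≤ c * ‖x‖ₑ) : ‖L‖ₑ ≤ c := by
  rcases eq_or_ne c ∞ with rfl | hc
  · exact le_top
  · lift c to ℝ≥0 using hc
    rw [enorm_eq_nnnorm]
    refine ENNReal.coe_le_coe.2 (L.opNNNorm_le_bound c fun x => ?_)
    have := h x
    rw [enorm_eq_nnnorm, enorm_eq_nnnorm, ← ENNReal.coe_mul] at this
    exact ENNReal.coe_le_coe.1 this

/-- A supremum over a countable dense set, so that the norm of a merely strongly measurable family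
is measurable. -/
theorem enorm_clm_eq_iSup [TopologicalSpace.SeparableSpace E] (L : E →L[ℂ] F) :
    ‖L‖ₑ = ⨆ i, ‖L (TopologicalSpace.denseSeq E i)‖ₑ / ‖TopologicalSpace.denseSeq E i‖ₑ := by
  refine le_antisymm (enorm_clm_le fun x => ?_) (iSup_le fun i => ?_)
  · set c := ⨆ i, ‖L (TopologicalSpace.denseSeq E i)‖ₑ / ‖TopologicalSpace.denseSeq E i‖ₑ with hc
    rcases eq_or_ne x 0 with rfl | hx
    · simp
    rcases eq_or_ne c ∞ with h | h
    · rw [h, ENNReal.top_mul (enorm_ne_zero.2 hx)]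
      exact le_top
    · have hclosed : IsClosed {x : E | ‖L x‖ₑ ≤ c * ‖x‖ₑ} :=
        isClosed_le (by fun_prop) ((ENNReal.continuous_const_mul h).comp continuous_enorm)
      have hd : Set.range (TopologicalSpace.denseSeq E) ⊆ {x : E | ‖L x‖ₑ ≤ c * ‖x‖ₑ} := by
        rintro _ ⟨i, rfl⟩
        rw [Set.mem_ofPred_eq]
        rcases eq_or_ne (TopologicalSpace.denseSeq E i) 0 with h0 | h0
        · simp [h0]
        · have h1 : ‖L (TopologicalSpace.denseSeq E i)‖ₑ / ‖TopologicalSpace.denseSeq E i‖ₑ ≤ c :=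
            le_iSup (fun i => ‖L (TopologicalSpace.denseSeq E i)‖ₑ /
              ‖TopologicalSpace.denseSeq E i‖ₑ) i
          exact (ENNReal.div_le_iff (enorm_ne_zero.2 h0) enorm_ne_top).1 h1
      have := hclosed.closure_subset_iff.2 hd
      rw [(TopologicalSpace.denseRange_denseSeq E).closure_range] at this
      exact this (Set.mem_univ x)
  · exact ENNReal.div_le_of_le_mul (L.le_opENorm _)

theorem aemeasurable_enorm_clm [TopologicalSpace.SeparableSpace E] {W : Ω → E →L[ℂ] F}
    (hW : ∀ c, AEStronglyMeasurable (fun ω => W ω c) ν) :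
    AEMeasurable (fun ω => ‖W ω‖ₑ) ν := by
  simp_rw [enorm_clm_eq_iSup]
  exact AEMeasurable.iSup fun i => ((hW _).enorm).div_const _

end OperatorFamilies

/-! ### Coupling functions as families of bounded operators -/

section Coupling

variable {d m n : ℕ}

/-- `w[k, q] ⟨p⟩^{-(2-m-n)}`, as a linear map. -/
def couplingLin (w : Coupling d m n) (hs : (0 : ℝ) ≤ 2 - m - n)
    (z : (Fin m → Photon d) × (Fin n → Photon d)) : Particle →ₗ[ℂ] Particle :=
  w z.1 z.2 ∘ₗ (besselOp (2 - m - n) hs : Particle →ₗ[ℂ] Particle).codRestrict _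
    (besselOp_mem (2 - m - n) hs)

open scoped Classical in
/-- `w[k, q] ⟨p⟩^{-(2-m-n)}`, as a bounded operator. -/
def couplingCLM (w : Coupling d m n) (hs : (0 : ℝ) ≤ 2 - m - n)
    (z : (Fin m → Photon d) × (Fin n → Photon d)) : Particle →L[ℂ] Particle :=
  if h : ∃ C : ℝ, ∀ f, ‖couplingLin w hs z f‖ ≤ C * ‖f‖ then
    (couplingLin w hs z).mkContinuousOfExistsBound h else 0

theorem couplingCLM_apply {w : Coupling d m n} {hs : (0 : ℝ) ≤ 2 - m - n}
    {z : (Fin m → Photon d) × (Fin n → Photon d)}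
    (h : ∃ C : ℝ, ∀ f, ‖couplingLin w hs z f‖ ≤ C * ‖f‖) (f : Particle) :
    couplingCLM w hs z f = couplingLin w hs z f := by
  rw [couplingCLM, dif_pos h]
  rfl

/-- Valid at every `z`: where the coupling is unbounded, `couplingCLM` takes the default value `0`.
-/
theorem enorm_couplingCLM_le (w : Coupling d m n) (hs : (0 : ℝ) ≤ 2 - m - n)
    (z : (Fin m → Photon d) × (Fin n → Photon d)) :
    ‖couplingCLM w hs z‖ₑ ≤ plainNorm w z.1 z.2 := by
  by_cases h : ∃ C : ℝ, ∀ f, ‖couplingLin w hs z f‖ ≤ C * ‖f‖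
  · refine enorm_clm_le fun f => ?_
    rw [couplingCLM_apply h]
    rcases eq_or_ne f 0 with rfl | hf
    · simp
    rw [← ENNReal.div_le_iff (enorm_ne_zero.2 hf) enorm_ne_top, ← sobolevENorm_besselOp _ hs f]
    exact le_iSup (fun u : sobolev (2 - m - n : ℝ) =>
      ‖w z.1 z.2 u‖ₑ / sobolevENorm (2 - m - n) u) ⟨_, besselOp_mem _ hs f⟩
  · refine enorm_clm_le fun f => ?_
    have h0 : couplingCLM w hs z f = 0 := by
      rw [couplingCLM, dif_neg h]
      rfl
    rw [h0, enorm_zero]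
    exact zero_le

/-- Take `δ = 0` and `v = u`. The remaining weight is a nonpositive power of a number in `(0, 1]`,
hence at least `1`; nonzero momenta keep that number positive. -/
theorem plain_le_weightedNorm {μ δ₀ : ℝ} (hμ : 0 ≤ μ) (hδ₀ : 0 ≤ δ₀) (w : Coupling d m n)
    {k : Fin m → Photon d} {q : Fin n → Photon d} (hk : ∀ j, (k j).1 ≠ 0)
    (hq : ∀ j, (q j).1 ≠ 0) (u : sobolev (2 - m - n : ℝ)) :
    ‖w k q u‖ₑ / sobolevENorm (2 - m - n) u ≤ weightedNorm μ δ₀ w k q := by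
  unfold weightedNorm
  refine le_iSup_of_le 0 (le_iSup_of_le (by simpa using hδ₀) (le_iSup_of_le u
    (le_iSup_of_le u (le_iSup_of_le (by simp) ?_))))
  gcongr
  rw [Lp.enorm_def]
  refine eLpNorm_mono fun x => ?_
  rw [norm_mul]
  refine le_mul_of_one_le_left (norm_nonneg _) ?_
  rw [Complex.norm_real, zero_mul, neg_zero, Real.exp_zero, mul_one]
  refine le_trans ?_ (le_abs_self _)
  have hj := one_le_japanese x
  have h1 : 0 < ∏ j, ‖(k j).1‖ ^ (1 / 2 : ℝ) :=
    Finset.prod_pos fun j _ => Real.rpow_pos_of_pos (norm_pos_iff.2 (hk j)) _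
  have h2 : 0 < ∏ j, ‖(q j).1‖ ^ (1 / 2 : ℝ) :=
    Finset.prod_pos fun j _ => Real.rpow_pos_of_pos (norm_pos_iff.2 (hq j)) _
  refine Real.one_le_rpow_of_pos_of_le_one_of_nonpos ?_ (min_le_right _ _) (by linarith)
  exact lt_min (by positivity) one_pos

/-- The weighted norm serves only qualitatively, to make almost every coupling operator bounded; all
sizes come from the ultraviolet integral. No sign of `M` is known here, whence the constant `max M
0`. -/
theorem ae_couplingLin_bounded {μ δ₀ M : ℝ} (hμ : 0 ≤ μ) (hδ₀ : 0 ≤ δ₀) {w : Coupling d m n}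
    (hs : (0 : ℝ) ≤ 2 - m - n) (hw : CouplingBound μ δ₀ M w) :
    ∀ᵐ z ∂(photonMeasureN d m).prod (photonMeasureN d n),
      ∃ C : ℝ, ∀ f, ‖couplingLin w hs z f‖ ≤ C * ‖f‖ := by
  have h1 : ∀ᵐ z ∂(photonMeasureN d m).prod (photonMeasureN d n),
      weightedNorm μ δ₀ w z.1 z.2 ≤ ENNReal.ofReal M := by
    filter_upwards [ENNReal.ae_le_essSup (fun z : (Fin m → Photon d) × (Fin n → Photon d) =>
      weightedNorm μ δ₀ w z.1 z.2)] with z hz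
    exact hz.trans hw.2.1
  filter_upwards [h1, Measure.quasiMeasurePreserving_fst.ae (ae_ne_zero d m),
    Measure.quasiMeasurePreserving_snd.ae (ae_ne_zero d n)] with z hz hk hq
  refine ⟨max M 0, fun f => ?_⟩
  rcases eq_or_ne f 0 with rfl | hf
  · simp
  have h2 := (plain_le_weightedNorm hμ hδ₀ w hk hq ⟨_, besselOp_mem _ hs f⟩).trans hz
  rw [sobolevENorm_besselOp, ENNReal.div_le_iff (enorm_ne_zero.2 hf) enorm_ne_top] at h2
  change ‖couplingLin w hs z f‖ₑ ≤ _ at h2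
  rw [← ofReal_norm, ← ofReal_norm, ← ENNReal.ofReal_mul' (norm_nonneg _)] at h2
  refine ((ENNReal.ofReal_le_ofReal_iff' (p := ‖couplingLin w hs z f‖)).1 h2).elim
    (fun h3 => h3.trans ?_) (fun h3 => h3.trans ?_)
  · gcongr
    exact le_max_left _ _
  · positivity

theorem aestronglyMeasurable_couplingCLM {μ δ₀ M : ℝ} (hμ : 0 ≤ μ) (hδ₀ : 0 ≤ δ₀)
    {w : Coupling d m n} (hs : (0 : ℝ) ≤ 2 - m - n) (hw : CouplingBound μ δ₀ M w) (f : Particle) :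
    AEStronglyMeasurable (fun z => couplingCLM w hs z f)
      ((photonMeasureN d m).prod (photonMeasureN d n)) := by
  refine (hw.1 ⟨_, besselOp_mem _ hs f⟩).congr ?_
  filter_upwards [ae_couplingLin_bounded hμ hδ₀ hs hw] with z hz
  rw [couplingCLM_apply hz]
  rfl

/-- `∏ (1 + |k_j|^{-1}) |k_j|^{-1}`. -/
def uvWeight {n : ℕ} (k : Fin n → Photon d) : ℝ≥0∞ :=
  ∏ j, (1 + ‖(k j).1‖ₑ⁻¹) * ‖(k j).1‖ₑ⁻¹

theorem measurable_uvWeight {n : ℕ} : Measurable (uvWeight : (Fin n → Photon d) → ℝ≥0∞) := by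
  unfold uvWeight
  fun_prop

theorem uvWeight_eq {n : ℕ} {k : Fin n → Photon d} (hk : ∀ j, (k j).1 ≠ 0) :
    uvWeight k = ENNReal.ofReal (∏ j, (1 + ‖(k j).1‖⁻¹) * ‖(k j).1‖⁻¹) := by
  rw [uvWeight, ENNReal.ofReal_prod_of_nonneg fun _ _ => by positivity]
  refine Finset.prod_congr rfl fun j _ => ?_
  have h1 : 0 < ‖(k j).1‖ := norm_pos_iff.2 (hk j)
  rw [ENNReal.ofReal_mul (by positivity), ENNReal.ofReal_add zero_le_one (by positivity),
    ENNReal.ofReal_inv_of_pos h1, ENNReal.ofReal_one, ofReal_norm]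

theorem lintegral_couplingCLM_le {M μ δ₀ : ℝ} {w : Coupling d m n} (hs : (0 : ℝ) ≤ 2 - m - n)
    (hw : CouplingBound μ δ₀ M w) :
    ∫⁻ z, uvWeight z.1 * uvWeight z.2 * ‖couplingCLM w hs z‖ₑ ^ 2
      ∂((photonMeasureN d m).prod (photonMeasureN d n)) ≤ ENNReal.ofReal M := by
  refine le_trans (lintegral_mono_ae ?_) hw.2.2
  filter_upwards [Measure.quasiMeasurePreserving_fst.ae (ae_ne_zero d m),
    Measure.quasiMeasurePreserving_snd.ae (ae_ne_zero d n)] with z hk hq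
  rw [uvWeight_eq hk, uvWeight_eq hq,
    ← ENNReal.ofReal_mul (Finset.prod_nonneg fun _ _ => by positivity)]
  gcongr
  exact enorm_couplingCLM_le w hs z

/-- `(1 + |k|) |k|^{-2} = (1 + |k|^{-1}) |k|^{-1}`: the weights produced by the two Cauchy-Schwarz
estimates are those of the ultraviolet integral. -/
theorem momentumProd_inv_sq_le {n : ℕ} {k : Fin n → Photon d} (hk : ∀ j, (k j).1 ≠ 0) :
    (∏ j, (1 + ‖(k j).1‖ₑ)) * (momentumProd k)⁻¹ ^ 2 = uvWeight k := by
  rw [momentumProd, ENNReal.prod_inv_distrib, ← Finset.prod_pow, ← Finset.prod_mul_distrib]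
  · refine Finset.prod_congr rfl fun j _ => ?_
    have h0 : ‖(k j).1‖ₑ ≠ 0 := enorm_ne_zero.2 (hk j)
    rw [add_mul, one_mul, add_mul, one_mul, sq, ← mul_assoc, ENNReal.mul_inv_cancel h0 enorm_ne_top,
      one_mul, add_comm]
  · intro i _ j _ _
    right
    exact enorm_ne_top

theorem momentumProd_inv_sq_le_uvWeight {n : ℕ} {k : Fin n → Photon d} (hk : ∀ j, (k j).1 ≠ 0) :
    (momentumProd k)⁻¹ ^ 2 ≤ uvWeight k := by
  rw [← momentumProd_inv_sq_le hk]
  refine le_mul_of_one_le_left zero_le ?_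
  exact Finset.one_le_prod' fun j _ => le_self_add

end Coupling

/-! ### Bounds on the annihilation and creation integrals -/

section Bounds

variable {d m n l : ℕ} {W : (Fin m → Photon d) × (Fin n → Photon d) → Particle →L[ℂ] Particle}
  {Θ : (Fin (n + l) → Photon d) → Particle} {C : ℝ≥0∞}

/-- The annihilation integral `∫ ∏|q_j|^{-1/2} W(k, q) Θ(q, r) dq`. -/
def annInt (W : (Fin m → Photon d) × (Fin n → Photon d) → Particle →L[ℂ] Particle)
    (Θ : (Fin (n + l) → Photon d) → Particle)
    (z : (Fin m → Photon d) × (Fin l → Photon d)) : Particle :=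
  ∫ q, ((photonFactor q : ℝ) : ℂ) • W (z.1, q) (Θ (Fin.append q z.2)) ∂photonMeasureN d n

theorem quasiMeasurePreserving_dropMiddle (d m n l : ℕ) : Measure.QuasiMeasurePreserving
    (fun p : ((Fin m → Photon d) × (Fin l → Photon d)) × (Fin n → Photon d) => (p.1.1, p.2))
    (((photonMeasureN d m).prod (photonMeasureN d l)).prod (photonMeasureN d n))
    ((photonMeasureN d m).prod (photonMeasureN d n)) :=
  MeasureTheory.QuasiMeasurePreserving.prodMap Measure.quasiMeasurePreserving_fst
    (Measure.QuasiMeasurePreserving.id _)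

theorem measurePreserving_append_swap (d n l : ℕ) : MeasurePreserving
    (fun p : (Fin l → Photon d) × (Fin n → Photon d) => Fin.append p.2 p.1)
    ((photonMeasureN d l).prod (photonMeasureN d n)) (photonMeasureN d (n + l)) :=
  (measurePreserving_append d n l).comp Measure.measurePreserving_swap

theorem quasiMeasurePreserving_appendLast (d m n l : ℕ) : Measure.QuasiMeasurePreserving
    (fun p : ((Fin m → Photon d) × (Fin l → Photon d)) × (Fin n → Photon d) =>
      Fin.append p.2 p.1.2)
    (((photonMeasureN d m).prod (photonMeasureN d l)).prod (photonMeasureN d n))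
    (photonMeasureN d (n + l)) :=
  (measurePreserving_append_swap d n l).quasiMeasurePreserving.comp
    (MeasureTheory.QuasiMeasurePreserving.prodMap Measure.quasiMeasurePreserving_snd
      (Measure.QuasiMeasurePreserving.id _))

section Measurability

variable (hW : ∀ c, AEStronglyMeasurable (fun z => W z c)
    ((photonMeasureN d m).prod (photonMeasureN d n)))
  (hΘ : AEStronglyMeasurable Θ (photonMeasureN d (n + l)))
include hW hΘ

theorem aestronglyMeasurable_integrand : AEStronglyMeasurable
    (fun p : ((Fin m → Photon d) × (Fin l → Photon d)) × (Fin n → Photon d) =>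
      ((photonFactor p.2 : ℝ) : ℂ) • W (p.1.1, p.2) (Θ (Fin.append p.2 p.1.2)))
    (((photonMeasureN d m).prod (photonMeasureN d l)).prod (photonMeasureN d n)) := by
  have h1 : AEStronglyMeasurable
      (fun p : ((Fin m → Photon d) × (Fin l → Photon d)) × (Fin n → Photon d) =>
        ((photonFactor p.2 : ℝ) : ℂ))
      (((photonMeasureN d m).prod (photonMeasureN d l)).prod (photonMeasureN d n)) :=
    (Complex.measurable_ofReal.comp
      (measurable_photonFactor.comp measurable_snd)).aestronglyMeasurable
  have h2 : AEStronglyMeasurable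
      (fun p : ((Fin m → Photon d) × (Fin l → Photon d)) × (Fin n → Photon d) =>
        W (p.1.1, p.2) (Θ (Fin.append p.2 p.1.2)))
      (((photonMeasureN d m).prod (photonMeasureN d l)).prod (photonMeasureN d n)) :=
    aestronglyMeasurable_clm_apply
      (fun c => (hW c).comp_quasiMeasurePreserving (quasiMeasurePreserving_dropMiddle d m n l))
      (hΘ.comp_quasiMeasurePreserving (quasiMeasurePreserving_appendLast d m n l))
  exact h1.smul h2

theorem aestronglyMeasurable_annInt : AEStronglyMeasurable (annInt W Θ)
    ((photonMeasureN d m).prod (photonMeasureN d l)) :=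
  (aestronglyMeasurable_integrand hW hΘ).integral_prod_right'

end Measurability

/-- `∫ ∏|q_j|^{-2} ‖W(k, q)‖² dq`. -/
def couplingMass (W : (Fin m → Photon d) × (Fin n → Photon d) → Particle →L[ℂ] Particle)
    (k : Fin m → Photon d) : ℝ≥0∞ :=
  ∫⁻ q, (momentumProd q)⁻¹ ^ 2 * ‖W (k, q)‖ₑ ^ 2 ∂photonMeasureN d n

/-- `∫ ∏|q_j| ‖Θ(q, r)‖² dq`. -/
def vectorMass (Θ : (Fin (n + l) → Photon d) → Particle) (r : Fin l → Photon d) : ℝ≥0∞ :=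
  ∫⁻ q, momentumProd q * ‖Θ (Fin.append q r)‖ₑ ^ 2 ∂photonMeasureN d n

theorem aemeasurable_couplingMass (hW : AEMeasurable (fun z => ‖W z‖ₑ)
    ((photonMeasureN d m).prod (photonMeasureN d n))) :
    AEMeasurable (couplingMass W) (photonMeasureN d m) :=
  AEMeasurable.lintegral_prod_right' (f := fun z : (Fin m → Photon d) × (Fin n → Photon d) =>
      (momentumProd z.2)⁻¹ ^ 2 * ‖W z‖ₑ ^ 2)
    (((measurable_momentumProd.comp measurable_snd).inv.pow_const 2).aemeasurable.mul
      (hW.pow_const 2))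

theorem aemeasurable_vectorMass (hΘ : AEStronglyMeasurable Θ (photonMeasureN d (n + l))) :
    AEMeasurable (vectorMass Θ) (photonMeasureN d l) :=
  AEMeasurable.lintegral_prod_right' (f := fun z : (Fin l → Photon d) × (Fin n → Photon d) =>
      momentumProd z.2 * ‖Θ (Fin.append z.2 z.1)‖ₑ ^ 2)
    ((measurable_momentumProd.comp measurable_snd).aemeasurable.mul
      ((hΘ.comp_quasiMeasurePreserving
        (measurePreserving_append_swap d n l).quasiMeasurePreserving).enorm.pow_const 2))

/-- Cauchy-Schwarz with the splitting `|q|^{-1/2} ‖W‖ ‖Θ‖ = (|q|^{-1} ‖W‖) (|q|^{1/2} ‖Θ‖)`: the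
infrared singularity goes to the coupling, and the vector receives a momentum that `H_f` controls.
-/
theorem lintegral_integrand_sq_le (hW : AEMeasurable (fun z => ‖W z‖ₑ)
      ((photonMeasureN d m).prod (photonMeasureN d n)))
    (hΘ : AEStronglyMeasurable Θ (photonMeasureN d (n + l))) :
    ∀ᵐ z ∂(photonMeasureN d m).prod (photonMeasureN d l),
      (∫⁻ q, ‖((photonFactor q : ℝ) : ℂ) • W (z.1, q) (Θ (Fin.append q z.2))‖ₑ
        ∂photonMeasureN d n) ^ 2 ≤ couplingMass W z.1 * vectorMass Θ z.2 := by
  have h1 := Measure.quasiMeasurePreserving_fst (μ := photonMeasureN d m)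
    (ν := photonMeasureN d l) |>.ae hW.aestronglyMeasurable.prodMk_left
  have h2 := Measure.quasiMeasurePreserving_snd (μ := photonMeasureN d m)
    (ν := photonMeasureN d l) |>.ae (hΘ.comp_quasiMeasurePreserving
        (measurePreserving_append_swap d n l).quasiMeasurePreserving).prodMk_left
  filter_upwards [h1, h2] with z hz1 hz2
  have hf : AEMeasurable (fun q => (momentumProd q)⁻¹ * ‖W (z.1, q)‖ₑ) (photonMeasureN d n) :=
    measurable_momentumProd.inv.aemeasurable.mul hz1.aemeasurable
  have hg : AEMeasurable (fun q => ‖photonFactor q‖ₑ * momentumProd q *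
      ‖Θ (Fin.append q z.2)‖ₑ) (photonMeasureN d n) :=
    (measurable_photonFactor.enorm.mul measurable_momentumProd).aemeasurable.mul hz2.enorm
  calc _ ≤ (∫⁻ q, ((momentumProd q)⁻¹ * ‖W (z.1, q)‖ₑ) * (‖photonFactor q‖ₑ * momentumProd q *
      ‖Θ (Fin.append q z.2)‖ₑ) ∂photonMeasureN d n) ^ 2 := by
        refine pow_le_pow_left₀ zero_le (lintegral_mono_ae ?_) 2
        filter_upwards [ae_ne_zero d n] with q hq
        have h0 := ENNReal.inv_mul_cancel (momentumProd_ne_zero hq) (momentumProd_ne_top q)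
        rw [enorm_smul]
        have h3 : ‖((photonFactor q : ℝ) : ℂ)‖ₑ = ‖photonFactor q‖ₑ := by
          rw [← ofReal_norm, Complex.norm_real, ofReal_norm]
        calc _ ≤ ‖photonFactor q‖ₑ * (‖W (z.1, q)‖ₑ * ‖Θ (Fin.append q z.2)‖ₑ) := by
              rw [h3]
              gcongr
              exact (W (z.1, q)).le_opENorm _
          _ = ((momentumProd q)⁻¹ * momentumProd q) *
                (‖photonFactor q‖ₑ * (‖W (z.1, q)‖ₑ * ‖Θ (Fin.append q z.2)‖ₑ)) := by
              rw [h0, one_mul]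
          _ = _ := by ring
    _ ≤ _ := lintegral_mul_sq_le hf hg
    _ = _ := by
        unfold couplingMass vectorMass
        congr 1
        · simp only [mul_pow]
        · refine lintegral_congr_ae ?_
          filter_upwards [ae_ne_zero d n] with q hq
          have h0 := ENNReal.inv_mul_cancel (momentumProd_ne_zero hq) (momentumProd_ne_top q)
          rw [mul_pow, mul_pow, photonFactor_enorm_sq hq, sq (momentumProd q), ← mul_assoc, h0,
            one_mul]

theorem lintegral_couplingMass_le (hW : AEMeasurable (fun z => ‖W z‖ₑ)
      ((photonMeasureN d m).prod (photonMeasureN d n)))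
    (hC : ∫⁻ z, uvWeight z.1 * uvWeight z.2 * ‖W z‖ₑ ^ 2
      ∂((photonMeasureN d m).prod (photonMeasureN d n)) ≤ C) :
    ∫⁻ k, uvWeight k * couplingMass W k ∂photonMeasureN d m ≤ C := by
  refine le_trans ?_ hC
  rw [lintegral_prod]
  · refine lintegral_mono_ae ?_
    filter_upwards [hW.aestronglyMeasurable.prodMk_left] with k hk
    rw [couplingMass, ← lintegral_const_mul'']
    · refine lintegral_mono_ae ?_
      filter_upwards [ae_ne_zero d n] with q hq
      rw [mul_assoc]
      gcongr
      exact momentumProd_inv_sq_le_uvWeight hq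
    · exact (measurable_momentumProd.inv.pow_const 2).aemeasurable.mul
        (hk.aemeasurable.pow_const 2)
  · exact ((measurable_uvWeight.comp measurable_fst).mul
      (measurable_uvWeight.comp measurable_snd)).aemeasurable.mul (hW.pow_const 2)

theorem ae_couplingMass_ne_top (hW : AEMeasurable (fun z => ‖W z‖ₑ)
      ((photonMeasureN d m).prod (photonMeasureN d n)))
    (hC : ∫⁻ k, uvWeight k * couplingMass W k ∂photonMeasureN d m ≤ C) (hC' : C ≠ ∞) :
    ∀ᵐ k ∂photonMeasureN d m, couplingMass W k ≠ ∞ := by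
  have h1 := ae_lt_top' (measurable_uvWeight.aemeasurable.mul (aemeasurable_couplingMass hW))
    (ne_top_of_le_ne_top hC' hC)
  filter_upwards [h1] with k hk h2
  simp only [Pi.mul_apply] at hk
  rw [h2, ENNReal.mul_top] at hk
  · exact lt_irrefl _ hk
  · refine Finset.prod_ne_zero_iff.2 fun j _ => mul_ne_zero (by simp) ?_
    exact ENNReal.inv_ne_zero.2 enorm_ne_top

theorem energyWeight_perm {N : ℕ} (k : Fin N → Photon d) (σ : Equiv.Perm (Fin N)) :
    energyWeight (k ∘ σ) = energyWeight k := by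
  rw [energyWeight_eq, energyWeight_eq, photonEnergyNN_perm]

theorem energyWeight_le_append (q : Fin n → Photon d) (r : Fin l → Photon d) :
    energyWeight r ≤ energyWeight (Fin.append q r) := by
  unfold energyWeight
  rw [Fin.sum_univ_add]
  simp only [Fin.append_right]
  gcongr
  exact le_add_self

/-- The number operator bound by symmetrisation. -/
theorem lintegral_vectorMass_le (p : ℕ)
    (hΘ : AEStronglyMeasurable Θ (photonMeasureN d (n + l)))
    (hsymm : ∀ σ : Equiv.Perm (Fin (n + l)), ∀ᵐ k ∂photonMeasureN d (n + l),
      ‖Θ (k ∘ σ)‖ₑ = ‖Θ k‖ₑ) :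
    ((n + l).factorial : ℝ≥0∞) * ∫⁻ r, energyWeight r ^ p * vectorMass Θ r ∂photonMeasureN d l ≤
      l.factorial * ∫⁻ k, energyWeight k ^ (p + n) * ‖Θ k‖ₑ ^ 2 ∂photonMeasureN d (n + l) := by
  set F : (Fin (n + l) → Photon d) → ℝ≥0∞ := fun k => energyWeight k ^ p * ‖Θ k‖ₑ ^ 2 with hF
  have hFm : AEMeasurable F (photonMeasureN d (n + l)) :=
    (measurable_energyWeight.pow_const p).aemeasurable.mul (hΘ.enorm.pow_const 2)
  have hhead : Measurable fun k : Fin (n + l) → Photon d =>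
      momentumProd (k ∘ Fin.castAdd l) :=
    measurable_momentumProd.comp (by fun_prop)
  have h1 : ∫⁻ r, energyWeight r ^ p * vectorMass Θ r ∂photonMeasureN d l ≤
      ∫⁻ k, momentumProd (k ∘ Fin.castAdd l) * F k ∂photonMeasureN d (n + l) := by
    have hmp := measurePreserving_append_swap d n l
    have hm1 : AEMeasurable (fun k => momentumProd (k ∘ Fin.castAdd l) * F k)
        (photonMeasureN d (n + l)) := hhead.aemeasurable.mul hFm
    have hm2 := hm1
    rw [← hmp.map_eq] at hm2
    have hm3 : AEMeasurable (fun p : (Fin l → Photon d) × (Fin n → Photon d) =>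
        momentumProd ((Fin.append p.2 p.1 : Fin (n + l) → Photon d) ∘ Fin.castAdd l) *
          F (Fin.append p.2 p.1)) ((photonMeasureN d l).prod (photonMeasureN d n)) :=
      hm1.comp_quasiMeasurePreserving hmp.quasiMeasurePreserving
    rw [← hmp.map_eq, lintegral_map' hm2 hmp.measurable.aemeasurable, lintegral_prod _ hm3]
    refine lintegral_mono_ae ?_
    filter_upwards [(hΘ.comp_quasiMeasurePreserving hmp.quasiMeasurePreserving).prodMk_left]
      with r hr
    rw [vectorMass, ← lintegral_const_mul'']
    · refine lintegral_mono fun q => ?_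
      have h2 : (Fin.append q r : Fin (n + l) → Photon d) ∘ Fin.castAdd l = q := by
        funext j
        simp
      simp only [hF, h2]
      rw [mul_left_comm]
      gcongr
      exact energyWeight_le_append q r
    · exact measurable_momentumProd.aemeasurable.mul (hr.enorm.pow_const 2)
  -- By symmetry of `‖Θ‖` any choice of the `n` annihilated photons gives the same integral. Summing
  -- over all `(n + l)!` permutations turns the product of momenta into at most `l!` times the
  -- `n`-th power of the energy.
  have h2 : ∀ σ : Equiv.Perm (Fin (n + l)),
      ∫⁻ k, momentumProd (k ∘ Fin.castAdd l) * F k ∂photonMeasureN d (n + l) =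
      ∫⁻ k, momentumProd ((k ∘ σ) ∘ Fin.castAdd l) * F k ∂photonMeasureN d (n + l) := by
    intro σ
    have hmp := measurePreserving_perm d σ
    have hm1 : AEMeasurable (fun k => momentumProd (k ∘ Fin.castAdd l) * F k)
        (photonMeasureN d (n + l)) := hhead.aemeasurable.mul hFm
    have hm2 := hm1
    rw [← hmp.map_eq] at hm2
    conv_lhs => rw [← hmp.map_eq, lintegral_map' hm2 hmp.measurable.aemeasurable]
    refine lintegral_congr_ae ?_
    filter_upwards [hsymm σ] with k hk
    simp only [hF, energyWeight_perm, hk]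
  calc _ ≤ ((n + l).factorial : ℝ≥0∞) *
        ∫⁻ k, momentumProd (k ∘ Fin.castAdd l) * F k ∂photonMeasureN d (n + l) := by gcongr
    _ = ∑ σ : Equiv.Perm (Fin (n + l)),
        ∫⁻ k, momentumProd ((k ∘ σ) ∘ Fin.castAdd l) * F k ∂photonMeasureN d (n + l) := by
        rw [← Finset.sum_congr rfl fun σ _ => h2 σ, Finset.sum_const, Finset.card_univ,
          Fintype.card_perm, Fintype.card_fin, nsmul_eq_mul]
    _ = ∫⁻ k, (∑ σ : Equiv.Perm (Fin (n + l)), momentumProd ((k ∘ σ) ∘ Fin.castAdd l)) * F k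
        ∂photonMeasureN d (n + l) := by
        rw [← lintegral_finsetSum']
        · simp only [Finset.sum_mul]
        · intro σ _
          exact (hhead.comp (measurePreserving_perm d σ).measurable).aemeasurable.mul hFm
    _ ≤ ∫⁻ k, l.factorial * (energyWeight k ^ (p + n) * ‖Θ k‖ₑ ^ 2)
        ∂photonMeasureN d (n + l) := by
        refine lintegral_mono fun k => ?_
        have h3 := sum_perm_prod_le n l fun i => ‖(k i).1‖ₑ
        calc _ ≤ (l.factorial * (∑ i, ‖(k i).1‖ₑ) ^ n) * F k := by
              gcongr
              exact h3
          _ ≤ (l.factorial * energyWeight k ^ n) * F k := by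
              gcongr
              exact le_add_self
          _ = _ := by
              simp only [hF]
              ring
    _ = _ := by
        rw [lintegral_const_mul' _ _ (ENNReal.natCast_ne_top _)]

end Bounds

/-! ### The components of `W Ψ` -/

section Components

variable {d m n l : ℕ} {W : (Fin m → Photon d) × (Fin n → Photon d) → Particle →L[ℂ] Particle}
  {Θ : (Fin (n + l) → Photon d) → Particle} {C : ℝ≥0∞}

/-- The combinatorial factor in the `(m + l)`-photon component of `W_{m,n} Ψ`. -/
def photonCoeff (m n l : ℕ) : ℝ :=
  Real.sqrt ((l + m).factorial / l.factorial) * Real.sqrt ((l + n).factorial / l.factorial) /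
    (l + m).factorial

/-- The `(m + l)`-photon component of `W_{m,n} Ψ`. -/
def createdVal (W : (Fin m → Photon d) × (Fin n → Photon d) → Particle →L[ℂ] Particle)
    (Θ : (Fin (n + l) → Photon d) → Particle) (k : Fin (m + l) → Photon d) : Particle :=
  ((photonCoeff m n l : ℝ) : ℂ) • ∑ σ : Equiv.Perm (Fin (m + l)),
    ((photonFactor (splitPhotons d m l (k ∘ σ)).1 : ℝ) : ℂ) •
      annInt W Θ (splitPhotons d m l (k ∘ σ))

theorem createdVal_perm (k : Fin (m + l) → Photon d) (τ : Equiv.Perm (Fin (m + l))) :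
    createdVal W Θ (k ∘ τ) = createdVal W Θ k := by
  unfold createdVal
  congr 1
  exact (Equiv.sum_comp (Equiv.mulLeft τ) fun σ : Equiv.Perm (Fin (m + l)) =>
    ((photonFactor (splitPhotons d m l (k ∘ σ)).1 : ℝ) : ℂ) •
      annInt W Θ (splitPhotons d m l (k ∘ σ)))

theorem aestronglyMeasurable_createdVal
    (hW : ∀ c, AEStronglyMeasurable (fun z => W z c)
      ((photonMeasureN d m).prod (photonMeasureN d n)))
    (hΘ : AEStronglyMeasurable Θ (photonMeasureN d (n + l))) :
    AEStronglyMeasurable (createdVal W Θ) (photonMeasureN d (m + l)) := by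
  suffices h : AEStronglyMeasurable (fun k => ∑ σ : Equiv.Perm (Fin (m + l)),
      ((photonFactor (splitPhotons d m l (k ∘ σ)).1 : ℝ) : ℂ) •
        annInt W Θ (splitPhotons d m l (k ∘ σ))) (photonMeasureN d (m + l)) from
    h.const_smul (((photonCoeff m n l : ℝ) : ℂ))
  refine Finset.aestronglyMeasurable_fun_sum _ fun σ _ => ?_
  have h1 : AEStronglyMeasurable (fun z : (Fin m → Photon d) × (Fin l → Photon d) =>
      ((photonFactor z.1 : ℝ) : ℂ) • annInt W Θ z)
      ((photonMeasureN d m).prod (photonMeasureN d l)) := by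
    have h2 : AEStronglyMeasurable (fun z : (Fin m → Photon d) × (Fin l → Photon d) =>
        ((photonFactor z.1 : ℝ) : ℂ)) ((photonMeasureN d m).prod (photonMeasureN d l)) :=
      (Complex.measurable_ofReal.comp
        (measurable_photonFactor.comp measurable_fst)).aestronglyMeasurable
    exact h2.smul (aestronglyMeasurable_annInt hW hΘ)
  exact (h1.comp_quasiMeasurePreserving
    (measurePreserving_split d m l).quasiMeasurePreserving).comp_quasiMeasurePreserving
      (quasiMeasurePreserving_perm d σ)

/-- The sum of `∏_{j < m} |k_{σ j}|` over all permutations. -/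
def permSum (m l : ℕ) (k : Fin (m + l) → Photon d) : ℝ≥0∞ :=
  ∑ σ : Equiv.Perm (Fin (m + l)), momentumProd (splitPhotons d m l (k ∘ σ)).1

theorem permSum_perm (k : Fin (m + l) → Photon d) (τ : Equiv.Perm (Fin (m + l))) :
    permSum m l (k ∘ τ) = permSum m l k :=
  Equiv.sum_comp (Equiv.mulLeft τ) fun σ : Equiv.Perm (Fin (m + l)) =>
    momentumProd (splitPhotons d m l (k ∘ σ)).1

theorem permSum_le (k : Fin (m + l) → Photon d) :
    permSum m l k ≤ l.factorial * ((m : ℝ≥0∞) ^ m *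
      ((∏ j, (1 + ‖((splitPhotons d m l k).1 j).1‖ₑ)) *
        energyWeight (splitPhotons d m l k).2 ^ m)) := by
  have h := sum_perm_prod_append_le m l (fun j => ‖((splitPhotons d m l k).1 j).1‖ₑ)
    fun j => ‖((splitPhotons d m l k).2 j).1‖ₑ
  have h1 : (Fin.append (fun j => ‖((splitPhotons d m l k).1 j).1‖ₑ)
      fun j => ‖((splitPhotons d m l k).2 j).1‖ₑ) = fun i => ‖(k i).1‖ₑ := by
    funext i
    refine Fin.addCases (fun j => ?_) (fun j => ?_) i <;> simp [splitPhotons]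
  rw [h1] at h
  exact h

/-- Weighted Cauchy-Schwarz with `a_i u_i = (b_i a_i) (b_i⁻¹ u_i)`. The weight `b_i` exactly
compensates the singular factor `a_i² = b_i⁻¹`, and the sum of the `b_i` will be controlled by the
photon energy. -/
theorem enorm_sum_sq_le {ι : Type*} (s : Finset ι) (a : ι → ℝ) (b : ι → ℝ≥0∞) (u : ι → Particle)
    (c : ι → ℝ≥0∞) (hb : ∀ i, b i ≠ 0) (hb' : ∀ i, b i ≠ ∞) (ha : ∀ i, ‖a i‖ₑ ^ 2 = (b i)⁻¹)
    (hu : ∀ i, ‖u i‖ₑ ^ 2 ≤ c i) :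
    ‖∑ i ∈ s, ((a i : ℝ) : ℂ) • u i‖ₑ ^ 2 ≤ (∑ i ∈ s, b i) * ∑ i ∈ s, (b i)⁻¹ ^ 2 * c i := by
  have h3 : ∀ i, ‖((a i : ℝ) : ℂ)‖ₑ = ‖a i‖ₑ := fun i => by
    rw [← ofReal_norm, Complex.norm_real, ofReal_norm]
  calc _ ≤ (∑ i ∈ s, (b i * ‖a i‖ₑ) * ((b i)⁻¹ * ‖u i‖ₑ)) ^ 2 := by
        gcongr
        refine (enorm_sum_le _ _).trans (Finset.sum_le_sum fun i _ => le_of_eq ?_)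
        calc ‖((a i : ℝ) : ℂ) • u i‖ₑ = (b i * (b i)⁻¹) * (‖a i‖ₑ * ‖u i‖ₑ) := by
              rw [enorm_smul, h3, ENNReal.mul_inv_cancel (hb i) (hb' i), one_mul]
          _ = _ := by ring
    _ ≤ _ := sum_mul_sq_le s _ _
    _ ≤ _ := by
        gcongr with i _ i _
        · rw [mul_pow, ha, sq, mul_assoc, ENNReal.mul_inv_cancel (hb i) (hb' i), mul_one]
        · rw [mul_pow]
          gcongr
          exact hu i

/-- The central field estimate. One Cauchy-Schwarz inequality treats the annihilated photons and
another the symmetrisation over created ones. Tonelli's theorem then separates the coupling from the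
vector, and the factorials cancel, so the bound is uniform in the photon number. -/
theorem lintegral_createdVal_sq_le
    (hW' : AEMeasurable (fun z => ‖W z‖ₑ) ((photonMeasureN d m).prod (photonMeasureN d n)))
    (hΘ : AEStronglyMeasurable Θ (photonMeasureN d (n + l)))
    (hC : ∫⁻ z, uvWeight z.1 * uvWeight z.2 * ‖W z‖ₑ ^ 2
      ∂((photonMeasureN d m).prod (photonMeasureN d n)) ≤ C)
    (hsymm : ∀ σ : Equiv.Perm (Fin (n + l)), ∀ᵐ k ∂photonMeasureN d (n + l),
      ‖Θ (k ∘ σ)‖ₑ = ‖Θ k‖ₑ) :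
    ∫⁻ k, ‖createdVal W Θ k‖ₑ ^ 2 ∂photonMeasureN d (m + l) ≤
      (m : ℝ≥0∞) ^ m * C * ∫⁻ k, energyWeight k ^ (m + n) * ‖Θ k‖ₑ ^ 2
        ∂photonMeasureN d (n + l) := by
  set T : (Fin m → Photon d) × (Fin l → Photon d) → ℝ≥0∞ := fun z =>
    (momentumProd z.1)⁻¹ ^ 2 * (couplingMass W z.1 * vectorMass Θ z.2) with hT
  have hTm : AEMeasurable T ((photonMeasureN d m).prod (photonMeasureN d l)) :=
    ((measurable_momentumProd.comp measurable_fst).inv.pow_const 2).aemeasurable.mul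
      (((aemeasurable_couplingMass hW').comp_quasiMeasurePreserving
        Measure.quasiMeasurePreserving_fst).mul
      ((aemeasurable_vectorMass hΘ).comp_quasiMeasurePreserving
        Measure.quasiMeasurePreserving_snd))
  have hTs : AEMeasurable (fun k => T (splitPhotons d m l k)) (photonMeasureN d (m + l)) :=
    hTm.comp_quasiMeasurePreserving (measurePreserving_split d m l).quasiMeasurePreserving
  have hmsplit : ∀ σ : Equiv.Perm (Fin (m + l)), Measurable fun k : Fin (m + l) → Photon d =>
      momentumProd (splitPhotons d m l (k ∘ σ)).1 := fun σ =>
    measurable_momentumProd.comp (by unfold splitPhotons; fun_prop)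
  have hSm : Measurable (permSum m l : (Fin (m + l) → Photon d) → ℝ≥0∞) := by
    unfold permSum
    exact Finset.measurable_fun_sum _ fun σ _ => hmsplit σ
  -- `enorm_sum_sq_le` with `b_σ` the product of the momenta of the created photons, combined with
  -- the bound on the annihilation integral.
  have hpt : ∀ᵐ k ∂photonMeasureN d (m + l), ‖createdVal W Θ k‖ₑ ^ 2 ≤
      ‖photonCoeff m n l‖ₑ ^ 2 * (permSum m l k *
        ∑ σ : Equiv.Perm (Fin (m + l)), T (splitPhotons d m l (k ∘ σ))) := by
    filter_upwards [ae_split (lintegral_integrand_sq_le hW' hΘ), ae_ne_zero d (m + l)] with k hk h0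
    have h3 : ‖((photonCoeff m n l : ℝ) : ℂ)‖ₑ = ‖photonCoeff m n l‖ₑ := by
      rw [← ofReal_norm, Complex.norm_real, ofReal_norm]
    rw [createdVal, enorm_smul, mul_pow, h3]
    gcongr
    have hne : ∀ σ : Equiv.Perm (Fin (m + l)), ∀ j, ((splitPhotons d m l (k ∘ σ)).1 j).1 ≠ 0 :=
      fun σ j => h0 _
    refine enorm_sum_sq_le Finset.univ _ _ _ _ (fun σ => momentumProd_ne_zero (hne σ))
      (fun σ => momentumProd_ne_top _) (fun σ => photonFactor_enorm_sq (hne σ)) fun σ => ?_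
    refine le_trans ?_ (hk σ)
    gcongr
    exact enorm_integral_le_lintegral_enorm _
  -- `permSum` and the measure are invariant under permutations, so all `(m + l)!` summands
  -- contribute equally.
  have hsym : ∀ σ : Equiv.Perm (Fin (m + l)),
      ∫⁻ k, permSum m l k * T (splitPhotons d m l (k ∘ σ)) ∂photonMeasureN d (m + l) =
      ∫⁻ k, permSum m l k * T (splitPhotons d m l k) ∂photonMeasureN d (m + l) := by
    intro σ
    have hmp := measurePreserving_perm d σ
    have hm1 : AEMeasurable (fun k => permSum m l k * T (splitPhotons d m l k))
        (photonMeasureN d (m + l)) := hSm.aemeasurable.mul hTs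
    rw [← hmp.map_eq] at hm1
    conv_rhs => rw [← hmp.map_eq, lintegral_map' hm1 hmp.measurable.aemeasurable]
    simp only [permSum_perm]
  -- In the bound on `permSum`, the factors `1 + |k_j|` complete `|k_j|^{-2}` to the ultraviolet
  -- weight and the power of the energy goes to the vector, so the integral factorises.
  have hmain : ∫⁻ k, permSum m l k * T (splitPhotons d m l k) ∂photonMeasureN d (m + l) ≤
      l.factorial * ((m : ℝ≥0∞) ^ m * (C *
        ∫⁻ r, energyWeight r ^ m * vectorMass Θ r ∂photonMeasureN d l)) := by
    calc _ ≤ ∫⁻ k, l.factorial * ((m : ℝ≥0∞) ^ m *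
          ((uvWeight (splitPhotons d m l k).1 * couplingMass W (splitPhotons d m l k).1) *
            (energyWeight (splitPhotons d m l k).2 ^ m * vectorMass Θ (splitPhotons d m l k).2)))
            ∂photonMeasureN d (m + l) := by
          refine lintegral_mono_ae ?_
          filter_upwards [ae_ne_zero d (m + l)] with k h0
          rw [← momentumProd_inv_sq_le (k := (splitPhotons d m l k).1) fun j => h0 _]
          refine (mul_le_mul_left (permSum_le k) _).trans (le_of_eq ?_)
          simp only [hT]
          ring
      _ = ∫⁻ z, l.factorial * ((m : ℝ≥0∞) ^ m *
          ((uvWeight z.1 * couplingMass W z.1) * (energyWeight z.2 ^ m * vectorMass Θ z.2)))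
            ∂(photonMeasureN d m).prod (photonMeasureN d l) := by
          have hmp := measurePreserving_split d m l
          have hm : AEMeasurable (fun z : (Fin m → Photon d) × (Fin l → Photon d) =>
              l.factorial * ((m : ℝ≥0∞) ^ m *
              ((uvWeight z.1 * couplingMass W z.1) * (energyWeight z.2 ^ m * vectorMass Θ z.2))))
              ((photonMeasureN d m).prod (photonMeasureN d l)) := by
            refine AEMeasurable.const_mul (AEMeasurable.const_mul (AEMeasurable.mul ?_ ?_) _) _
            · exact (measurable_uvWeight.aemeasurable.mul
                (aemeasurable_couplingMass hW')).comp_quasiMeasurePreserving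
                  Measure.quasiMeasurePreserving_fst
            · exact ((measurable_energyWeight.pow_const m).aemeasurable.mul
                (aemeasurable_vectorMass hΘ)).comp_quasiMeasurePreserving
                  Measure.quasiMeasurePreserving_snd
          rw [← hmp.map_eq] at hm
          rw [← hmp.map_eq, lintegral_map' hm hmp.measurable.aemeasurable]
      _ = l.factorial * ((m : ℝ≥0∞) ^ m *
          ((∫⁻ k, uvWeight k * couplingMass W k ∂photonMeasureN d m) *
            ∫⁻ r, energyWeight r ^ m * vectorMass Θ r ∂photonMeasureN d l)) := by
          rw [lintegral_const_mul' _ _ (ENNReal.natCast_ne_top _),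
            lintegral_const_mul' _ _ (ENNReal.pow_ne_top (ENNReal.natCast_ne_top _)),
            lintegral_prod_mul (f := fun k => uvWeight k * couplingMass W k)
              (g := fun r => energyWeight r ^ m * vectorMass Θ r)
              (measurable_uvWeight.aemeasurable.mul (aemeasurable_couplingMass hW'))
              ((measurable_energyWeight.pow_const m).aemeasurable.mul
                (aemeasurable_vectorMass hΘ))]
      _ ≤ _ := by
          gcongr
          exact lintegral_couplingMass_le hW' hC
  -- The factor `(m + l)!` from the symmetrisation and `l!` from `permSum` leave `(n + l)!/l!`,
  -- which `lintegral_vectorMass_le` cancels.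
  have hcoeff : ‖photonCoeff m n l‖ₑ ^ 2 * ((m + l).factorial * l.factorial) =
      ((n + l).factorial : ℝ≥0∞) / l.factorial := by
    have h1 : photonCoeff m n l ^ 2 * ((m + l).factorial * l.factorial) =
        ((n + l).factorial : ℝ) / l.factorial := by
      unfold photonCoeff
      rw [div_pow, mul_pow, Real.sq_sqrt (by positivity), Real.sq_sqrt (by positivity),
        add_comm m l, add_comm n l]
      have ha : ((l + m).factorial : ℝ) ≠ 0 := by positivity
      have hb : (l.factorial : ℝ) ≠ 0 := by positivity
      field_simp
    have h2 : ‖photonCoeff m n l‖ₑ = ENNReal.ofReal (photonCoeff m n l) := by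
      rw [Real.enorm_eq_ofReal]
      unfold photonCoeff
      positivity
    rw [h2, ← ENNReal.ofReal_pow (by unfold photonCoeff; positivity), ← ENNReal.ofReal_natCast,
      ← ENNReal.ofReal_natCast, ← ENNReal.ofReal_natCast, ← ENNReal.ofReal_mul (by positivity),
      ← ENNReal.ofReal_mul (by positivity), ← ENNReal.ofReal_div_of_pos (by positivity), h1]
  have hl0 : (l.factorial : ℝ≥0∞) ≠ 0 := Nat.cast_ne_zero.2 (Nat.factorial_ne_zero _)
  calc _ ≤ ∫⁻ k, ‖photonCoeff m n l‖ₑ ^ 2 * (permSum m l k *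
        ∑ σ : Equiv.Perm (Fin (m + l)), T (splitPhotons d m l (k ∘ σ)))
        ∂photonMeasureN d (m + l) := lintegral_mono_ae hpt
    _ = ‖photonCoeff m n l‖ₑ ^ 2 * ∑ σ : Equiv.Perm (Fin (m + l)),
        ∫⁻ k, permSum m l k * T (splitPhotons d m l (k ∘ σ)) ∂photonMeasureN d (m + l) := by
        rw [lintegral_const_mul' _ _ (ENNReal.pow_ne_top enorm_ne_top), ← lintegral_finsetSum']
        · simp only [Finset.mul_sum]
        · intro σ _
          exact hSm.aemeasurable.mul
            (hTs.comp_quasiMeasurePreserving (quasiMeasurePreserving_perm d σ))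
    _ = ‖photonCoeff m n l‖ₑ ^ 2 * ((m + l).factorial *
        ∫⁻ k, permSum m l k * T (splitPhotons d m l k) ∂photonMeasureN d (m + l)) := by
        rw [Finset.sum_congr rfl fun σ _ => hsym σ, Finset.sum_const, Finset.card_univ,
          Fintype.card_perm, Fintype.card_fin, nsmul_eq_mul]
    _ ≤ ‖photonCoeff m n l‖ₑ ^ 2 * ((m + l).factorial * (l.factorial * ((m : ℝ≥0∞) ^ m * (C *
        ∫⁻ r, energyWeight r ^ m * vectorMass Θ r ∂photonMeasureN d l)))) := by gcongr
    _ = (m : ℝ≥0∞) ^ m * C * ((l.factorial : ℝ≥0∞)⁻¹ * ((n + l).factorial *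
        ∫⁻ r, energyWeight r ^ m * vectorMass Θ r ∂photonMeasureN d l)) := by
        calc _ = (‖photonCoeff m n l‖ₑ ^ 2 * ((m + l).factorial * l.factorial)) *
              ((m : ℝ≥0∞) ^ m * (C *
              ∫⁻ r, energyWeight r ^ m * vectorMass Θ r ∂photonMeasureN d l)) := by ring
          _ = _ := by
              rw [hcoeff, div_eq_mul_inv]
              ring
    _ ≤ (m : ℝ≥0∞) ^ m * C * ((l.factorial : ℝ≥0∞)⁻¹ * (l.factorial *
        ∫⁻ k, energyWeight k ^ (m + n) * ‖Θ k‖ₑ ^ 2 ∂photonMeasureN d (n + l))) := by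
        have := lintegral_vectorMass_le m hΘ hsymm
        gcongr
    _ = _ := by
        rw [← mul_assoc (l.factorial : ℝ≥0∞)⁻¹,
          ENNReal.inv_mul_cancel hl0 (ENNReal.natCast_ne_top _), one_mul]

end Components

/-! ### The interaction terms on a common domain -/

instance instSeparableParticle : TopologicalSpace.SeparableSpace Particle := by
  have : Fact ((2 : ℝ≥0∞) ≠ ∞) := ⟨ENNReal.ofNat_ne_top⟩
  have : SecondCountableTopology (Lp ℂ 2 (volume : Measure Pos)) :=
    Lp.SecondCountableTopology
  change TopologicalSpace.SeparableSpace (Lp ℂ 2 (volume : Measure Pos))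
  infer_instance

section InteractionBound

variable {d m n : ℕ}

theorem one_le_energyWeight {N : ℕ} (k : Fin N → Photon d) : 1 ≤ energyWeight k := le_self_add

theorem ae_vectorMass_ne_top {l : ℕ} {Θ : (Fin (n + l) → Photon d) → Particle}
    (hΘ : AEStronglyMeasurable Θ (photonMeasureN d (n + l)))
    (hsymm : ∀ σ : Equiv.Perm (Fin (n + l)), ∀ᵐ k ∂photonMeasureN d (n + l),
      ‖Θ (k ∘ σ)‖ₑ = ‖Θ k‖ₑ)
    (hfin : ∫⁻ k, energyWeight k ^ (m + n) * ‖Θ k‖ₑ ^ 2 ∂photonMeasureN d (n + l) ≠ ∞) :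
    ∀ᵐ r ∂photonMeasureN d l, vectorMass Θ r ≠ ∞ := by
  have h1 := lintegral_vectorMass_le 0 hΘ hsymm
  simp only [pow_zero, one_mul, zero_add] at h1
  have h2 : ∫⁻ k, energyWeight k ^ n * ‖Θ k‖ₑ ^ 2 ∂photonMeasureN d (n + l) ≠ ∞ := by
    refine ne_top_of_le_ne_top hfin (lintegral_mono fun k => ?_)
    gcongr
    · exact one_le_energyWeight k
    · omega
  have h3 : ∫⁻ r, vectorMass Θ r ∂photonMeasureN d l ≠ ∞ := by
    intro h
    rw [h, ENNReal.mul_top (Nat.cast_ne_zero.2 (Nat.factorial_ne_zero _)), top_le_iff] at h1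
    exact ENNReal.mul_ne_top (ENNReal.natCast_ne_top _) h2 h1
  filter_upwards [ae_lt_top' (aemeasurable_vectorMass hΘ) h3] with r hr
  exact hr.ne

/-- Extends data given at photon numbers `m + l` by zero to all `N`. Stating this as existence keeps
the casts between `Fin N` and `Fin (m + l)` out of the later arguments. -/
theorem exists_shifted {α β : Type*} [Zero β] (m : ℕ) (G : ∀ l, (Fin (m + l) → α) → β) :
    ∃ F : ∀ N, (Fin N → α) → β, (∀ l, F (m + l) = G l) ∧ ∀ N < m, F N = 0 := by
  have h : ∀ N, ∃ f : (Fin N → α) → β,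
      (∀ l (h : m + l = N), ∀ k, f k = G l (k ∘ Fin.cast h)) ∧ (N < m → f = 0) := by
    intro N
    by_cases hN : m ≤ N
    · obtain ⟨l, rfl⟩ := Nat.exists_eq_add_of_le hN
      refine ⟨G l, fun l' h k => ?_, fun h => absurd h (by omega)⟩
      obtain rfl : l' = l := by omega
      rfl
    · exact ⟨0, fun l h => absurd h (by omega), fun _ => rfl⟩
  choose F hF hF0 using h
  exact ⟨F, fun l => funext fun k => hF _ l rfl k, hF0⟩

theorem mem_graph_interactionTerm {w : Coupling d m n} {u v : Fock d Particle} :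
    (u, v) ∈ (interactionTerm w).graph ↔ InteractionRel w u v := by
  refine mem_graph_toLinearPMap fun v (hv : InteractionRel w 0 v) => fock_eq_zero fun N => ?_
  by_cases hN : m ≤ N
  · obtain ⟨l, rfl⟩ := Nat.exists_eq_add_of_le hN
    filter_upwards [hv.1 l, interactionValue_zero w l] with k h1 h2
    rw [h1.2, h2]
  · exact hv.2 N (by omega)

variable {w : Coupling d m n} {hs : (0 : ℝ) ≤ 2 - m - n} {μ δ₀ M : ℝ} {Ψ : Fock d Particle}
  {Θ : ∀ N, (Fin N → Photon d) → Particle}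

/-- Writing `Ψ = ⟨p⟩^{-s} Θ` replaces the coupling by the bounded family `couplingCLM`; finiteness
of the two Cauchy-Schwarz factors makes the annihilation integral absolutely convergent. -/
theorem ae_annihilable (hμ : 0 ≤ μ) (hδ₀ : 0 ≤ δ₀) (hw : CouplingBound μ δ₀ M w) (l : ℕ)
    (hΘ : AEStronglyMeasurable (Θ (n + l)) (photonMeasureN d (n + l)))
    (hsymm : ∀ σ : Equiv.Perm (Fin (n + l)), ∀ᵐ k ∂photonMeasureN d (n + l),
      ‖Θ (n + l) (k ∘ σ)‖ₑ = ‖Θ (n + l) k‖ₑ)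
    (hΨ : ∀ᵐ k ∂photonMeasureN d (n + l), sector Ψ (n + l) k = besselOp _ hs (Θ (n + l) k))
    (hfin : ∫⁻ k, energyWeight k ^ (m + n) * ‖Θ (n + l) k‖ₑ ^ 2 ∂photonMeasureN d (n + l) ≠ ∞) :
    ∀ᵐ z ∂(photonMeasureN d m).prod (photonMeasureN d l), Annihilable w Ψ z.1 z.2 ∧
      ∫ q, annihilated w Ψ z.1 z.2 q ∂photonMeasureN d n =
        annInt (couplingCLM w hs) (Θ (n + l)) z := by
  have hW := aestronglyMeasurable_couplingCLM hμ hδ₀ hs hw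
  have hW' := aemeasurable_enorm_clm hW
  have hC := lintegral_couplingCLM_le hs hw
  have h1 := Measure.quasiMeasurePreserving_fst (μ := photonMeasureN d m)
    (ν := photonMeasureN d l) |>.ae (Measure.ae_ae_of_ae_prod (ae_couplingLin_bounded hμ hδ₀ hs hw))
  have h2 := Measure.quasiMeasurePreserving_snd (μ := photonMeasureN d m)
    (ν := photonMeasureN d l) |>.ae (Measure.ae_ae_of_ae_prod
      ((measurePreserving_append_swap d n l).quasiMeasurePreserving.ae hΨ))
  have h3 := Measure.quasiMeasurePreserving_fst (μ := photonMeasureN d m)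
    (ν := photonMeasureN d l) |>.ae
      (ae_couplingMass_ne_top hW' (lintegral_couplingMass_le hW' hC) ENNReal.ofReal_ne_top)
  have h4 := Measure.quasiMeasurePreserving_snd (μ := photonMeasureN d m)
    (ν := photonMeasureN d l) |>.ae (ae_vectorMass_ne_top hΘ hsymm hfin)
  filter_upwards [h1, h2, h3, h4, lintegral_integrand_sq_le hW' hΘ,
    (aestronglyMeasurable_integrand hW hΘ).prodMk_left] with z hz1 hz2 hz3 hz4 hz5 hz6
  have hint : Integrable (fun q => ((photonFactor q : ℝ) : ℂ) •
      couplingCLM w hs (z.1, q) (Θ (n + l) (Fin.append q z.2))) (photonMeasureN d n) := by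
    refine ⟨hz6, ?_⟩
    rw [HasFiniteIntegral, lt_top_iff_ne_top]
    intro h
    rw [h, ENNReal.top_pow two_ne_zero, top_le_iff] at hz5
    exact ENNReal.mul_ne_top hz3 hz4 hz5
  have heq : annihilated w Ψ z.1 z.2 =ᵐ[photonMeasureN d n] fun q => ((photonFactor q : ℝ) : ℂ) •
      couplingCLM w hs (z.1, q) (Θ (n + l) (Fin.append q z.2)) := by
    filter_upwards [hz1, hz2] with q hq1 hq2
    have hmem := besselOp_mem _ hs (Θ (n + l) (Fin.append q z.2))
    simp only [annihilated]
    rw [hq2, valueOrZero_of_mem (couplingOp w z.1 q) hmem, couplingCLM_apply hq1]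
    rfl
  refine ⟨⟨?_, (integrable_congr heq).2 hint⟩, integral_congr_ae heq⟩
  filter_upwards [hz2] with q hq
  rw [hq]
  exact besselOp_mem _ hs _

theorem interactionValue_eq_createdVal {l : ℕ}
    {W : (Fin m → Photon d) × (Fin n → Photon d) → Particle →L[ℂ] Particle}
    {T : (Fin (n + l) → Photon d) → Particle} {k : Fin (m + l) → Photon d}
    (h : ∀ σ : Equiv.Perm (Fin (m + l)),
      ∫ q, annihilated w Ψ (splitPhotons d m l (k ∘ σ)).1 (splitPhotons d m l (k ∘ σ)).2 q
        ∂photonMeasureN d n = annInt W T (splitPhotons d m l (k ∘ σ))) :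
    interactionValue w Ψ l k = createdVal W T k := by
  unfold interactionValue createdVal photonCoeff
  congr 1
  refine Finset.sum_congr rfl fun σ _ => ?_
  rw [← h σ]
  rfl

/-- The values of `W_{m,n} Ψ` form a vector of the Fock space. -/
theorem exists_shiftedVector {W : (Fin m → Photon d) × (Fin n → Photon d) → Particle →L[ℂ] Particle}
    {C : ℝ≥0∞} (hC' : C ≠ ∞) (hW : ∀ c, AEStronglyMeasurable (fun z => W z c)
      ((photonMeasureN d m).prod (photonMeasureN d n)))
    (hC : ∫⁻ z, uvWeight z.1 * uvWeight z.2 * ‖W z‖ₑ ^ 2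
      ∂((photonMeasureN d m).prod (photonMeasureN d n)) ≤ C)
    (hΘ : ∀ N, AEStronglyMeasurable (Θ N) (photonMeasureN d N))
    (hsymm : ∀ N (σ : Equiv.Perm (Fin N)), ∀ᵐ k ∂photonMeasureN d N, ‖Θ N (k ∘ σ)‖ₑ = ‖Θ N k‖ₑ)
    {X : ℝ≥0∞} (hX : X ≠ ∞)
    (hfin : ∑' N, ∫⁻ k, energyWeight k ^ (m + n) * ‖Θ N k‖ₑ ^ 2 ∂photonMeasureN d N ≤ X) :
    ∃ v : Fock d Particle, (∀ l, ∀ᵐ k ∂photonMeasureN d (m + l),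
        sector v (m + l) k = createdVal W (Θ (n + l)) k) ∧
      (∀ N < m, ∀ᵐ k ∂photonMeasureN d N, sector v N k = 0) ∧
      ‖v‖ₑ ^ 2 ≤ (m : ℝ≥0∞) ^ m * C * X := by
  have hW' := aemeasurable_enorm_clm hW
  obtain ⟨F, hF, hF0⟩ := exists_shifted m fun l =>
    createdVal (m := m) (n := n) (l := l) W (Θ (n + l))
  have hsum : ∑' N, ∫⁻ k, ‖F N k‖ₑ ^ 2 ∂photonMeasureN d N ≤ (m : ℝ≥0∞) ^ m * C * X := by
    have hsupp : Function.support (fun N => ∫⁻ k, ‖F N k‖ₑ ^ 2 ∂photonMeasureN d N) ⊆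
        Set.range fun l => m + l := by
      intro N hN
      by_contra h
      refine hN ?_
      have hlt : N < m := by
        by_contra h'
        obtain ⟨l, rfl⟩ := Nat.exists_eq_add_of_le (not_lt.1 h')
        exact h ⟨l, rfl⟩
      simp [hF0 N hlt]
    rw [← (add_right_injective m).tsum_eq hsupp]
    calc _ ≤ ∑' l, (m : ℝ≥0∞) ^ m * C *
            ∫⁻ k, energyWeight k ^ (m + n) * ‖Θ (n + l) k‖ₑ ^ 2 ∂photonMeasureN d (n + l) := by
            refine ENNReal.tsum_le_tsum fun l => ?_
            rw [hF l]
            exact lintegral_createdVal_sq_le hW' (hΘ _) hC (hsymm _)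
        _ ≤ _ := by
            rw [ENNReal.tsum_mul_left]
            gcongr
            exact (ENNReal.tsum_comp_le_tsum_of_injective (add_right_injective n) _).trans hfin
  have hm : ∀ N, AEStronglyMeasurable (F N) (photonMeasureN d N) := by
    intro N
    by_cases hN : m ≤ N
    · obtain ⟨l, rfl⟩ := Nat.exists_eq_add_of_le hN
      rw [hF]
      exact aestronglyMeasurable_createdVal hW (hΘ _)
    · rw [hF0 N (by omega)]
      exact aestronglyMeasurable_const
  have hs : ∀ N (σ : Equiv.Perm (Fin N)), ∀ᵐ k ∂photonMeasureN d N, F N (k ∘ σ) = F N k := by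
    intro N σ
    by_cases hN : m ≤ N
    · obtain ⟨l, rfl⟩ := Nat.exists_eq_add_of_le hN
      rw [hF]
      exact Filter.Eventually.of_forall fun k => createdVal_perm k σ
    · rw [hF0 N (by omega)]
      exact Filter.Eventually.of_forall fun k => rfl
  obtain ⟨v, hv⟩ := exists_fock hm hs (ne_top_of_le_ne_top (ENNReal.mul_ne_top (ENNReal.mul_ne_top
    (ENNReal.pow_ne_top (ENNReal.natCast_ne_top _)) hC') hX) hsum)
  refine ⟨v, fun l => ?_, fun N hN => ?_, ?_⟩
  · rw [← hF]
    exact hv (m + l)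
  · filter_upwards [hv N] with k hk
    rw [hk, hF0 N hN]
    rfl
  · rw [fock_enorm_sq]
    refine le_trans (le_of_eq ?_) hsum
    refine tsum_congr fun N => lintegral_congr_ae ?_
    filter_upwards [hv N] with k hk
    rw [hk]

/-- The interaction term `W_{m,n}` is bounded relative to `⟨p⟩^{2-m-n} (1 + H_f)^{(m+n)/2}`. -/
theorem exists_interactionTerm (hμ : 0 ≤ μ) (hδ₀ : 0 ≤ δ₀) (hw : CouplingBound μ δ₀ M w)
    (hΘ : ∀ N, AEStronglyMeasurable (Θ N) (photonMeasureN d N))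
    (hΨ : ∀ N, ∀ᵐ k ∂photonMeasureN d N, sector Ψ N k = besselOp _ hs (Θ N k))
    {X : ℝ≥0∞} (hX : X ≠ ∞)
    (hfin : ∑' N, ∫⁻ k, energyWeight k ^ (m + n) * ‖Θ N k‖ₑ ^ 2 ∂photonMeasureN d N ≤ X) :
    ∃ v, (Ψ, v) ∈ (interactionTerm w).graph ∧
      ‖v‖ₑ ^ 2 ≤ (m : ℝ≥0∞) ^ m * ENNReal.ofReal M * X := by
  -- The symmetry of `Ψ` passes to `Θ` because `⟨p⟩^{-s}` is injective.
  have hsymm : ∀ N (σ : Equiv.Perm (Fin N)), ∀ᵐ k ∂photonMeasureN d N,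
      ‖Θ N (k ∘ σ)‖ₑ = ‖Θ N k‖ₑ := by
    intro N σ
    filter_upwards [sector_symm Ψ N σ, hΨ N, (quasiMeasurePreserving_perm d σ).ae (hΨ N)]
      with k h1 h2 h3
    rw [h2, h3] at h1
    rw [besselOp_injective _ hs h1]
  have hfin' : ∀ N, ∫⁻ k, energyWeight k ^ (m + n) * ‖Θ N k‖ₑ ^ 2 ∂photonMeasureN d N ≠ ∞ :=
    fun N => ENNReal.ne_top_of_tsum_ne_top (ne_top_of_le_ne_top hX hfin) N
  have hW := aestronglyMeasurable_couplingCLM hμ hδ₀ hs hw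
  have hC := lintegral_couplingCLM_le hs hw
  have hex := exists_shiftedVector (W := couplingCLM w hs) (Θ := Θ) (C := ENNReal.ofReal M)
    ENNReal.ofReal_ne_top hW hC hΘ hsymm hX hfin
  obtain ⟨v, hv, hv0, hvb⟩ := hex
  refine ⟨v, mem_graph_interactionTerm.2 ⟨fun l => ?_, hv0⟩, hvb⟩
  filter_upwards [hv l, ae_split (ae_annihilable hμ hδ₀ hw l (hΘ _) (hsymm _) (hΨ _)
      (hfin' _))] with k h1 h2
  refine ⟨fun σ => (h2 σ).1, ?_⟩
  rw [h1]
  exact (interactionValue_eq_createdVal fun σ => (h2 σ).2).symm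

end InteractionBound

/-! ### Bounds for the interaction on the ranges of fibre operators. -/

section InteractionFibre

variable {d m n : ℕ} {L : ℝ≥0 → Particle →L[ℂ] Particle} {b μ δ₀ M : ℝ}

/-- Split `⟨p⟩^{-2} = ⟨p⟩^{-s} ⟨p⟩^{-t}`: the coupling consumes `s = 2 - m - n` powers, and the
remaining `t = m + n` powers are left to offset the growth in the photon energy. -/
theorem interactionTerm_fibre {w : Coupling d m n} (hμ : 0 ≤ μ) (hδ₀ : 0 ≤ δ₀)
    (hw : CouplingBound μ δ₀ M w) {s t : ℝ} (hst : s = 2 - m - n) (hs : 0 ≤ s) (ht : 0 ≤ t)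
    (hts : s + t = 2) (hL : IsFibre L) (hB : IsFibre fun r => besselOp 2 zero_le_two ∘L L r)
    (hb : ∀ r x, ((1 + r : ℝ≥0) : ℝ) ^ (m + n) * ‖besselOp t ht (L r x)‖ ^ 2 ≤ b ^ 2 * ‖x‖ ^ 2)
    (f : Fock d Particle) :
    ∃ v, (fibreOp d _ hB f, v) ∈ (interactionTerm w).graph ∧
      ‖v‖ₑ ^ 2 ≤ (m : ℝ≥0∞) ^ m * ENNReal.ofReal M *
        (ENNReal.ofReal (b ^ 2) * ENNReal.ofReal ‖f‖ ^ 2) := by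
  subst hst
  have hT : IsFibre fun r => besselOp t ht ∘L L r := (IsFibre.const _).comp hL
  refine exists_interactionTerm (hs := hs) (Θ := fun N => sector (fibreOp d _ hT f) N) hμ hδ₀ hw
    (fun N => sector_aestronglyMeasurable _ N) (fun N => ?_)
    (ENNReal.mul_ne_top ENNReal.ofReal_ne_top (ENNReal.pow_ne_top ENNReal.ofReal_ne_top)) ?_
  · filter_upwards [sector_fibreOp hB f N, sector_fibreOp hT f N] with k h1 h2
    rw [h1, h2]
    exact (besselOp_comp hs ht zero_le_two hts _).symm
  · have h0 : ENNReal.ofReal ‖f‖ ^ 2 = _ := (congrArg (· ^ 2) (ofReal_norm f)).trans (fock_enorm_sq f)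
    refine le_trans ?_ (congrArg _ h0).ge
    refine le_trans ?_ (le_of_eq ENNReal.tsum_mul_left)
    refine ENNReal.tsum_le_tsum fun N => ?_
    refine le_trans (lintegral_mono_ae ?_) (lintegral_const_mul' _ _ ENNReal.ofReal_ne_top).le
    filter_upwards [sector_fibreOp hT f N] with k hk
    rw [hk, energyWeight_eq]
    have h1 := ENNReal.ofReal_le_ofReal (hb (photonEnergyNN k) (sector f N k))
    rw [ENNReal.ofReal_mul (by positivity), ENNReal.ofReal_mul (by positivity),
      ENNReal.ofReal_pow (by positivity), ENNReal.ofReal_pow (norm_nonneg _),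
      ENNReal.ofReal_pow (norm_nonneg _), ofReal_norm, ofReal_norm, ENNReal.ofReal_coe_nnreal] at h1
    push_cast at h1
    exact h1

theorem norm_le_of_enorm_sq_le {G : Type*} [NormedAddCommGroup G] {v : G} {F : ℝ} (hm' : m ≤ 2)
    (hM : 0 ≤ M) (hb0 : 0 ≤ b) (hF : 0 ≤ F)
    (h : ‖v‖ₑ ^ 2 ≤ (m : ℝ≥0∞) ^ m * ENNReal.ofReal M *
      (ENNReal.ofReal (b ^ 2) * ENNReal.ofReal F ^ 2)) : ‖v‖ ≤ 2 * √M * b * F := by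
  -- The largest value of `m ^ m` for `m ≤ 2` is `4`; its square root is the factor `2` in the
  -- conclusion.
  have hm : (m : ℝ≥0∞) ^ m ≤ ENNReal.ofReal 4 := by
    have h4 : ENNReal.ofReal 4 = ((4 : ℕ) : ℝ≥0∞) := by norm_num
    rw [h4, ← Nat.cast_pow, Nat.cast_le]
    interval_cases m <;> norm_num
  have h1 : ‖v‖ₑ ^ 2 ≤ ENNReal.ofReal (2 * √M * b * F) ^ 2 := by
    have h2 : (2 * √M * b * F) ^ 2 = 4 * M * (b ^ 2 * F ^ 2) := by
      rw [mul_pow, mul_pow, mul_pow, Real.sq_sqrt hM]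
      ring
    rw [← ENNReal.ofReal_pow (by positivity), h2, ENNReal.ofReal_mul (by positivity),
      ENNReal.ofReal_mul (by positivity), ENNReal.ofReal_mul (by positivity),
      ENNReal.ofReal_pow hF]
    exact h.trans (by gcongr)
  have h3 := (ENNReal.pow_le_pow_left_iff two_ne_zero).1 h1
  rwa [← ofReal_norm, ENNReal.ofReal_le_ofReal_iff (by positivity)] at h3

theorem norm_smul_sum_le {G : Type*} [NormedAddCommGroup G] [NormedSpace ℂ G]
    {v1 v2 v3 v4 v5 : G} {g c : ℝ} (hg : 0 ≤ g) (h1 : ‖v1‖ ≤ c) (h2 : ‖v2‖ ≤ c) (h3 : ‖v3‖ ≤ c)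
    (h4 : ‖v4‖ ≤ c) (h5 : ‖v5‖ ≤ c) : ‖(g : ℂ) • (v1 + v2 + v3 + v4 + v5)‖ ≤ g * (5 * c) := by
  rw [norm_smul, Complex.norm_real, Real.norm_of_nonneg hg]
  gcongr
  refine (norm_add_le _ _).trans ?_
  have e1 := norm_add_le (v1 + v2 + v3) v4
  have e2 := norm_add_le (v1 + v2) v3
  have e3 := norm_add_le v1 v2
  linarith

/-- For `m + n = 2` the hypothesis `hb'` is used directly. For `m + n = 1` it is interpolated with
`hb`, at the cost of half a power of `1 + r`. -/
theorem interactionTerm_fibre_bound {w : Coupling d m n} (hμ : 0 ≤ μ) (hδ₀ : 0 ≤ δ₀) (hM : 0 ≤ M)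
    (hmn : 1 ≤ m + n) (hmn' : m + n ≤ 2)
    (hw : CouplingBound μ δ₀ M w) (hL : IsFibre L)
    (hB : IsFibre fun r => besselOp 2 zero_le_two ∘L L r) (hb0 : 0 ≤ b)
    (hb : ∀ r, ‖L r‖ ≤ b)
    (hb' : ∀ r, ((1 + r : ℝ≥0) : ℝ) * ‖besselOp 2 zero_le_two ∘L L r‖ ≤ b) (f : Fock d Particle) :
    ∃ v, (fibreOp d _ hB f, v) ∈ (interactionTerm w).graph ∧ ‖v‖ ≤ 2 * √M * b * ‖f‖ := by
  have key : ∀ s t : ℝ, ∀ (ht : 0 ≤ t), s = 2 - m - n → 0 ≤ s → s + t = 2 →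
      (∀ r x, ((1 + r : ℝ≥0) : ℝ) ^ (m + n) * ‖besselOp t ht (L r x)‖ ^ 2 ≤ b ^ 2 * ‖x‖ ^ 2) →
      ∃ v, (fibreOp d _ hB f, v) ∈ (interactionTerm w).graph ∧ ‖v‖ ≤ 2 * √M * b * ‖f‖ := by
    intro s t ht hst hs hts hbt
    have hex := interactionTerm_fibre (b := b) hμ hδ₀ hw hst hs ht hts hL hB hbt f
    obtain ⟨v, hv, hvb⟩ := hex
    exact ⟨v, hv, norm_le_of_enorm_sq_le (by omega) hM hb0 (norm_nonneg _) hvb⟩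
  have hB2 : ∀ r x, ((1 + r : ℝ≥0) : ℝ) * ‖besselOp 2 zero_le_two (L r x)‖ ≤ b * ‖x‖ := by
    intro r x
    have h1 : ‖besselOp 2 zero_le_two (L r x)‖ ≤ ‖besselOp 2 zero_le_two ∘L L r‖ * ‖x‖ :=
      (besselOp 2 zero_le_two ∘L L r).le_opNorm x
    calc _ ≤ ((1 + r : ℝ≥0) : ℝ) * (‖besselOp 2 zero_le_two ∘L L r‖ * ‖x‖) :=
          mul_le_mul_of_nonneg_left h1 (NNReal.coe_nonneg _)
      _ = (((1 + r : ℝ≥0) : ℝ) * ‖besselOp 2 zero_le_two ∘L L r‖) * ‖x‖ := (mul_assoc _ _ _).symm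
      _ ≤ _ := mul_le_mul_of_nonneg_right (hb' r) (norm_nonneg _)
  have hcase : m + n = 1 ∨ m + n = 2 := by omega
  rcases hcase with h | h
  · have hc : (m : ℝ) + n = 1 := by exact_mod_cast h
    refine key 1 1 zero_le_one (by linarith) zero_le_one (by norm_num) fun r x => ?_
    rw [h, pow_one]
    have h1 := norm_besselOp_sq_le (s := 1) (t := 2) zero_le_one zero_le_two (by norm_num) (L r x)
    have h2 := hB2 r x
    have h3 : ‖L r x‖ ≤ b * ‖x‖ := (L r).le_of_opNorm_le (hb r) x
    calc _ ≤ ((1 + r : ℝ≥0) : ℝ) * (‖L r x‖ * ‖besselOp 2 zero_le_two (L r x)‖) := by gcongr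
      _ = ‖L r x‖ * (((1 + r : ℝ≥0) : ℝ) * ‖besselOp 2 zero_le_two (L r x)‖) := by ring
      _ ≤ (b * ‖x‖) * (b * ‖x‖) := by gcongr
      _ = _ := by ring
  · have hc : (m : ℝ) + n = 2 := by exact_mod_cast h
    refine key 0 2 zero_le_two (by linarith) le_rfl (by norm_num) fun r x => ?_
    rw [h, ← mul_pow, ← mul_pow]
    exact pow_le_pow_left₀ (by positivity) (hB2 r x) 2

/-- The interaction is bounded relative to operators that map into `D(⟨p⟩²) ∩ D(H_f)`. -/
theorem interaction_fibre_bound {w : ∀ m n, Coupling d m n} (hμ : 0 ≤ μ) (hδ₀ : 0 ≤ δ₀)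
    (hM : 0 ≤ M) (hw : ∀ m n, 1 ≤ m + n → m + n ≤ 2 → CouplingBound μ δ₀ M (w m n))
    (hL : IsFibre L) (hB : IsFibre fun r => besselOp 2 zero_le_two ∘L L r) (hb0 : 0 ≤ b)
    (hb : ∀ r, ‖L r‖ ≤ b)
    (hb' : ∀ r, ((1 + r : ℝ≥0) : ℝ) * ‖besselOp 2 zero_le_two ∘L L r‖ ≤ b) {g : ℝ} (hg : 0 ≤ g)
    (f : Fock d Particle) :
    ∃ v, (fibreOp d _ hB f, v) ∈ (interaction g w).graph ∧ ‖v‖ ≤ g * (10 * √M * b) * ‖f‖ := by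
  have key : ∀ m n, 1 ≤ m + n → m + n ≤ 2 → ∃ v,
      (fibreOp d _ hB f, v) ∈ (interactionTerm (w m n)).graph ∧ ‖v‖ ≤ 2 * √M * b * ‖f‖ :=
    fun m n h h' => interactionTerm_fibre_bound hμ hδ₀ hM h h' (hw m n h h') hL hB hb0 hb hb' f
  have k1 := key 1 0 (by norm_num) (by norm_num)
  obtain ⟨v1, h1, b1⟩ := k1
  have k2 := key 0 1 (by norm_num) (by norm_num)
  obtain ⟨v2, h2, b2⟩ := k2
  have k3 := key 2 0 (by norm_num) (by norm_num)
  obtain ⟨v3, h3, b3⟩ := k3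
  have k4 := key 1 1 (by norm_num) (by norm_num)
  obtain ⟨v4, h4, b4⟩ := k4
  have k5 := key 0 2 (by norm_num) (by norm_num)
  obtain ⟨v5, h5, b5⟩ := k5
  refine ⟨(g : ℂ) • (v1 + v2 + v3 + v4 + v5), ?_, ?_⟩
  · exact mem_graph_smul.2 ⟨_, mem_graph_add.2 ⟨_, _, mem_graph_add.2 ⟨_, _, mem_graph_add.2
      ⟨_, _, mem_graph_add.2 ⟨_, _, h1, h2, rfl⟩, h3, rfl⟩, h4, rfl⟩, h5, rfl⟩, rfl⟩
  · refine (norm_smul_sum_le hg b1 b2 b3 b4 b5).trans (le_of_eq ?_)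
    generalize ‖f‖ = F
    ring

end InteractionFibre

/-! ### Isospectrality of the Feshbach-Schur map for unbounded operators -/

section Isospectrality

variable {H X : Type*} [NormedAddCommGroup H] [NormedSpace ℂ H] [NormedAddCommGroup X]
  [NormedSpace ℂ X]

/-- Unbounded operators `H₀`, `I`, `π`, `π̄` that are represented by the bounded operators
`τ`, `w`, `p`, `q` on the common domain `Ran G`, where `S` is the range of the projection `y`. -/
structure IsRepresented (H₀ I Q Qb : H →ₗ.[ℂ] H) (S : Submodule ℂ H) (ζ : ℂ)
    (G p q y τ w : H →L[ℂ] H) : Prop where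
  injective : Function.Injective G
  free : ∀ u v, (u, v) ∈ (shift H₀ ζ).graph ↔ ∃ f, u = G f ∧ v = τ f
  int : ∀ f, (G f, w f) ∈ I.graph
  graph_p : ∀ u v, (u, v) ∈ Q.graph ↔ v = p u
  graph_q : ∀ u v, (u, v) ∈ Qb.graph ↔ v = q u
  mem_range : ∀ u, u ∈ S ↔ y u = u
  G_p : G * p = p * G
  G_q : G * q = q * G
  G_y : G * y = y * G

variable {H₀ I Q Qb : H →ₗ.[ℂ] H} {S : Submodule ℂ H} {ζ : ℂ} {G p q y τ w t s : H →L[ℂ] H}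
  (h : IsRepresented H₀ I Q Qb S ζ G p q y τ w)

include h

theorem IsRepresented.int_iff {f v : H} : (G f, v) ∈ I.graph ↔ v = w f :=
  ⟨fun h1 => LinearPMap.mem_graph_snd_inj _ h1 (h.int f) rfl, fun h1 => h1 ▸ h.int f⟩

/-- `p₂` commutes with `G`, hence leaves the domain `Ran G` of the interaction invariant, so the
natural domain of the product contains all of `Ran G`. -/
theorem IsRepresented.graph_sandwich {Q₁ Q₂ : H →ₗ.[ℂ] H} {p₁ p₂ : H →L[ℂ] H}
    (h1 : ∀ u v, (u, v) ∈ Q₁.graph ↔ v = p₁ u) (h2 : ∀ u v, (u, v) ∈ Q₂.graph ↔ v = p₂ u)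
    (hp : G * p₂ = p₂ * G) {f v : H} :
    (G f, v) ∈ (opComp Q₁ (opComp I Q₂)).graph ↔ v = p₁ (w (p₂ f)) := by
  have hG : p₂ (G f) = G (p₂ f) := (DFunLike.congr_fun hp f).symm
  rw [mem_graph_opComp]
  constructor
  · rintro ⟨y1, h3, h4⟩
    rw [mem_graph_opComp] at h3
    obtain ⟨y2, h5, h6⟩ := h3
    rw [h2, hG] at h5
    subst h5
    rw [h.int_iff] at h6
    rw [(h1 _ _).1 h4, h6]
  · rintro rfl
    refine ⟨_, mem_graph_opComp.2 ⟨_, (h2 _ _).2 rfl, ?_⟩, (h1 _ _).2 rfl⟩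
    rw [hG]
    exact h.int _

theorem IsRepresented.graph_hamiltonian (u v : H) :
    (u, v) ∈ (shift (H₀ + I) ζ).graph ↔ ∃ f, u = G f ∧ v = (τ + w) f := by
  rw [mem_graph_shift, mem_graph_add]
  constructor
  · rintro ⟨a, b, ha, hb, hab⟩
    obtain ⟨f, rfl, hf⟩ := (h.free u (a - ζ • u)).1 (by rwa [mem_graph_shift, sub_add_cancel])
    refine ⟨f, rfl, ?_⟩
    rw [h.int_iff] at hb
    rw [_root_.add_apply, ← hf, ← hb, ← add_sub_right_comm, ← hab, add_sub_cancel_right]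
  · rintro ⟨f, rfl, rfl⟩
    refine ⟨_, _, mem_graph_shift.1 ((h.free _ _).2 ⟨f, rfl, rfl⟩), h.int f, ?_⟩
    rw [_root_.add_apply]
    abel

theorem IsRepresented.graph_barHam (u v : H) :
    (u, v) ∈ (shift (H₀ + opComp Qb (opComp I Qb)) ζ).graph ↔
      ∃ f, u = G f ∧ v = (τ + q * w * q) f := by
  rw [mem_graph_shift, mem_graph_add]
  constructor
  · rintro ⟨a, b, ha, hb, hab⟩
    obtain ⟨f, rfl, hf⟩ := (h.free u (a - ζ • u)).1 (by rwa [mem_graph_shift, sub_add_cancel])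
    refine ⟨f, rfl, ?_⟩
    rw [h.graph_sandwich h.graph_q h.graph_q h.G_q] at hb
    have hb' : (q * w * q) f = b := hb.symm
    rw [_root_.add_apply, ← hf, hb', ← add_sub_right_comm, ← hab, add_sub_cancel_right]
  · rintro ⟨f, rfl, rfl⟩
    refine ⟨_, _, mem_graph_shift.1 ((h.free _ _).2 ⟨f, rfl, rfl⟩),
      (h.graph_sandwich h.graph_q h.graph_q h.G_q).2 rfl, ?_⟩
    rw [_root_.add_apply]
    change _ = _ + ζ • G f + (q * w * q) f
    abel

theorem IsRepresented.mem_range_iff (f : H) : G f ∈ S ↔ y f = f := by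
  rw [h.mem_range]
  have h1 : y (G f) = G (y f) := (DFunLike.congr_fun h.G_y f).symm
  rw [h1]
  exact h.injective.eq_iff

variable (hd : FeshbachData p q y τ w t s)
include hd

/-- `τ + q w q` commutes with `y`, so `S` is invariant; there `s` inverts it, and the inverse of
`H_π̄ - ζ` on `S` is `G s`. -/
theorem IsRepresented.graph_barHam_restrict (u v : H) :
    (u ∈ S ∧ (u, v) ∈ (shift (H₀ + opComp Qb (opComp I Qb)) ζ).graph) ↔
      v ∈ S ∧ u = G (s v) := by
  rw [h.graph_barHam]
  constructor
  · rintro ⟨hu, f, rfl, rfl⟩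
    rw [h.mem_range_iff] at hu
    have h1 := DFunLike.congr_fun hd.s_mul f
    rw [mul_apply_eq_comp, hu] at h1
    refine ⟨?_, by rw [h1]⟩
    rw [h.mem_range]
    -- `y τ = τ t τ = τ y`, and `y` fixes `q` from both sides.
    have h2 : y * (τ + q * w * q) = (τ + q * w * q) * y := by
      linear_combination (norm := noncomm_ring) -hd.τ_t * τ + τ * hd.t_τ + hd.y_q * w * q
        - q * w * hd.q_y
    have h3 := DFunLike.congr_fun h2 f
    rw [mul_apply_eq_comp, mul_apply_eq_comp, hu] at h3
    exact h3
  · rintro ⟨hv, rfl⟩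
    rw [h.mem_range_iff]
    refine ⟨DFunLike.congr_fun hd.y_s v, s v, rfl, ?_⟩
    rw [h.mem_range] at hv
    have h1 := DFunLike.congr_fun hd.mul_s v
    rw [mul_apply_eq_comp, hv] at h1
    exact h1.symm

theorem IsRepresented.bddInvertibleOn :
    BddInvertibleOn (shift (H₀ + opComp Qb (opComp I Qb)) ζ) S := by
  refine ⟨fun u hu => ?_, fun f hf => ?_, ‖G ∘L s‖, fun u hu => ?_⟩
  · exact ((h.graph_barHam_restrict hd _ _).1 ⟨hu, LinearPMap.mem_graph _ u⟩).1
  · obtain ⟨h1, h2⟩ := (h.graph_barHam_restrict hd _ _).2 ⟨hf, rfl⟩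
    obtain ⟨h3, h4⟩ := mem_graph_iff_exists.1 h2
    exact ⟨⟨_, h3⟩, h1, h4⟩
  · obtain ⟨-, h2⟩ := (h.graph_barHam_restrict hd _ _).1 ⟨hu, LinearPMap.mem_graph _ u⟩
    rw [h2]
    exact (G ∘L s).le_opNorm _

theorem IsRepresented.graph_inverse (u v : H) :
    (v, u) ∈ ((shift (H₀ + opComp Qb (opComp I Qb)) ζ).domRestrict S).inverse.graph ↔
      v ∈ S ∧ u = G (s v) := by
  rw [mem_graph_inverse, mem_graph_domRestrict, h.graph_barHam_restrict hd]
  refine ker_eq_bot_of_graph fun u hu => ?_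
  rw [mem_graph_domRestrict, h.graph_barHam_restrict hd] at hu
  rw [hu.2, map_zero, map_zero]

/-- Along the chain of products every intermediate vector lies in the domain of the next factor: `q`
maps into `S`, the inverse `G s` maps into `Ran G`, and `p`, `q` preserve `Ran G`. So the domain is
exactly `Ran G`. -/
theorem IsRepresented.graph_feshbach (u v : H) :
    (u, v) ∈ (shift H₀ ζ + opComp Q (opComp I Q) - opComp Q (opComp I (opComp Qb
      (opComp ((shift (H₀ + opComp Qb (opComp I Qb)) ζ).domRestrict S).inverse
        (opComp Qb (opComp I Q)))))).graph ↔ ∃ f, u = G f ∧ v = feshF p q τ w s f := by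
  have hG1 : ∀ f, q (G (s f)) = G (q (s f)) := fun f => (DFunLike.congr_fun h.G_q (s f)).symm
  have key : ∀ f v, (G f, v) ∈ (opComp Q (opComp I (opComp Qb
      (opComp ((shift (H₀ + opComp Qb (opComp I Qb)) ζ).domRestrict S).inverse
        (opComp Qb (opComp I Q)))))).graph ↔ v = p (w (q (s (q (w (p f)))))) := by
    intro f v
    simp only [mem_graph_opComp (A := Q) (B := opComp I (opComp Qb
      (opComp ((shift (H₀ + opComp Qb (opComp I Qb)) ζ).domRestrict S).inverse
        (opComp Qb (opComp I Q))))), mem_graph_opComp (A := I) (B := opComp Qb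
      (opComp ((shift (H₀ + opComp Qb (opComp I Qb)) ζ).domRestrict S).inverse
        (opComp Qb (opComp I Q)))), mem_graph_opComp (A := Qb) (B :=
      opComp ((shift (H₀ + opComp Qb (opComp I Qb)) ζ).domRestrict S).inverse
        (opComp Qb (opComp I Q))), mem_graph_opComp
        (A := ((shift (H₀ + opComp Qb (opComp I Qb)) ζ).domRestrict S).inverse),
        h.graph_sandwich h.graph_q h.graph_p h.G_p, h.graph_inverse hd]
    constructor
    · rintro ⟨y1, ⟨y2, ⟨y3, ⟨y4, rfl, -, rfl⟩, h3⟩, h2⟩, h1⟩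
      rw [h.graph_q, hG1] at h3
      subst h3
      rw [h.int_iff] at h2
      subst h2
      exact (h.graph_p _ _).1 h1
    · rintro rfl
      refine ⟨_, ⟨_, ⟨_, ⟨_, rfl, ?_, rfl⟩, (h.graph_q _ _).2 rfl⟩, ?_⟩, (h.graph_p _ _).2 rfl⟩
      · rw [h.mem_range]
        exact DFunLike.congr_fun hd.y_q _
      · rw [hG1]
        exact h.int _
  rw [mem_graph_sub]
  constructor
  · rintro ⟨a, b, ha, hb, rfl⟩
    rw [mem_graph_add] at ha
    obtain ⟨a1, a2, h1, h2, rfl⟩ := ha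
    obtain ⟨f, rfl, rfl⟩ := (h.free _ _).1 h1
    rw [h.graph_sandwich h.graph_p h.graph_p h.G_p] at h2
    rw [key] at hb
    refine ⟨f, rfl, ?_⟩
    rw [h2, hb]
    rfl
  · rintro ⟨f, rfl, rfl⟩
    refine ⟨_, _, mem_graph_add.2 ⟨_, _, (h.free _ _).2 ⟨f, rfl, rfl⟩,
      (h.graph_sandwich h.graph_p h.graph_p h.G_p).2 rfl, rfl⟩, (key _ _).2 rfl, rfl⟩

end Isospectrality

/-! ### Compression of the Feshbach operator to the scalar Fock space. -/

section Effective

variable {H X : Type*} [NormedAddCommGroup H] [NormedSpace ℂ H] [NormedAddCommGroup X]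
  [NormedSpace ℂ X] {F D D' : H →ₗ.[ℂ] H} {T : X →ₗ.[ℂ] H} {G f Γ Γ' : H →L[ℂ] H}
  {J : X →L[ℂ] H} {J' : H →L[ℂ] X} {c : ℂ}

/-- Here `J` stands for `Φ ↦ ψ ⊗ Φ` with left inverse `J'`, and `Γ` for the dilation. The projection
`Γ' J J' Γ` commutes with `G` and fixes the values of `f` on its range, so `T.inverse` imposes no
further domain condition. -/
theorem graph_effective (hF : ∀ u v, (u, v) ∈ F.graph ↔ ∃ a, u = G a ∧ v = f a)
    (hG : Function.Injective G)
    (hD : ∀ u v, (u, v) ∈ D.graph ↔ v = Γ u) (hD' : ∀ u v, (u, v) ∈ D'.graph ↔ v = Γ' u)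
    (hT : ∀ u v, (u, v) ∈ T.graph ↔ v = J u) (hJ : ∀ x, J' (J x) = x)
    (hΓ : ∀ u, Γ (Γ' u) = u) (hΓ' : ∀ u, Γ' (Γ u) = u)
    (hcomm : ∀ u, Γ' (J (J' (Γ (G u)))) = G (Γ' (J (J' (Γ u)))))
    (hf : ∀ x, Γ' (J (J' (Γ (f (Γ' (J x)))))) = f (Γ' (J x))) (u v : X) :
    (u, v) ∈ (opComp T.inverse (opComp (c • opComp D (opComp F D')) T)).graph ↔
      ∃ h, u = (J' ∘L Γ ∘L G ∘L Γ' ∘L J) h ∧ v = (c • (J' ∘L Γ ∘L f ∘L Γ' ∘L J)) h := by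
  have hker : LinearMap.ker T.toFun = ⊥ := by
    refine ker_eq_bot_of_graph fun x hx => ?_
    rw [hT] at hx
    rw [← hJ x, ← hx, map_zero]
  have hTi : ∀ y x, (y, x) ∈ T.inverse.graph ↔ y = J x := fun y x => by
    rw [mem_graph_inverse hker, hT]
  rw [mem_graph_opComp]
  constructor
  · rintro ⟨y1, h1, h2⟩
    rw [hTi] at h2
    subst h2
    rw [mem_graph_opComp] at h1
    obtain ⟨y2, h3, h4⟩ := h1
    rw [hT] at h3
    subst h3
    rw [mem_graph_smul] at h4
    obtain ⟨y3, h5, h6⟩ := h4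
    rw [mem_graph_opComp] at h5
    obtain ⟨y4, h7, h8⟩ := h5
    rw [hD] at h8
    subst h8
    rw [mem_graph_opComp] at h7
    obtain ⟨y5, h9, h10⟩ := h7
    rw [hD'] at h9
    subst h9
    rw [hF] at h10
    obtain ⟨a, ha, rfl⟩ := h10
    -- `G a` lies in the range of the projection by assumption; since `G` is injective and commutes
    -- with the projection, so does `a`.
    have ha2 : Γ' (J (J' (Γ a))) = a := by
      apply hG
      rw [← hcomm, ← ha, hΓ, hJ]
    refine ⟨J' (Γ a), ?_, ?_⟩
    · simp only [ContinuousLinearMap.comp_apply]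
      rw [ha2, ← ha, hΓ, hJ]
    · simp only [_root_.smul_apply, ContinuousLinearMap.comp_apply]
      rw [ha2, ← map_smul, ← h6, hJ]
  · rintro ⟨x, rfl, rfl⟩
    refine ⟨J ((c • (J' ∘L Γ ∘L f ∘L Γ' ∘L J)) x), mem_graph_opComp.2
      ⟨_, (hT _ _).2 rfl, mem_graph_smul.2 ⟨Γ (f (Γ' (J x))), mem_graph_opComp.2
        ⟨f (Γ' (J x)), mem_graph_opComp.2 ⟨_, (hD' _ _).2 rfl, (hF _ _).2 ⟨Γ' (J x), ?_, rfl⟩⟩,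
          (hD _ _).2 rfl⟩, ?_⟩⟩, (hTi _ _).2 rfl⟩
    · simp only [ContinuousLinearMap.comp_apply]
      rw [hcomm, hΓ, hJ]
    · simp only [_root_.smul_apply, ContinuousLinearMap.comp_apply, map_smul]
      congr 1
      apply (Function.LeftInverse.injective hΓ)
      rw [hf, hΓ']

end Effective

/-! ### Operators that are diagonal with respect to a projection and the photon energy -/

section Diagonal

variable {d : ℕ} {E : Type*} [NormedAddCommGroup E] [NormedSpace ℂ E] {P : E →L[ℂ] E}
  {a a' a'' : ℝ≥0 → ℂ} {S S' S'' : ℝ≥0 → E →L[ℂ] E}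

/-- The fibres `a P + S`, where `S` acts on the kernel of `P`. -/
structure IsDiag (P : E →L[ℂ] E) (a : ℝ≥0 → ℂ) (S : ℝ≥0 → E →L[ℂ] E) : Prop where
  measurable : Measurable a
  bounded : ∃ C, ∀ r, ‖a r‖ ≤ C
  isFibre : IsFibre S
  left : ∀ r x, P (S r x) = 0
  right : ∀ r x, S r (P x) = 0

theorem IsDiag.isFibre_diag (h : IsDiag P a S) : IsFibre fun r => a r • P + S r := by
  obtain ⟨C, hC⟩ := h.bounded
  exact (IsFibre.smul h.measurable hC (IsFibre.const P)).add h.isFibre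

theorem IsDiag.zero (ha : Measurable a) (hb : ∃ C, ∀ r, ‖a r‖ ≤ C) :
    IsDiag P a fun _ => 0 :=
  ⟨ha, hb, IsFibre.const 0, fun _ _ => map_zero P, fun _ _ => rfl⟩

theorem IsDiag.one_sub (hP : ∀ x, P (P x) = P x) (ha : Measurable a)
    (hb : ∃ C, ∀ r, ‖a r‖ ≤ C) : IsDiag P a fun _ => 1 - P :=
  ⟨ha, hb, IsFibre.const _, fun _ x => by simp [hP], fun _ x => by simp [hP]⟩

theorem IsDiag.one_sub_add_smul (hP : ∀ x, P (P x) = P x) (ha : Measurable a')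
    (hb : ∃ C, ∀ r, ‖a' r‖ ≤ C) (h : IsDiag P a S) (c : ℂ) :
    IsDiag P a' fun r => (1 - P) + c • S r := by
  refine ⟨ha, hb, (IsFibre.const _).add (IsFibre.smul (b := ‖c‖) measurable_const
    (fun _ => le_rfl) h.isFibre), fun r x => ?_, fun r x => ?_⟩
  · simp [hP, h.left]
  · simp [hP, h.right]

/-- The operator on the Fock space with fibres `a P + S`. -/
def diagOp (d : ℕ) (h : IsDiag P a S) : Fock d E →L[ℂ] Fock d E :=
  fibreOp d (fun r => a r • P + S r) h.isFibre_diag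

/-- The parts on `Ran P` and `ker P` annihilate each other, so products are computed separately on
the two parts. -/
theorem diagOp_mul (hP : ∀ x, P (P x) = P x) (h : IsDiag P a S) (h' : IsDiag P a' S')
    (h'' : IsDiag P a'' S'') (ha : ∀ r, a r * a' r = a'' r)
    (hS : ∀ r x, S r (S' r x) = S'' r x) : diagOp d h * diagOp d h' = diagOp d h'' := by
  refine fibreOp_comp _ _ _ fun r => ?_
  ext x
  simp [h.right, h'.left, hP, hS, ← ha, smul_smul, mul_comm]

theorem diagOp_mul_comm (hP : ∀ x, P (P x) = P x) (h : IsDiag P a S) (h' : IsDiag P a' S')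
    (hS : ∀ r x, S r (S' r x) = S' r (S r x)) :
    diagOp d h * diagOp d h' = diagOp d h' * diagOp d h := by
  obtain ⟨b, hb⟩ := h.bounded
  obtain ⟨b', hb'⟩ := h'.bounded
  have h2 : IsDiag P (fun r => a r * a' r) fun r => S r ∘L S' r :=
    ⟨h.measurable.mul h'.measurable, ⟨b * b', fun r => (norm_mul_le _ _).trans
      (mul_le_mul (hb r) (hb' r) (norm_nonneg _) ((norm_nonneg _).trans (hb r)))⟩,
      h.isFibre.comp h'.isFibre, fun r x => h.left r _, fun r x => by
        simp [h'.right]⟩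
  rw [diagOp_mul hP h h' h2 (fun _ => rfl) (fun _ _ => rfl),
    diagOp_mul hP h' h h2 (fun _ => mul_comm _ _) (fun r x => (hS r x).symm)]

theorem diagOp_add (h : IsDiag P a S) (h' : IsDiag P a' S')
    (h'' : IsDiag P a'' S'') (ha : ∀ r, a r + a' r = a'' r)
    (hS : ∀ r x, S r x + S' r x = S'' r x) : diagOp d h + diagOp d h' = diagOp d h'' := by
  refine fibreOp_add _ _ _ fun r => ?_
  ext x
  simp only [_root_.add_apply, _root_.smul_apply]
  rw [← ha, ← hS, add_smul]
  abel

theorem diagOp_eq_one (h : IsDiag P a S) (ha : ∀ r, a r = 1)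
    (hS : ∀ r x, S r x = x - P x) : diagOp d h = 1 := by
  refine fibreOp_one _ fun r => ?_
  ext x
  simp [ha, hS]

theorem mem_graph_decomposable_diag (h : IsDiag P a S)
    {b : ∀ n, (Fin n → Photon d) → (E →ₗ[ℂ] E)}
    (hb : ∀ n (k : Fin n → Photon d) x,
      b n k x = a (photonEnergyNN k) • P x + S (photonEnergyNN k) x) (u v : Fock d E) :
    (u, v) ∈ (decomposable fun n k => (b n k).toPMap ⊤).graph ↔ v = diagOp d h u :=
  mem_graph_decomposable_toPMap h.isFibre_diag fun n k x => hb n k x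

/-! ### The free Hamiltonian -/

theorem mem_graph_fieldHam {u v : Fock d E} : (u, v) ∈ (fieldHam d E).graph ↔
    ∀ n, ∀ᵐ k ∂photonMeasureN d n, sector v n k = ((photonEnergyNN k : ℝ) : ℂ) • sector u n k := by
  unfold fieldHam
  rw [mem_graph_decomposable]
  simp only [mem_graph_toPMap_top, coe_photonEnergyNN]
  rfl

theorem mem_graph_freeHam_of_sector {A : E →ₗ.[ℂ] E} {z : ℂ} {G : ℝ≥0 → E →L[ℂ] E}
    (h : ∀ (r : ℝ≥0) v, (G r v, v + z • G r v - ((r : ℝ) : ℂ) • G r v) ∈ A.graph)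
    {u v b : Fock d E}
    (hu : ∀ n, ∀ᵐ k ∂photonMeasureN d n, sector u n k = G (photonEnergyNN k) (sector v n k))
    (hb : ∀ n, ∀ᵐ k ∂photonMeasureN d n, sector b n k =
      (((photonEnergyNN k : ℝ) : ℂ) • G (photonEnergyNN k)) (sector v n k)) :
    (u, v + z • u) ∈ (freeHam d A).graph := by
  have h7 : v + z • u = (v + z • u + (-1 : ℂ) • b) + b := by
    rw [neg_one_smul, neg_add_cancel_right]
  refine mem_graph_add.2 ⟨_, b, mem_graph_decomposable.2 fun n => ?_,
    mem_graph_fieldHam.2 fun n => ?_, h7⟩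
  · filter_upwards [hu n, sector_add v (z • u) n, sector_smul z u n, hb n,
      sector_add (v + z • u) ((-1 : ℂ) • b) n, sector_smul (-1) b n] with k h1 h2 h3 h4 h5 h6
    rw [h5, h6, h2, h3, h4, h1, neg_one_smul, ← sub_eq_add_neg]
    exact h _ _
  · filter_upwards [hu n, hb n] with k h1 h2
    rw [h2, h1]
    rfl

/-- At photon energy `r` the free Hamiltonian is `A + r`, so its resolvent has the fibres `G r`. The
bound on `r ‖G r‖` puts the range of the fibre operator into `D(H_f)`, hence into the intersection
of the two domains. -/
theorem mem_graph_freeHam {A : E →ₗ.[ℂ] E} {z : ℂ} {G : ℝ≥0 → E →L[ℂ] E} (hG : IsFibre G)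
    (hG' : ∃ C, ∀ r : ℝ≥0, (r : ℝ) * ‖G r‖ ≤ C)
    (h : ∀ (r : ℝ≥0) u v, (u, v + z • u - ((r : ℝ) : ℂ) • u) ∈ A.graph ↔ u = G r v)
    {u v : Fock d E} : (u, v + z • u) ∈ (freeHam d A).graph ↔ u = fibreOp d G hG v := by
  constructor
  · intro huv
    obtain ⟨a, b, ha, hb, hab⟩ := mem_graph_add.1 huv
    rw [mem_graph_decomposable] at ha
    rw [mem_graph_fieldHam] at hb
    refine fock_ext fun n => ?_
    filter_upwards [ha n, hb n, sector_fibreOp hG v n, sector_add v (z • u) n, sector_smul z u n,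
      sector_add a b n] with k h1 h2 h3 h4 h5 h6
    rw [h3, ← h]
    rw [← hab, h4, h5] at h6
    rw [h6, h2, add_sub_cancel_right]
    exact h1
  · rintro rfl
    have hG2 : IsFibre fun r : ℝ≥0 => ((r : ℝ) : ℂ) • G r := by
      obtain ⟨C, hC⟩ := hG'
      have hm : StronglyMeasurable fun r : ℝ≥0 => ((r : ℝ) : ℂ) :=
        (Complex.measurable_ofReal.comp measurable_coe_nnreal_real).stronglyMeasurable
      refine ⟨hm.smul hG.1, C, fun r => ?_⟩
      simpa [norm_smul] using hC r
    exact mem_graph_freeHam_of_sector (fun r v => (h r _ v).2 rfl) (sector_fibreOp hG v)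
      (sector_fibreOp hG2 v)

/-! ### Strong convergence of fibred operators -/

theorem tendsto_zero_of_enorm_sq {G : Type*} [NormedAddCommGroup G] {x : ℕ → G}
    (h : Filter.Tendsto (fun j => ‖x j‖ₑ ^ 2) Filter.atTop (nhds 0)) :
    Filter.Tendsto x Filter.atTop (nhds 0) := by
  rw [tendsto_zero_iff_norm_tendsto_zero]
  have h3 := (ENNReal.tendsto_toReal ENNReal.zero_ne_top).comp h
  have h4 : Filter.Tendsto (fun j => √(‖x j‖ ^ 2)) Filter.atTop (nhds √0) := by
    refine (Real.continuous_sqrt.tendsto 0).comp ?_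
    simpa [Function.comp_def] using h3
  simpa [Real.sqrt_sq (norm_nonneg _)] using h4

/-- Dominated convergence twice: in the photon variables within each sector, then over the sectors.
-/
theorem tendsto_fibreOp {B : ℕ → ℝ≥0 → E →L[ℂ] E} (hB : ∀ j, IsFibre (B j)) {C : ℝ≥0}
    (hC : ∀ j r, ‖B j r‖ ≤ C) (hlim : ∀ r, Filter.Tendsto (fun j => B j r) Filter.atTop (nhds 0))
    (f : Fock d E) :
    Filter.Tendsto (fun j => fibreOp d (B j) (hB j) f) Filter.atTop (nhds 0) := by
  have hpt : ∀ j n, ∫⁻ k, ‖sector (fibreOp d (B j) (hB j) f) n k‖ₑ ^ 2 ∂photonMeasureN d n =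
      ∫⁻ k, ‖B j (photonEnergyNN k) (sector f n k)‖ₑ ^ 2 ∂photonMeasureN d n := by
    intro j n
    refine lintegral_congr_ae ?_
    filter_upwards [sector_fibreOp (hB j) f n] with k hk
    rw [hk]
  have hfin : ∀ n, ∫⁻ k, (C : ℝ≥0∞) ^ 2 * ‖sector f n k‖ₑ ^ 2 ∂photonMeasureN d n ≤
      (C : ℝ≥0∞) ^ 2 * ∫⁻ k, ‖sector f n k‖ₑ ^ 2 ∂photonMeasureN d n := fun n =>
    (lintegral_const_mul' _ _ (by finiteness)).le
  have hf := fock_enorm_sq f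
  have hft : ∑' n, ∫⁻ k, ‖sector f n k‖ₑ ^ 2 ∂photonMeasureN d n ≠ ∞ := by
    rw [← hf]
    finiteness
  have hbd : ∀ j n k, ‖B j (photonEnergyNN k) (sector f n k)‖ₑ ^ 2 ≤
      (C : ℝ≥0∞) ^ 2 * ‖sector f n k‖ₑ ^ 2 := by
    intro j n k
    rw [← mul_pow]
    gcongr
    refine ((B j (photonEnergyNN k)).le_opENorm _).trans ?_
    gcongr
    exact_mod_cast hC j _
  have hmeas : ∀ j n, AEMeasurable (fun k => ‖B j (photonEnergyNN k) (sector f n k)‖ₑ ^ 2)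
      (photonMeasureN d n) := by
    intro j n
    refine AEMeasurable.congr
      ((sector_aestronglyMeasurable (fibreOp d (B j) (hB j) f) n).enorm.pow_const 2) ?_
    filter_upwards [sector_fibreOp (hB j) f n] with k hk
    rw [hk]
  have h1 : ∀ n, Filter.Tendsto (fun j => ∫⁻ k, ‖B j (photonEnergyNN k) (sector f n k)‖ₑ ^ 2
      ∂photonMeasureN d n) Filter.atTop (nhds 0) := by
    intro n
    have := tendsto_lintegral_of_dominated_convergence' (μ := photonMeasureN d n)
      (F := fun j k => ‖B j (photonEnergyNN k) (sector f n k)‖ₑ ^ 2) (f := fun _ => 0)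
      (fun k => (C : ℝ≥0∞) ^ 2 * ‖sector f n k‖ₑ ^ 2) (hmeas · n)
      (fun j => Filter.Eventually.of_forall (hbd j n))
      (ne_top_of_le_ne_top (ENNReal.mul_ne_top (by finiteness)
        (ENNReal.ne_top_of_tsum_ne_top hft n)) (hfin n))
      (Filter.Eventually.of_forall fun k => by
        have h2 : Filter.Tendsto (fun j => B j (photonEnergyNN k) (sector f n k))
            Filter.atTop (nhds 0) :=
          ((ContinuousLinearMap.apply ℂ E (sector f n k)).continuous.tendsto 0).comp (hlim _)
        have h3 := (ENNReal.continuous_pow 2).tendsto _ |>.comp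
          ((continuous_enorm.tendsto _).comp h2)
        simpa [Function.comp_def] using h3)
    simpa using this
  have h2 : Filter.Tendsto (fun j => ‖fibreOp d (B j) (hB j) f‖ₑ ^ 2) Filter.atTop (nhds 0) := by
    simp only [fock_enorm_sq, hpt, ← lintegral_count]
    have := tendsto_lintegral_of_dominated_convergence' (μ := (Measure.count : Measure ℕ))
      (F := fun j n => ∫⁻ k, ‖B j (photonEnergyNN k) (sector f n k)‖ₑ ^ 2 ∂photonMeasureN d n)
      (f := fun _ => 0)
      (fun n => (C : ℝ≥0∞) ^ 2 * ∫⁻ k, ‖sector f n k‖ₑ ^ 2 ∂photonMeasureN d n)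
      (fun j => Measurable.of_discrete.aemeasurable)
      (fun j => Filter.Eventually.of_forall fun n =>
        (lintegral_mono (hbd j n)).trans (hfin n))
      (by
        rw [lintegral_count, ENNReal.tsum_mul_left]
        exact ENNReal.mul_ne_top (by finiteness) hft)
      (Filter.Eventually.of_forall h1)
    simpa using this
  exact tendsto_zero_of_enorm_sq h2

end Diagonal

/-! ### Reduced resolvents of the particle Hamiltonian as fibres -/

theorem isFibre_of_lipschitz {E E' : Type*} [NormedAddCommGroup E] [NormedSpace ℂ E]
    [NormedAddCommGroup E'] [NormedSpace ℂ E'] {B : ℝ≥0 → E →L[ℂ] E'} {C D : ℝ}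
    (hC : ∀ r, ‖B r‖ ≤ C) (hD : ∀ r s : ℝ≥0, ‖B r - B s‖ ≤ D * |(r : ℝ) - s|) : IsFibre B := by
  refine ⟨Continuous.stronglyMeasurable ?_, C, hC⟩
  refine LipschitzWith.continuous (K := D.toNNReal) (LipschitzWith.of_dist_le_mul fun r s => ?_)
  rw [dist_eq_norm, NNReal.dist_eq]
  exact (hD r s).trans (mul_le_mul_of_nonneg_right (Real.le_coe_toNNReal D) (abs_nonneg _))

/-- Operators that map into `H²(ℝ³)` factor through `⟨p⟩^{-2}`. -/
theorem exists_besselOp_comp {T : Particle →L[ℂ] Particle} {c : ℝ} (hc : 0 ≤ c)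
    (h : ∀ f, ∃ a, (T f, a) ∈ laplacianOp.graph ∧ ‖a‖ ≤ c * ‖f‖) :
    ∃ L : Particle →L[ℂ] Particle, besselOp 2 zero_le_two ∘L L = T ∧ ‖L‖ ≤ ‖T‖ + c := by
  obtain ⟨W, hW⟩ := exists_clm_of_graph laplacianOp T c h
  have hWc : ‖W‖ ≤ c := W.opNorm_le_bound hc fun f => by
    obtain ⟨a, ha, hac⟩ := h f
    rwa [LinearPMap.mem_graph_snd_inj _ (hW f) ha rfl]
  -- `W = Δ T`, so `T - W = (1 - Δ) T = ⟨p⟩² T`.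
  refine ⟨T - W, ?_, (norm_sub_le _ _).trans (by gcongr)⟩
  ext1 f
  exact besselOp_two_sub_laplacian (hW f)

section ReducedResolvents

/-- The constant in the bounds on the fibres of the free resolvent. -/
def fibreConst (M n : ℝ) : ℝ :=
  (M + 2 * (1 + 4 * M) * M / n) + (1 + (2 * (1 + M) ^ 2 + 2 * (1 + 4 * M)) / n) +
    (2 * (1 + M) ^ 2 + 2 * (1 + 4 * M) + (1 + 2 * M))

variable {κ : ℂ} {V : Pos → ℂ} {lam : ℂ} {P : Particle →L[ℂ] Particle} {ψ : Particle} {M K : ℝ}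
  {R : ℂ → Particle →L[ℂ] Particle}

theorem re_le_of_mem_regionQ {A : Particle →ₗ.[ℂ] Particle} {z : ℂ} (hz : z ∈ regionQ A lam)
    (hlam : ‖lam‖ ≤ M) (hgap : gap A lam ≤ M) : z.re ≤ 2 * M ∧ |z.im| ≤ 2 * M := by
  obtain ⟨h1, h2⟩ := hz
  have hM : 0 ≤ M := (norm_nonneg _).trans hlam
  have h3 := (Complex.abs_re_le_norm lam).trans hlam
  have h4 := (Complex.abs_im_le_norm lam).trans hlam
  rw [Complex.sub_re] at h1
  rw [Complex.sub_im] at h2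
  rw [abs_le] at h2 h3 h4 ⊢
  refine ⟨by linarith, by linarith, by linarith⟩

/-- On the eigenspace the graph estimate at `z = lam` has vanishing residual, so `Δ P` is bounded in
terms of `P` alone. -/
theorem exists_besselOp_comp_proj (hκ : κ ≠ 0) (hκ' : 0 ≤ κ.re) (hV : PotentialBound κ V)
    (h : IsSimpleSpectralProjection (particleHam κ V) lam P ψ) (hlam : ‖lam‖ ≤ M) (hP : ‖P‖ ≤ M) :
    ∃ L : Particle →L[ℂ] Particle, besselOp 2 zero_le_two ∘L L = P ∧
      ‖L‖ ≤ M + 2 * (1 + 4 * M) * M / ‖κ‖ := by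
  have hM : 0 ≤ M := (norm_nonneg _).trans hlam
  have hn : 0 < ‖κ‖ := norm_pos_iff.2 hκ
  have key : ∀ f, ∃ a, (P f, a) ∈ laplacianOp.graph ∧
      ‖a‖ ≤ 2 * (1 + 4 * M) * M / ‖κ‖ * ‖f‖ := by
    intro f
    obtain ⟨a, ha, hb, -⟩ := particleHam_estimate (T := 2 * M) hκ' hV (h.mem_graph_proj f)
      (z := lam) (by linarith [(Complex.re_le_norm lam).trans hlam])
      (by linarith [(Complex.abs_im_le_norm lam).trans hlam])
    refine ⟨a, ha, ?_⟩
    rw [sub_self, norm_zero, mul_zero, zero_add] at hb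
    have h1 : ‖P f‖ ≤ M * ‖f‖ := P.le_of_opNorm_le hP f
    rw [div_mul_eq_mul_div, le_div_iff₀ hn]
    calc _ = ‖κ‖ * ‖a‖ := mul_comm _ _
      _ ≤ _ := hb
      _ ≤ 2 * (1 + 2 * (2 * M)) * (M * ‖f‖) := by gcongr
      _ = _ := by ring
  obtain ⟨L, hL, hLb⟩ := exists_besselOp_comp (by positivity) key
  exact ⟨L, hL, hLb.trans (by gcongr)⟩

/-- The graph estimate applied to `u = T f`. The condition `1 ≤ (M + 1) K` allows the residual `f -
P f` to be bounded by a multiple of `K ‖f‖`, so that both estimates are proportional to `K`. The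
second one becomes decay in the photon energy once `z` is shifted by `-r`. -/
theorem exists_besselOp_comp_reduced (hκ : κ ≠ 0) (hκ' : 0 ≤ κ.re) (hV : PotentialBound κ V)
    (hlam : ‖lam‖ ≤ M) (hgap : gap (particleHam κ V) lam ≤ M) (hP : ‖P‖ ≤ M) (hK : 0 ≤ K)
    (hMK : 1 ≤ (M + 1) * K) {z : ℂ} (hz : z ∈ regionQ (particleHam κ V) lam)
    {T : Particle →L[ℂ] Particle} (hT : IsReducedResolvent (particleHam κ V) P z T)
    (hTK : ‖T‖ ≤ K) :
    (∃ L : Particle →L[ℂ] Particle, besselOp 2 zero_le_two ∘L L = T ∧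
      ‖L‖ ≤ (1 + (2 * (1 + M) ^ 2 + 2 * (1 + 4 * M)) / ‖κ‖) * K) ∧
    ∀ f, -z.re * ‖T f‖ ≤ (2 * (1 + M) ^ 2 + 2 * (1 + 4 * M)) * K * ‖f‖ := by
  have hM : 0 ≤ M := (norm_nonneg _).trans hlam
  have hn : 0 < ‖κ‖ := norm_pos_iff.2 hκ
  obtain ⟨hz1, hz2⟩ := re_le_of_mem_regionQ hz hlam hgap
  have hbd : ∀ f, 2 * ‖f - P f + z • T f - z • T f‖ + 2 * (1 + 2 * (2 * M)) * ‖T f‖ ≤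
      (2 * (1 + M) ^ 2 + 2 * (1 + 4 * M)) * K * ‖f‖ := by
    intro f
    rw [add_sub_cancel_right]
    have h1 : ‖P f‖ ≤ M * ‖f‖ := P.le_of_opNorm_le hP f
    have h2 : ‖T f‖ ≤ K * ‖f‖ := T.le_of_opNorm_le hTK f
    have h3 : ‖f - P f‖ ≤ (1 + M) * ‖f‖ := (norm_sub_le _ _).trans (by linarith)
    have h4 : (1 + M) * ‖f‖ ≤ (1 + M) * ((M + 1) * K) * ‖f‖ := by
      gcongr
      exact le_mul_of_one_le_right (by positivity) hMK
    have h5 : 2 * (1 + 2 * (2 * M)) * ‖T f‖ ≤ 2 * (1 + 2 * (2 * M)) * (K * ‖f‖) := by gcongr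
    calc _ ≤ 2 * ((1 + M) * ((M + 1) * K) * ‖f‖) + 2 * (1 + 2 * (2 * M)) * (K * ‖f‖) := by
          linarith
      _ = _ := by ring
  have key : ∀ f, ∃ a, (T f, a) ∈ laplacianOp.graph ∧
      ‖a‖ ≤ (2 * (1 + M) ^ 2 + 2 * (1 + 4 * M)) / ‖κ‖ * K * ‖f‖ := by
    intro f
    obtain ⟨a, ha, hb, -⟩ := particleHam_estimate (T := 2 * M) hκ' hV (hT.mem_graph f) hz1 hz2
    refine ⟨a, ha, ?_⟩
    rw [div_mul_eq_mul_div, div_mul_eq_mul_div, le_div_iff₀ hn, mul_comm]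
    exact hb.trans (hbd f)
  refine ⟨?_, fun f => ?_⟩
  · obtain ⟨L, hL, hLb⟩ := exists_besselOp_comp (by positivity) key
    refine ⟨L, hL, hLb.trans ?_⟩
    rw [add_mul, one_mul]
    gcongr
  · obtain ⟨a, -, -, hb⟩ := particleHam_estimate (T := 2 * M) hκ' hV (hT.mem_graph f) hz1 hz2
    exact hb.trans (hbd f)

variable (h : IsSimpleSpectralProjection (particleHam κ V) lam P ψ)
  (hR : ∀ ζ ∈ regionQ (particleHam κ V) lam, IsReducedResolvent (particleHam κ V) P ζ (R ζ))
  (hRK : ∀ ζ ∈ regionQ (particleHam κ V) lam, ‖R ζ‖ ≤ K)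
  (hK : 0 ≤ K) {z : ℂ} (hz : z ∈ regionQ (particleHam κ V) lam)

include h hR hRK hK hz

/-- By the resolvent identity the family is Lipschitz in `r` with constant `K²`, hence norm
continuous and strongly measurable. -/
theorem isFibre_reducedResolvent : IsFibre fun r : ℝ≥0 => R (z - (r : ℝ)) := by
  have hmem : ∀ r : ℝ≥0, z - (r : ℝ) ∈ regionQ (particleHam κ V) lam :=
    fun r => sub_mem_regionQ hz r.2
  refine isFibre_of_lipschitz (C := K) (D := K * K) (fun r => hRK _ (hmem r)) fun r s => ?_
  rw [(hR _ (hmem r)).sub h (hR _ (hmem s)), norm_smul]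
  have h1 : z - (r : ℝ) - (z - (s : ℝ)) = ((s - r : ℝ) : ℂ) := by
    push_cast
    ring
  rw [h1, Complex.norm_real, Real.norm_eq_abs, abs_sub_comm, mul_comm]
  gcongr
  refine (ContinuousLinearMap.opNorm_comp_le _ _).trans ?_
  exact mul_le_mul (hRK _ (hmem r)) (hRK _ (hmem s)) (norm_nonneg _) hK

theorem isDiag_reducedResolvent {a : ℝ≥0 → ℂ} (ha : Measurable a) (hb : ∃ C, ∀ r, ‖a r‖ ≤ C) :
    IsDiag P a fun r : ℝ≥0 => R (z - (r : ℝ)) :=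
  ⟨ha, hb, isFibre_reducedResolvent h hR hRK hK hz,
    fun r x => (hR _ (sub_mem_regionQ hz r.2)).proj x,
    fun r x => (hR _ (sub_mem_regionQ hz r.2)).apply_proj h x⟩

/-- Both quantities that control the interaction, `⟨p⟩²` and `1 + r` applied to a resolvent fibre,
are bounded uniformly in `r` by a constant times `α + K`. The number `α` measures the component on
`Ran P` and `K` the one on `ker P`. -/
theorem exists_fibre_bound (hκ : κ ≠ 0) (hκ' : 0 ≤ κ.re) (hV : PotentialBound κ V)
    (hlam : ‖lam‖ ≤ M) (hgap : gap (particleHam κ V) lam ≤ M) (hP : ‖P‖ ≤ M)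
    (hMK : 1 ≤ (M + 1) * K) {a : ℝ≥0 → ℂ} (ha : Measurable a) {α : ℝ}
    (hα : ∀ r : ℝ≥0, (1 + (r : ℝ)) * ‖a r‖ ≤ α) :
    ∃ L : ℝ≥0 → Particle →L[ℂ] Particle, IsFibre L ∧
      (∀ r, besselOp 2 zero_le_two ∘L L r = a r • P + R (z - (r : ℝ))) ∧
      (∀ r, ‖L r‖ ≤ fibreConst M ‖κ‖ * (α + K)) ∧
      ∀ r : ℝ≥0, ((1 + r : ℝ≥0) : ℝ) * ‖besselOp 2 zero_le_two ∘L L r‖ ≤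
        fibreConst M ‖κ‖ * (α + K) := by
  have hM : 0 ≤ M := (norm_nonneg _).trans hlam
  have hn : 0 < ‖κ‖ := norm_pos_iff.2 hκ
  have hmem : ∀ r : ℝ≥0, z - (r : ℝ) ∈ regionQ (particleHam κ V) lam :=
    fun r => sub_mem_regionQ hz r.2
  have hα0 : 0 ≤ α := le_trans (by positivity) (hα 0)
  have haα : ∀ r, ‖a r‖ ≤ α := fun r =>
    (le_mul_of_one_le_left (norm_nonneg _) (by simp)).trans (hα r)
  obtain ⟨LP, hLP, hLPb⟩ := exists_besselOp_comp_proj hκ hκ' hV h hlam hP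
  have hex := fun r : ℝ≥0 => exists_besselOp_comp_reduced hκ hκ' hV hlam hgap hP hK hMK (hmem r)
    (hR _ (hmem r)) (hRK _ (hmem r))
  choose LR hLR using fun r => (hex r).1
  set ℓ := (1 + (2 * (1 + M) ^ 2 + 2 * (1 + 4 * M)) / ‖κ‖) * K with hℓ
  have hLRf : IsFibre LR := by
    refine isFibre_of_lipschitz (C := ℓ) (D := ℓ * K) (fun r => (hLR r).2) fun r s => ?_
    -- The resolvent identity for `R`, with the injective factor `⟨p⟩^{-2}` cancelled.
    have h1 : LR r - LR s = ((s - r : ℝ) : ℂ) • (LR r ∘L R (z - (s : ℝ))) := by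
      ext1 x
      refine besselOp_injective 2 zero_le_two ?_
      have h2 := DFunLike.congr_fun ((hR _ (hmem r)).sub h (hR _ (hmem s))) x
      have h3 : z - (r : ℝ) - (z - (s : ℝ)) = ((s - r : ℝ) : ℂ) := by
        push_cast
        ring
      have h4 : ∀ r x, besselOp 2 zero_le_two (LR r x) = R (z - (r : ℝ)) x := fun r x =>
        DFunLike.congr_fun (hLR r).1 x
      rw [h3] at h2
      simp only [_root_.sub_apply, _root_.smul_apply, ContinuousLinearMap.comp_apply, map_sub,
        map_smul, h4] at h2 ⊢
      exact h2
    rw [h1, norm_smul, Complex.norm_real, Real.norm_eq_abs, abs_sub_comm, mul_comm]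
    gcongr
    refine (ContinuousLinearMap.opNorm_comp_le _ _).trans ?_
    exact mul_le_mul (hLR r).2 (hRK _ (hmem s)) (norm_nonneg _) (by positivity)
  have hcomp : ∀ r, besselOp 2 zero_le_two ∘L (a r • LP + LR r) = a r • P + R (z - (r : ℝ)) := by
    intro r
    rw [ContinuousLinearMap.comp_add, ContinuousLinearMap.comp_smul, hLP, (hLR r).1]
  refine ⟨fun r => a r • LP + LR r, (IsFibre.smul ha haα (IsFibre.const LP)).add hLRf, hcomp,
    fun r => ?_, fun r => ?_⟩
  · have h1 : ‖a r • LP + LR r‖ ≤ α * (M + 2 * (1 + 4 * M) * M / ‖κ‖) + ℓ := by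
      refine (norm_add_le _ _).trans (add_le_add ?_ (hLR r).2)
      rw [norm_smul]
      exact mul_le_mul (haα r) hLPb (norm_nonneg _) hα0
    refine h1.trans ?_
    have h2 : fibreConst M ‖κ‖ * (α + K) = α * (M + 2 * (1 + 4 * M) * M / ‖κ‖) + ℓ +
        (α * (1 + (2 * (1 + M) ^ 2 + 2 * (1 + 4 * M)) / ‖κ‖ +
          (2 * (1 + M) ^ 2 + 2 * (1 + 4 * M) + (1 + 2 * M))) +
        K * (M + 2 * (1 + 4 * M) * M / ‖κ‖ +
          (2 * (1 + M) ^ 2 + 2 * (1 + 4 * M) + (1 + 2 * M)))) := by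
      rw [fibreConst, hℓ]
      ring
    rw [h2]
    exact le_add_of_nonneg_right (by positivity)
  · rw [hcomp]
    have h0 : ∀ f, (1 + (r : ℝ)) * ‖R (z - (r : ℝ)) f‖ ≤
        (2 * (1 + M) ^ 2 + 2 * (1 + 4 * M) + (1 + 2 * M)) * K * ‖f‖ := by
      intro f
      have h1 := (hex r).2 f
      have h2 : ‖R (z - (r : ℝ)) f‖ ≤ K * ‖f‖ := (R _).le_of_opNorm_le (hRK _ (hmem r)) f
      have h3 := (re_le_of_mem_regionQ hz hlam hgap).1
      rw [Complex.sub_re, Complex.ofReal_re] at h1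
      -- Write `1 + r = -(Re z - r) + (1 + Re z)`: the first part is covered by the decay estimate,
      -- the second by `Re z ≤ 2M`.
      calc _ = -(z.re - r) * ‖R (z - (r : ℝ)) f‖ + (1 + z.re) * ‖R (z - (r : ℝ)) f‖ := by ring
        _ ≤ (2 * (1 + M) ^ 2 + 2 * (1 + 4 * M)) * K * ‖f‖ +
            (1 + 2 * M) * (K * ‖f‖) := by
            refine add_le_add h1 ?_
            exact (mul_le_mul_of_nonneg_right (by linarith) (norm_nonneg _)).trans
              (mul_le_mul_of_nonneg_left h2 (by positivity))
        _ = _ := by ring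
    have h4 : (1 + (r : ℝ)) * ‖R (z - (r : ℝ))‖ ≤
        (2 * (1 + M) ^ 2 + 2 * (1 + 4 * M) + (1 + 2 * M)) * K := by
      have h5 : (0 : ℝ) < 1 + r := by positivity
      rw [mul_comm, ← le_div_iff₀ h5]
      refine ContinuousLinearMap.opNorm_le_bound _ (by positivity) fun f => ?_
      rw [div_mul_eq_mul_div, le_div_iff₀ h5, mul_comm]
      exact h0 f
    have h6 : (1 + (r : ℝ)) * ‖a r • P‖ ≤ α * M := by
      rw [norm_smul, ← mul_assoc]
      exact mul_le_mul (hα r) hP (norm_nonneg _) hα0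
    have h7 : fibreConst M ‖κ‖ * (α + K) = α * M +
        (2 * (1 + M) ^ 2 + 2 * (1 + 4 * M) + (1 + 2 * M)) * K +
        (α * (2 * (1 + 4 * M) * M / ‖κ‖ + (1 + (2 * (1 + M) ^ 2 + 2 * (1 + 4 * M)) / ‖κ‖) +
          (2 * (1 + M) ^ 2 + 2 * (1 + 4 * M) + (1 + 2 * M))) +
        K * (M + 2 * (1 + 4 * M) * M / ‖κ‖ +
          (1 + (2 * (1 + M) ^ 2 + 2 * (1 + 4 * M)) / ‖κ‖))) := by
      rw [fibreConst]
      ring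
    rw [h7]
    calc _ ≤ (1 + (r : ℝ)) * (‖a r • P‖ + ‖R (z - (r : ℝ))‖) := by
          push_cast
          gcongr
          exact norm_add_le _ _
      _ ≤ _ := by
          rw [mul_add]
          refine (add_le_add h6 h4).trans (le_add_of_nonneg_right (by positivity))

end ReducedResolvents

/-! ### The range of the smoothed projection -/

section Range

variable {d : ℕ} {E : Type*} [NormedAddCommGroup E] [NormedSpace ℂ E] {P : E →L[ℂ] E}
  {c : ℝ≥0 → ℝ} {a ι : ℝ≥0 → ℂ}

/-- The closed range is that of the projection with symbol `1_{c ≠ 0}` on `Ran P` and the identity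
on `ker P`. Since `c` may come arbitrarily close to `0`, a vector fixed by this projection is only a
limit of elements of the range. -/
theorem mem_closure_range_diagOp (hP : ∀ x, P (P x) = P x) (ha : ∀ r, a r = c r)
    (hc : ∀ r, |c r| ≤ 1) (hcm : Measurable c) (hι : ∀ r, ι r = if c r = 0 then 0 else 1)
    (hq : IsDiag P a fun _ => 1 - P) (hy : IsDiag P ι fun _ => 1 - P) (u : Fock d E) :
    u ∈ closure (Set.range (diagOp d hq)) ↔ diagOp d hy u = u := by
  have hyq : diagOp d hy * diagOp d hq = diagOp d hq := by
    refine diagOp_mul hP hy hq hq (fun r => ?_) fun r x => by simp [hP]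
    rw [hι, ha]
    split_ifs with h <;> simp [h]
  constructor
  · intro hu
    have hclosed : IsClosed {u | diagOp d hy u = u} :=
      isClosed_eq (diagOp d hy).continuous continuous_id
    refine closure_minimal ?_ hclosed hu
    rintro _ ⟨x, rfl⟩
    exact DFunLike.congr_fun hyq x
  · intro hu
    have hden : ∀ (j : ℕ) r, (0 : ℝ) < (j + 1) * c r ^ 2 + 1 := fun j r => by positivity
    have hdm : ∀ j : ℕ, Measurable fun r => (j + 1) * c r / ((j + 1) * c r ^ 2 + 1) := fun j =>
      (hcm.const_mul _).div (((hcm.pow_const 2).const_mul _).add_const _)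
    -- A bounded regularisation `d_j` of `1/c`. Where `c ≠ 0` one has `c d_j + ((j + 1) c² + 1)⁻¹ =
    -- 1`, and the error term is at most `1` and tends to `0` pointwise.
    have hd : ∀ j : ℕ, IsDiag P (fun r => (((j + 1) * c r / ((j + 1) * c r ^ 2 + 1) : ℝ) : ℂ))
        fun _ => 1 - P := by
      intro j
      refine IsDiag.one_sub hP (Complex.measurable_ofReal.comp (hdm j)) ⟨j + 1, fun r => ?_⟩
      rw [Complex.norm_real, Real.norm_eq_abs, abs_div, abs_mul, abs_of_pos (hden j r),
        abs_of_pos (by positivity : (0 : ℝ) < j + 1), div_le_iff₀ (hden j r)]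
      have h1 : ((j : ℝ) + 1) * |c r| ≤ (j + 1) * 1 := by
        gcongr
        exact hc r
      have h2 : ((j : ℝ) + 1) * 1 ≤ (j + 1) * ((j + 1) * c r ^ 2 + 1) := by
        gcongr
        exact le_add_of_nonneg_left (by positivity)
      exact h1.trans h2
    have hιm : Measurable ι := hy.measurable
    have hι1 : ∀ r, ‖ι r‖ ≤ 1 := fun r => by
      rw [hι]
      split_ifs <;> simp
    have hfb : ∀ (j : ℕ) r, ‖ι r * ((((j + 1) * c r ^ 2 + 1)⁻¹ : ℝ) : ℂ)‖ ≤ 1 := by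
      intro j r
      rw [norm_mul, Complex.norm_real, Real.norm_of_nonneg (by positivity)]
      refine mul_le_one₀ (hι1 r) (by positivity) (inv_le_one_of_one_le₀ ?_)
      exact le_add_of_nonneg_left (by positivity)
    have hf : ∀ j : ℕ, IsDiag P (fun r => ι r * ((((j + 1) * c r ^ 2 + 1)⁻¹ : ℝ) : ℂ))
        fun _ => 0 := fun j => IsDiag.zero (hιm.mul (Complex.measurable_ofReal.comp
          (((hcm.pow_const 2).const_mul _).add_const _).inv)) ⟨1, hfb j⟩
    have he : ∀ j : ℕ, diagOp d hq * diagOp d (hd j) + diagOp d (hf j) = diagOp d hy := by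
      intro j
      have he1 : IsDiag P (fun r => a r * (((j + 1) * c r / ((j + 1) * c r ^ 2 + 1) : ℝ) : ℂ))
          fun _ => 1 - P := by
        refine IsDiag.one_sub hP (hq.measurable.mul (hd j).measurable) ?_
        obtain ⟨C, hC⟩ := (hd j).bounded
        refine ⟨1 * C, fun r => (norm_mul_le _ _).trans ?_⟩
        refine mul_le_mul ?_ (hC r) (norm_nonneg _) zero_le_one
        rw [ha, Complex.norm_real]
        exact hc r
      rw [diagOp_mul hP hq (hd j) he1 (fun r => rfl) fun r x => by simp [hP]]
      refine diagOp_add _ _ _ (fun r => ?_) fun r x => by simp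
      rw [ha, hι]
      have h0 := (hden j r).ne'
      split_ifs with h
      · simp [h]
      · rw [one_mul, ← Complex.ofReal_mul, ← Complex.ofReal_add, ← Complex.ofReal_one]
        congr 1
        field_simp
    have hlim : Filter.Tendsto (fun j => diagOp d (hf j) u) Filter.atTop (nhds 0) := by
      refine tendsto_fibreOp (fun j => (hf j).isFibre_diag) (C := ‖P‖₊) (fun j r => ?_)
        (fun r => ?_) u
      · rw [add_zero, norm_smul]
        exact mul_le_of_le_one_left (norm_nonneg _) (hfb j r)
      · simp only [add_zero]
        rw [← zero_smul ℂ P]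
        refine Filter.Tendsto.smul_const ?_ P
        by_cases h : c r = 0
        · simp [hι, h]
        · have h2 : Filter.Tendsto (fun j : ℕ => (((j : ℝ) + 1) * c r ^ 2 + 1)⁻¹) Filter.atTop
              (nhds 0) := by
            refine Filter.Tendsto.inv_tendsto_atTop (Filter.tendsto_atTop_add_const_right _ _ ?_)
            refine Filter.Tendsto.atTop_mul_const (by positivity) ?_
            exact Filter.tendsto_atTop_add_const_right _ _ tendsto_natCast_atTop_atTop
          have h3 := (Complex.continuous_ofReal.tendsto 0).comp h2
          have h4 := h3.const_mul (ι r)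
          simpa using h4
    refine mem_closure_of_tendsto (f := fun j : ℕ => diagOp d hq (diagOp d (hd j) u))
      (b := Filter.atTop) ?_ (Filter.Eventually.of_forall fun j => ⟨_, rfl⟩)
    have h5 : (fun j : ℕ => diagOp d hq (diagOp d (hd j) u)) = fun j => u - diagOp d (hf j) u := by
      funext j
      have h6 := DFunLike.congr_fun (he j) u
      rw [hu] at h6
      exact eq_sub_of_add_eq h6
    rw [h5]
    simpa using tendsto_const_nhds.sub hlim

end Range

/-! ### The resolvent of the free Hamiltonian -/

section Resolvent

variable {E : Type*} [NormedAddCommGroup E] [NormedSpace ℂ E] {A : E →ₗ.[ℂ] E} {lam z : ℂ}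
  {P T : E →L[ℂ] E} {ψ : E}

/-- `A` acts as `lam` on `Ran P`, so the full resolvent is `(lam - z)⁻¹ P` plus the reduced one. -/
theorem mem_graph_iff_resolvent (h : IsSimpleSpectralProjection A lam P ψ)
    (hT : IsReducedResolvent A P z T) (hz : lam - z ≠ 0) (u v : E) :
    (u, v + z • u) ∈ A.graph ↔ u = (lam - z)⁻¹ • P v + T v := by
  constructor
  · intro hu
    have h1 := h.comm_graph hu
    have h2 : P (v + z • u) = lam • P u :=
      LinearPMap.mem_graph_snd_inj A h1 (h.mem_graph_proj u) rfl
    have h3 : P v = (lam - z) • P u := by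
      rw [sub_smul, ← h2, map_add, map_smul, add_sub_cancel_right]
    have h4 := A.graph.sub_mem hu (h.mem_graph_proj u)
    have h5 := hT.unique _ _ h4 (by rw [map_sub, h.idem, sub_self])
    have h6 : v + z • u - lam • P u - z • (u - P u) = v - P v := by
      rw [h3, smul_sub, sub_smul]
      abel
    change T (v + z • u - lam • P u - z • (u - P u)) = u - P u at h5
    rw [h6, map_sub, hT.apply_proj h, sub_zero] at h5
    rw [h5, h3, inv_smul_smul₀ hz]
    abel
  · rintro rfl
    have h1 := A.graph.add_mem (A.graph.smul_mem (lam - z)⁻¹ (h.mem_graph_proj v)) (hT.mem_graph v)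
    have h2 : v + z • ((lam - z)⁻¹ • P v + T v) =
        (lam - z)⁻¹ • lam • P v + (v - P v + z • T v) := by
      have h3 : (lam - z)⁻¹ • lam • P v = z • (lam - z)⁻¹ • P v + P v := by
        have h4 : (lam - z)⁻¹ * lam = z * (lam - z)⁻¹ + 1 := by
          field_simp
          ring
        rw [smul_smul, smul_smul, h4, add_smul, one_smul]
      rw [h3, smul_add]
      abel
    rw [h2]
    exact h1

variable {z' : ℂ} {T' : E →L[ℂ] E}

theorem resolvent_identity (h : IsSimpleSpectralProjection A lam P ψ)
    (hT : IsReducedResolvent A P z T) (hT' : IsReducedResolvent A P z' T') (x : E) :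
    T' ((1 - P : E →L[ℂ] E) x + (z - z') • T x) = T x := by
  have h1 := DFunLike.congr_fun (hT'.sub h hT) x
  simp only [_root_.sub_apply, _root_.smul_apply, ContinuousLinearMap.comp_apply,
    one_apply_eq_self, map_add, map_sub, map_smul, hT'.apply_proj h] at h1 ⊢
  rw [sub_eq_iff_eq_add] at h1
  rw [h1, sub_zero]
  module

/-- The factors are `(A - z) T'` and `(A - z') T`, so on `ker P` they are inverse to each other. -/
theorem reduced_mul (h : IsSimpleSpectralProjection A lam P ψ)
    (hT : IsReducedResolvent A P z T) (hT' : IsReducedResolvent A P z' T') (x : E) :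
    ((1 - P : E →L[ℂ] E) + (z' - z) • T') (((1 - P : E →L[ℂ] E) + (z - z') • T) x) =
      (1 - P : E →L[ℂ] E) x := by
  have h1 := resolvent_identity h hT hT' x
  have h2 := h.idem
  have h3 := hT.proj
  simp only [_root_.add_apply, _root_.smul_apply, h1]
  simp only [_root_.sub_apply, one_apply_eq_self, map_add, map_sub, map_smul, h2, h3]
  module

end Resolvent

/-! ### The free part of the Feshbach-Schur map -/

section Shift

variable {H : Type*} [NormedAddCommGroup H] [NormedSpace ℂ H] {H₀ : H →ₗ.[ℂ] H} {G : H →L[ℂ] H}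
  {z : ℂ}

/-- On `Ran G` one has `H₀ - ζ = (H₀ - z) + (z - ζ)`, and `H₀ - z` undoes `G`. -/
theorem mem_graph_shift_of_resolvent (h : ∀ u v, (u, v + z • u) ∈ H₀.graph ↔ u = G v) (ζ : ℂ)
    (u v : H) : (u, v) ∈ (shift H₀ ζ).graph ↔ ∃ f, u = G f ∧ v = (1 + (z - ζ) • G) f := by
  rw [mem_graph_shift]
  constructor
  · intro hu
    have h1 : v + ζ • u = (v + (ζ - z) • u) + z • u := by module
    rw [h1, h] at hu
    refine ⟨_, hu, ?_⟩
    change v = v + (ζ - z) • u + (z - ζ) • G (v + (ζ - z) • u)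
    rw [← hu]
    module
  · rintro ⟨f, rfl, rfl⟩
    have h1 : (1 + (z - ζ) • G) f + ζ • G f = f + z • G f := by
      change f + (z - ζ) • G f + ζ • G f = _
      module
    rw [h1, h]

theorem injective_of_resolvent (h : ∀ u v, (u, v + z • u) ∈ H₀.graph ↔ u = G v) :
    Function.Injective G := by
  rw [injective_iff_map_eq_zero]
  intro f hf
  have h1 := (h 0 f).2 hf.symm
  rw [smul_zero, add_zero] at h1
  exact LinearPMap.mem_graph_snd_inj _ h1 (Submodule.zero_mem _) rfl

theorem Fock.eq_add_smul {d : ℕ} {u v f : Fock d H} {w : ℂ}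
    (h : ∀ n, ∀ᵐ k ∂photonMeasureN d n, sector f n k = sector u n k + w • sector v n k) :
    f = u + w • v := by
  refine fock_ext fun n => ?_
  filter_upwards [h n, sector_add u (w • v) n, sector_smul w v n] with k h1 h2 h3
  rw [h1, h2, h3]

end Shift

/-! ### Fibre formulas for `τ`, its partial inverse `t`, and the smoothed projections. -/

section FreePart

variable {d : ℕ} {E : Type*} [NormedAddCommGroup E] [NormedSpace ℂ E]
  {A : E →ₗ.[ℂ] E} {lam z ζ : ℂ} {P : E →L[ℂ] E} {ψ : E} {T T' : ℝ≥0 → E →L[ℂ] E}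
  {a b ι : ℝ≥0 → ℂ} {c χ : ℝ≥0 → ℝ}

theorem diagOp_resolvent_ham (h : IsSimpleSpectralProjection A lam P ψ)
    (hT : ∀ r : ℝ≥0, IsReducedResolvent A P (z - (r : ℝ)) (T r)) (hG : IsDiag P a T)
    (ha : ∀ r : ℝ≥0, a r = (lam - (z - (r : ℝ)))⁻¹) (hne : ∀ r : ℝ≥0, lam - (z - (r : ℝ)) ≠ 0)
    (hb : ∃ C, ∀ r : ℝ≥0, (r : ℝ) * ‖a r • P + T r‖ ≤ C) (u v : Fock d E) :
    (u, v + z • u) ∈ (freeHam d A).graph ↔ u = diagOp d hG v := by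
  refine mem_graph_freeHam hG.isFibre_diag hb fun r u v => ?_
  have h1 := mem_graph_iff_resolvent h (hT r) (hne r) u v
  rw [sub_smul, ← add_sub_assoc] at h1
  rw [h1, ha]
  rfl

theorem sector_diagOp (h : IsDiag P a T) (u : Fock d E) (n : ℕ) :
    ∀ᵐ k ∂photonMeasureN d n, sector (diagOp d h u) n k =
      a (photonEnergyNN k) • P (sector u n k) + T (photonEnergyNN k) (sector u n k) :=
  sector_fibreOp h.isFibre_diag u n

theorem diagOp_sq_add_sq (hP : ∀ x, P (P x) = P x) (hχ : ∀ r, χ r ^ 2 + c r ^ 2 = 1)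
    (hp : IsDiag P (fun r => (χ r : ℂ)) fun _ => 0)
    (hq : IsDiag P (fun r => (c r : ℂ)) fun _ => 1 - P) :
    diagOp d hp * diagOp d hp + diagOp d hq * diagOp d hq = 1 := by
  have hbd : ∀ {a : ℝ≥0 → ℂ}, (∃ C, ∀ r, ‖a r‖ ≤ C) → ∃ C, ∀ r, ‖a r * a r‖ ≤ C := by
    rintro a ⟨C, hC⟩
    exact ⟨C * C, fun r => (norm_mul_le _ _).trans
      (mul_le_mul (hC r) (hC r) (norm_nonneg _) ((norm_nonneg _).trans (hC r)))⟩
  have hpp : IsDiag P (fun r => (χ r : ℂ) * χ r) fun _ => 0 :=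
    IsDiag.zero (hp.measurable.mul hp.measurable) (hbd hp.bounded)
  have hqq : IsDiag P (fun r => (c r : ℂ) * c r) fun _ => 1 - P :=
    IsDiag.one_sub hP (hq.measurable.mul hq.measurable) (hbd hq.bounded)
  have h1 : IsDiag P (fun _ => (1 : ℂ)) fun _ => 1 - P :=
    IsDiag.one_sub hP measurable_const ⟨‖(1 : ℂ)‖, fun _ => le_rfl⟩
  have e1 := diagOp_mul (d := d) hP hp hp hpp (fun _ => rfl) fun r x => rfl
  have e2 := diagOp_mul (d := d) hP hq hq hqq (fun _ => rfl) fun r x => by simp [hP]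
  have e3 := diagOp_add (d := d) hpp hqq h1 (fun r => by
    rw [← Complex.ofReal_mul, ← Complex.ofReal_mul, ← Complex.ofReal_add, ← sq, ← sq, hχ,
      Complex.ofReal_one]) fun r x => by simp
  have e4 := diagOp_eq_one (d := d) h1 (fun r => rfl) fun r x => rfl
  exact (congrArg₂ (· + ·) e1 e2).trans (e3.trans e4)

/-- Formally `t = (H₀ - z) (H₀ - ζ)⁻¹ y = y + (ζ - z) (H₀ - ζ)⁻¹ y`, so that `G t = (H₀ - ζ)⁻¹ y`.
The indicator `ι` removes the photon energies at which `lam - (ζ - r)` may vanish. All identities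
reduce to scalar ones on `Ran P` and to resolvent identities on `ker P`. -/
theorem exists_diagOp_inverse (h : IsSimpleSpectralProjection A lam P ψ)
    (hT : ∀ r : ℝ≥0, IsReducedResolvent A P (z - (r : ℝ)) (T r))
    (hT' : ∀ r : ℝ≥0, IsReducedResolvent A P (ζ - (r : ℝ)) (T' r))
    (hG : IsDiag P a T) (hG' : IsDiag P b T')
    (ha : ∀ r : ℝ≥0, a r = (lam - (z - (r : ℝ)))⁻¹) (hne : ∀ r : ℝ≥0, lam - (z - (r : ℝ)) ≠ 0)
    (hb : ∀ r : ℝ≥0, b r = ι r * (lam - (ζ - (r : ℝ)))⁻¹)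
    (hι : ∀ r, ι r = if c r = 0 then 0 else 1)
    (hne' : ∀ r : ℝ≥0, c r ≠ 0 → lam - (ζ - (r : ℝ)) ≠ 0)
    (hχ : ∀ r, χ r ^ 2 + c r ^ 2 = 1)
    (hp : IsDiag P (fun r => (χ r : ℂ)) fun _ => 0)
    (hq : IsDiag P (fun r => (c r : ℂ)) fun _ => 1 - P) (hy : IsDiag P ι fun _ => 1 - P) :
    ∃ t : Fock d E →L[ℂ] Fock d E, diagOp d hG * t = diagOp d hG' ∧ diagOp d hq * t = t * diagOp d hq ∧
      ∀ w, IsUnit (1 + diagOp d hq * w * diagOp d hq * t) → ∃ s,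
        FeshbachData (diagOp d hp) (diagOp d hq) (diagOp d hy) (1 + (z - ζ) • diagOp d hG) w t s := by
  have hP := h.idem
  have hbd : ∀ {a : ℝ≥0 → ℂ}, (∃ C, ∀ r, ‖a r‖ ≤ C) → ∀ w : ℂ, ∃ C, ∀ r, ‖w * a r‖ ≤ C := by
    rintro a ⟨C, hC⟩ w
    refine ⟨‖w‖ * C, fun r => ?_⟩
    rw [norm_mul]
    exact mul_le_mul_of_nonneg_left (hC r) (norm_nonneg _)
  have hadd : ∀ {a b : ℝ≥0 → ℂ}, (∃ C, ∀ r, ‖a r‖ ≤ C) → (∃ C, ∀ r, ‖b r‖ ≤ C) →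
      ∃ C, ∀ r, ‖a r + b r‖ ≤ C := by
    rintro a b ⟨C, hC⟩ ⟨D, hD⟩
    exact ⟨C + D, fun r => (norm_add_le _ _).trans (add_le_add (hC r) (hD r))⟩
  have hτ : IsDiag P (fun r => 1 + (z - ζ) * a r) fun r => (1 - P) + (z - ζ) • T r :=
    IsDiag.one_sub_add_smul hP (measurable_const.add (hG.measurable.const_mul _))
      (hadd ⟨‖(1 : ℂ)‖, fun _ => le_rfl⟩ (hbd hG.bounded _)) hG _
  have ht : IsDiag P (fun r => ι r + (ζ - z) * b r) fun r => (1 - P) + (ζ - z) • T' r :=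
    IsDiag.one_sub_add_smul hP (hy.measurable.add (hG'.measurable.const_mul _))
      (hadd hy.bounded (hbd hG'.bounded _)) hG' _
  have hτ' : diagOp d hτ = 1 + (z - ζ) • diagOp d hG := by
    refine ContinuousLinearMap.ext fun u =>
      Fock.eq_add_smul (u := u) (v := diagOp d hG u) fun n => ?_
    filter_upwards [sector_diagOp hτ u n, sector_diagOp hG u n] with k h5 h6
    refine h5.trans ?_
    simp only [h6, _root_.add_apply, _root_.smul_apply, _root_.sub_apply, one_apply_eq_self]
    module
  have hsc : ∀ r : ℝ≥0, ι r ≠ 0 → lam - (ζ - (r : ℝ)) ≠ 0 := fun r h1 => hne' r fun h2 =>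
    h1 (by rw [hι, if_pos h2])
  have hsub : ∀ (x y : ℂ) (r : ℝ≥0), x - (r : ℝ) - (y - (r : ℝ)) = x - y := fun x y r =>
    sub_sub_sub_cancel_right _ _ _
  have hGt : diagOp d hG * diagOp d ht = diagOp d hG' := by
    refine diagOp_mul hP hG ht hG' (fun r => ?_) fun r x => ?_
    · rw [ha, hb]
      have h1 := hne r
      by_cases h0 : ι r = 0
      · simp [h0]
      · have h2 := hsc r h0
        field_simp
        ring
    · have h1 := resolvent_identity h (hT' r) (hT r) x
      rw [hsub] at h1
      exact h1
  have hτt : diagOp d hτ * diagOp d ht = diagOp d hy := by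
    refine diagOp_mul hP hτ ht hy (fun r => ?_) fun r x => ?_
    · rw [ha, hb]
      have h1 := hne r
      by_cases h0 : ι r = 0
      · simp [h0]
      · have h2 := hsc r h0
        field_simp
        ring
    · have h1 := reduced_mul h (hT' r) (hT r) x
      rw [hsub, hsub] at h1
      exact h1
  have htτ : diagOp d ht * diagOp d hτ = diagOp d hy := by
    refine diagOp_mul hP ht hτ hy (fun r => ?_) fun r x => ?_
    · rw [ha, hb]
      have h1 := hne r
      by_cases h0 : ι r = 0
      · simp [h0]
      · have h2 := hsc r h0
        field_simp
        ring
    · have h1 := reduced_mul h (hT r) (hT' r) x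
      rw [hsub, hsub] at h1
      exact h1
  have hιι : ∀ r, ι r * ι r = ι r := fun r => by
    rw [hι]
    split_ifs <;> simp
  have hιc : ∀ r, ι r * (c r : ℂ) = c r := fun r => by
    rw [hι]
    split_ifs with h1 <;> simp [h1]
  have hid : ∀ {S : ℝ≥0 → E →L[ℂ] E} {a : ℝ≥0 → ℂ}, IsDiag P a S → ∀ r x,
      (1 - P : E →L[ℂ] E) (S r x) = S r x := fun hS r x => by simp [hS.left]
  have hid' : ∀ {S : ℝ≥0 → E →L[ℂ] E} {a : ℝ≥0 → ℂ}, IsDiag P a S → ∀ r x,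
      S r ((1 - P : E →L[ℂ] E) x) = S r x := fun hS r x => by simp [hS.right]
  refine ⟨diagOp d ht, hGt, diagOp_mul_comm hP hq ht fun r x => by rw [hid ht, hid' ht], fun w hw => ?_⟩
  rw [← hτ']
  refine exists_feshbachData (diagOp_sq_add_sq hP hχ hp hq) (diagOp_mul_comm hP hp hτ fun r x => by simp)
    (diagOp_mul_comm hP hq hτ fun r x => by rw [hid hτ, hid' hτ])
    (diagOp_mul_comm hP hp hq fun r x => by simp) (diagOp_mul_comm hP hp ht fun r x => by simp)
    (diagOp_mul hP hy hq hq hιc fun r x => by simp [hP])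
    (diagOp_mul hP hq hy hq (fun r => by rw [mul_comm]; exact hιc r) fun r x => by simp [hP])
    hτt htτ (diagOp_mul hP hy ht ht (fun r => ?_) fun r x => hid ht r x)
    (diagOp_mul hP ht hy ht (fun r => ?_) fun r x => hid' ht r x) hw
  · rw [hb, mul_add, hιι, mul_left_comm, ← mul_assoc (ι r), hιι]
  · rw [hb, add_mul, hιι, mul_assoc, mul_right_comm, hιι]

end FreePart

/-! ### The spectra of the Feshbach-Schur map, abstractly -/

section AbstractSpectra

variable {H X : Type*} [NormedAddCommGroup H] [NormedSpace ℂ H] [NormedAddCommGroup X]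
  [NormedSpace ℂ X] {H₀ I Q Qb D D' : H →ₗ.[ℂ] H} {T : X →ₗ.[ℂ] H} {S : Submodule ℂ H} {ζ c : ℂ}
  {G p q y τ w t s Γ Γ' : H →L[ℂ] H} {J : X →L[ℂ] H} {J' : H →L[ℂ] X}

/-- As `q` commutes with `t`, the perturbation is `q (w t) q`. Only `w t`, that is the interaction
after the free resolvent on `Ran π̄`, has to be small. -/
theorem isUnit_one_add_of_bound [CompleteSpace H] {C b : ℝ} (hC : 0 ≤ C) (hb : 0 ≤ b)
    (hq : ‖q‖ ≤ C) (hqt : q * t = t * q) (hw : ∀ f, ‖w (t f)‖ ≤ b * ‖f‖) (h1 : C * b * C < 1) :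
    IsUnit (1 + q * w * q * t) := by
  have h2 : ‖w * t‖ ≤ b := ContinuousLinearMap.opNorm_le_bound _ hb hw
  have h3 : q * w * q * t = q * (w * t) * q := by
    rw [mul_assoc (q * w), hqt]
    noncomm_ring
  have h4 : ‖-(q * (w * t) * q)‖ < 1 := by
    rw [norm_neg]
    refine lt_of_le_of_lt ((norm_mul_le _ _).trans ?_) h1
    refine mul_le_mul ((norm_mul_le _ _).trans ?_) hq (norm_nonneg _) (by positivity)
    exact mul_le_mul hq h2 (norm_nonneg _) hC
  rw [h3, ← sub_neg_eq_add]
  exact isUnit_one_sub_of_norm_lt_one h4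

/-- With `U = Γ' J` and `U' = J' Γ` one has `U' U = 1` and `U U' = L`. Both unbounded operators are
represented by bounded ones, and the two homotopy retracts carry injectivity, surjectivity and the
Fredholm property back and forth. -/
theorem spectra_iff_of_feshbach [CompleteSpace H] [CompleteSpace X]
    (h : IsRepresented H₀ I Q Qb S ζ G p q y τ w)
    (hd : FeshbachData p q y τ w t s) (hc : c ≠ 0)
    (hD : ∀ u v, (u, v) ∈ D.graph ↔ v = Γ u) (hD' : ∀ u v, (u, v) ∈ D'.graph ↔ v = Γ' u)
    (hT : ∀ u v, (u, v) ∈ T.graph ↔ v = J u) (hJ : ∀ x, J' (J x) = x)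
    (hΓ : ∀ u, Γ (Γ' u) = u) (hΓ' : ∀ u, Γ' (Γ u) = u) {L : H →L[ℂ] H}
    (hL : ∀ u, Γ' (J (J' (Γ u))) = L u) (hLp : L * p = p) (hpL : p * L = p)
    (hLG : L * G = G * L) (hLτ : L * τ = τ * L) {F : H →ₗ.[ℂ] H}
    (hF : F = shift H₀ ζ + opComp Q (opComp I Q) - opComp Q (opComp I (opComp Qb
      (opComp ((shift (H₀ + opComp Qb (opComp I Qb)) ζ).domRestrict S).inverse
        (opComp Qb (opComp I Q)))))) {Heff : X →ₗ.[ℂ] X}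
    (hH : Heff = opComp T.inverse (opComp (c • opComp D (opComp F D')) T)) :
    (ζ ∈ opSpectrum (H₀ + I) ↔ 0 ∈ opSpectrum Heff) ∧
      (ζ ∈ pointSpectrum (H₀ + I) ↔ 0 ∈ pointSpectrum Heff) ∧
      (ζ ∈ essSpectrum (H₀ + I) ↔ 0 ∈ essSpectrum Heff) := by
  have hUU : (Γ' ∘L J) ∘L (J' ∘L Γ) = L := ContinuousLinearMap.ext hL
  have hU : (J' ∘L Γ) ∘L (Γ' ∘L J) = 1 := ContinuousLinearMap.ext fun x => by
    change J' (Γ (Γ' (J x))) = x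
    rw [hΓ, hJ]
  have hp : ((Γ' ∘L J) ∘L (J' ∘L Γ)) * p = p := by rw [hUU, hLp]
  have hp' : p * ((Γ' ∘L J) ∘L (J' ∘L Γ)) = p := by rw [hUU, hpL]
  have hτ : ((Γ' ∘L J) ∘L (J' ∘L Γ)) * τ = τ * ((Γ' ∘L J) ∘L (J' ∘L Γ)) := by rw [hUU, hLτ]
  have hcomm : ∀ u, Γ' (J (J' (Γ (G u)))) = G (Γ' (J (J' (Γ u)))) := fun u => by
    rw [hL, hL]
    exact DFunLike.congr_fun hLG u
  have hgF : ∀ u v, (u, v) ∈ F.graph ↔ ∃ f, u = G f ∧ v = feshF p q τ w s f := by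
    rw [hF]
    exact h.graph_feshbach hd
  have heff : ∀ u v, (u, v) ∈ (shift Heff 0).graph ↔ ∃ x,
      u = (J' ∘L Γ ∘L G ∘L Γ' ∘L J) x ∧
      v = (c • ((J' ∘L Γ) ∘L feshF p q τ w s ∘L (Γ' ∘L J))) x := by
    intro u v
    rw [mem_graph_shift, zero_smul, add_zero, hH]
    exact graph_effective hgF h.injective hD hD' hT hJ hΓ hΓ' hcomm
      (fun x => feshF_apply_range (U := Γ' ∘L J) (U' := J' ∘L Γ) hU hp hτ x) u v
  have hGi : Function.Injective (J' ∘L Γ ∘L G ∘L Γ' ∘L J) := by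
    intro x x' hx
    have h1 : Γ' (J (J' (Γ (G (Γ' (J x)))))) = Γ' (J (J' (Γ (G (Γ' (J x')))))) :=
      congrArg (fun x => Γ' (J x)) hx
    rw [hcomm, hcomm, hΓ, hΓ, hJ, hJ] at h1
    have h2 := congrArg (fun u => J' (Γ u)) (h.injective h1)
    simpa only [hΓ, hJ] using h2
  obtain ⟨r1⟩ := nonempty_homotopyRetract_feshF hd hc hp hp'
  obtain ⟨r2⟩ := nonempty_homotopyRetract_feshF' hd hc hU hp hp' hτ
  have hg := h.graph_hamiltonian
  rw [mem_opSpectrum_iff_of_graph h.injective hg, mem_opSpectrum_iff_of_graph hGi heff,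
    mem_pointSpectrum_iff_of_graph h.injective hg, mem_pointSpectrum_iff_of_graph hGi heff,
    mem_essSpectrum_iff_of_graph h.injective hg, mem_essSpectrum_iff_of_graph hGi heff]
  have hinj : Function.Injective (τ + w) ↔
      Function.Injective (c • ((J' ∘L Γ) ∘L feshF p q τ w s ∘L (Γ' ∘L J))) :=
    ⟨fun h1 => r2.injective h1, fun h1 => r1.injective h1⟩
  have hsurj : Function.Surjective (τ + w) ↔
      Function.Surjective (c • ((J' ∘L Γ) ∘L feshF p q τ w s ∘L (Γ' ∘L J))) :=
    ⟨fun h1 => r2.surjective h1, fun h1 => r1.surjective h1⟩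
  exact ⟨not_congr (and_congr hinj hsurj), not_congr hinj,
    not_congr ⟨fun h1 => r2.isFredholmCLM h1, fun h1 => r1.isFredholmCLM h1⟩⟩

end AbstractSpectra

/-! ### The cutoff functions -/

section Cutoff

variable {χ : ℝ → ℝ} {ρ : ℝ}

theorem IsCutoff.lt_of_sqrt_ne_zero (hχ : IsCutoff χ) (hρ : 0 < ρ) {r : ℝ}
    (h : √(1 - χ (r / ρ) ^ 2) ≠ 0) : 9 / 10 * ρ < r := by
  by_contra! h1
  refine h ?_
  rw [hχ.2.2.1 _ ((div_le_iff₀ hρ).2 h1)]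
  simp

theorem IsCutoff.sq_add_sq (hχ : IsCutoff χ) (r : ℝ) : χ r ^ 2 + √(1 - χ r ^ 2) ^ 2 = 1 := by
  have h1 := hχ.2.1 r
  rw [Real.sq_sqrt]
  · ring
  · nlinarith

theorem IsCutoff.abs_sqrt_le (r : ℝ) : |√(1 - χ r ^ 2)| ≤ 1 := by
  rw [abs_of_nonneg (Real.sqrt_nonneg _)]
  exact Real.sqrt_le_one.2 (sub_le_self _ (sq_nonneg _))

/-- On the support of `π̄` within `Ran P` one has `r > 9ρ/10`, so `|lam - ζ + r| ≥ r - ρ/2 ≥ 2ρ/5`.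
The margin between `9/10` and `1/2` makes the denominator proportional to `ρ`. -/
theorem IsCutoff.norm_inv_le (hχ : IsCutoff χ) (hρ : 0 < ρ) {M : ℝ} (hM0 : 0 ≤ M) (hM : ρ ≤ 2 * (M + 1))
    {lam ζ : ℂ} (hζ : (ζ - lam).re ≤ ρ / 2) (r : ℝ≥0) (h : √(1 - χ (r / ρ) ^ 2) ≠ 0) :
    lam - (ζ - (r : ℝ)) ≠ 0 ∧ (1 + (r : ℝ)) * ‖(lam - (ζ - (r : ℝ)))⁻¹‖ ≤ 7 * (M + 1) / ρ := by
  have h1 := hχ.lt_of_sqrt_ne_zero hρ h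
  have h2 : (lam - (ζ - (r : ℝ))).re = r - (ζ - lam).re := by
    simp only [Complex.sub_re, Complex.ofReal_re]
    ring
  have h3 : (r : ℝ) - ρ / 2 ≤ ‖lam - (ζ - (r : ℝ))‖ := by
    refine le_trans ?_ (Complex.re_le_norm _)
    rw [h2]
    linarith
  have h4 : 0 < ‖lam - (ζ - (r : ℝ))‖ := by linarith
  refine ⟨norm_pos_iff.1 h4, ?_⟩
  rw [norm_inv, ← div_eq_mul_inv, div_le_div_iff₀ h4 hρ]
  -- The three terms below contribute `5/2 + 2 + 5/2 = 7` times `M + 1`, using `ρ ≤ 2(M + 1)`.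
  have h5 : ρ ≤ 5 / 2 * ‖lam - (ζ - (r : ℝ))‖ := by linarith
  calc (1 + (r : ℝ)) * ρ ≤ (1 + (‖lam - (ζ - (r : ℝ))‖ + ρ / 2)) * ρ := by
        gcongr
        linarith
    _ = 1 * ρ + ‖lam - (ζ - (r : ℝ))‖ * ρ + ρ / 2 * ρ := by ring
    _ ≤ (M + 1) * (5 / 2 * ‖lam - (ζ - (r : ℝ))‖) + ‖lam - (ζ - (r : ℝ))‖ * (2 * (M + 1)) +
        2 * (M + 1) / 2 * (5 / 2 * ‖lam - (ζ - (r : ℝ))‖) := by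
        gcongr
        linarith
    _ = 7 * (M + 1) * ‖lam - (ζ - (r : ℝ))‖ := by ring

end Cutoff

/-! ### Relative bounds of the interaction -/

section Bounds

variable {d : ℕ}

theorem IsFibre.congr {E E' : Type*} [NormedAddCommGroup E] [NormedSpace ℂ E]
    [NormedAddCommGroup E'] [NormedSpace ℂ E'] {B C : ℝ≥0 → E →L[ℂ] E'} (hC : IsFibre C)
    (h : ∀ r, B r = C r) : IsFibre B := by
  obtain rfl : B = C := funext h
  exact hC

theorem fibreOp_congr {E E' : Type*} [NormedAddCommGroup E] [NormedSpace ℂ E]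
    [NormedAddCommGroup E'] [NormedSpace ℂ E'] {B C : ℝ≥0 → E →L[ℂ] E'} (h : ∀ r, B r = C r)
    (hB : IsFibre B) (hC : IsFibre C) : fibreOp d B hB = fibreOp d C hC := by
  obtain rfl : B = C := funext h
  rfl

theorem exists_mem_graph_fibreOp_congr {E : Type*} [NormedAddCommGroup E] [NormedSpace ℂ E]
    {I : Fock d E →ₗ.[ℂ] Fock d E} {B C : ℝ≥0 → E →L[ℂ] E} (h : ∀ r, B r = C r)
    (hB : IsFibre B) (hC : IsFibre C) {f : Fock d E} {b : ℝ}
    (hex : ∃ v, (fibreOp d B hB f, v) ∈ I.graph ∧ ‖v‖ ≤ b) :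
    ∃ v, (fibreOp d C hC f, v) ∈ I.graph ∧ ‖v‖ ≤ b := by
  obtain rfl : B = C := funext h
  exact hex

section ConstProjection

variable {E : Type*} [NormedAddCommGroup E] [NormedSpace ℂ E] {P : E →L[ℂ] E}
  {a a' : ℝ≥0 → ℂ} {S : ℝ≥0 → E →L[ℂ] E}

theorem diagOp_mul_comm_one_sub (hP : ∀ x, P (P x) = P x) (h : IsDiag P a S)
    (h' : IsDiag P a' fun _ => 1 - P) :
    diagOp d h * diagOp d h' = diagOp d h' * diagOp d h :=
  diagOp_mul_comm hP h h' fun r x => by simp [h.left, h.right]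

theorem fibreOp_const_eq_diagOp (h : IsDiag P (fun _ => 1) fun _ => 0) :
    fibreOp d _ (IsFibre.const P) = diagOp d h :=
  fibreOp_congr (fun r => by simp) (IsFibre.const P) h.isFibre_diag

theorem isDiag_const (P : E →L[ℂ] E) : IsDiag P (fun _ => (1 : ℂ)) fun _ => 0 :=
  IsDiag.zero measurable_const ⟨‖(1 : ℂ)‖, fun _ => le_rfl⟩

theorem fibreOp_const_mul_comm (hP : ∀ x, P (P x) = P x) (h : IsDiag P a S) :
    fibreOp d _ (IsFibre.const P) * diagOp d h = diagOp d h * fibreOp d _ (IsFibre.const P) := by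
  rw [fibreOp_const_eq_diagOp (isDiag_const P)]
  exact diagOp_mul_comm hP _ h fun r x => by simp

theorem fibreOp_const_mul (hP : ∀ x, P (P x) = P x) (h : IsDiag P a fun _ => 0) :
    fibreOp d _ (IsFibre.const P) * diagOp d h = diagOp d h := by
  rw [fibreOp_const_eq_diagOp (isDiag_const P)]
  exact diagOp_mul hP _ h h (fun r => one_mul _) fun r x => rfl

end ConstProjection

variable {κ lam z : ℂ} {V : Pos → ℂ} {P : Particle →L[ℂ] Particle} {ψ : Particle}
  {R : ℂ → Particle →L[ℂ] Particle} {M K μ δ₀ g α : ℝ} {w : ∀ m n, Coupling d m n}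
  {a : ℝ≥0 → ℂ}

/-- This serves twice: at `z = λ_j - 1` it makes `W = I_g G` a bounded operator, and at `z = ζ` it
bounds `W t`, the quantity in the Neumann series. -/
theorem diagOp_interaction_bound (h : IsSimpleSpectralProjection (particleHam κ V) lam P ψ)
    (hR : ∀ ζ ∈ regionQ (particleHam κ V) lam, IsReducedResolvent (particleHam κ V) P ζ (R ζ))
    (hRK : ∀ ζ ∈ regionQ (particleHam κ V) lam, ‖R ζ‖ ≤ K)
    (hK : 0 ≤ K) (hz : z ∈ regionQ (particleHam κ V) lam) (hκ : κ ≠ 0) (hκ' : 0 ≤ κ.re)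
    (hGH : IsGH μ δ₀ M κ V w) (hμ : 0 ≤ μ) (hδ₀ : 0 ≤ δ₀) (hg : 0 ≤ g)
    (hlam : ‖lam‖ ≤ M) (hgap : gap (particleHam κ V) lam ≤ M) (hP : ‖P‖ ≤ M)
    (hMK : 1 ≤ (M + 1) * K) (ha : IsDiag P a fun r : ℝ≥0 => R (z - (r : ℝ)))
    (hα : ∀ r : ℝ≥0, (1 + (r : ℝ)) * ‖a r‖ ≤ α) :
    (∃ C, ∀ r : ℝ≥0, (r : ℝ) * ‖a r • P + R (z - (r : ℝ))‖ ≤ C) ∧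
    ∀ f, ∃ v, (diagOp d ha f, v) ∈ (interaction g w).graph ∧
      ‖v‖ ≤ g * (10 * √M * (fibreConst M ‖κ‖ * (α + K))) * ‖f‖ := by
  have hM : 0 ≤ M := (norm_nonneg _).trans hlam
  have hex := exists_fibre_bound h hR hRK hK hz hκ hκ' hGH.1 hlam hgap hP hMK ha.measurable hα
  obtain ⟨L, hL, hcomp, hb, hb'⟩ := hex
  refine ⟨⟨_, fun r => le_trans ?_ (hb' r)⟩, fun f => ?_⟩
  · rw [hcomp]
    refine mul_le_mul_of_nonneg_right ?_ (norm_nonneg _)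
    push_cast
    linarith
  · have hB : IsFibre fun r => besselOp 2 zero_le_two ∘L L r :=
      ha.isFibre_diag.congr hcomp
    have h1 := interaction_fibre_bound hμ hδ₀ hM hGH.2 hL hB ((norm_nonneg _).trans (hb 0)) hb hb'
      hg f
    exact exists_mem_graph_fibreOp_congr hcomp hB ha.isFibre_diag h1

end Bounds

/-! ### The smoothed projections -/

section Projections

variable {d : ℕ} {P : Particle →L[ℂ] Particle} {χ : ℝ → ℝ} {ρ : ℝ}

theorem mem_graph_feshPi (hp : IsDiag P (fun r : ℝ≥0 => ((χ (r / ρ) : ℝ) : ℂ)) fun _ => 0)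
    (u v : Fock d Particle) : (u, v) ∈ (feshPi d P χ ρ).graph ↔ v = diagOp d hp u := by
  refine mem_graph_decomposable_diag hp (fun n k x => ?_) u v
  rw [coe_photonEnergyNN]
  exact (add_zero _).symm

theorem mem_graph_feshPiBar
    (hq : IsDiag P (fun r : ℝ≥0 => ((√(1 - χ (r / ρ) ^ 2) : ℝ) : ℂ)) fun _ => 1 - P)
    (u v : Fock d Particle) : (u, v) ∈ (feshPiBar d P χ ρ).graph ↔ v = diagOp d hq u := by
  refine mem_graph_decomposable_diag hq (fun n k x => ?_) u v
  rw [coe_photonEnergyNN]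
  rfl

theorem mem_topologicalClosure_range {H : Type*} [NormedAddCommGroup H] [NormedSpace ℂ H]
    {A : H →ₗ.[ℂ] H} {q : H →L[ℂ] H} (h : ∀ u v, (u, v) ∈ A.graph ↔ v = q u) (u : H) :
    u ∈ (LinearMap.range A.toFun).topologicalClosure ↔ u ∈ closure (Set.range q) := by
  have h1 : (LinearMap.range A.toFun : Set H) = Set.range q := by
    ext v
    constructor
    · rintro ⟨x, rfl⟩
      exact ⟨x, ((h _ _).1 (LinearPMap.mem_graph A x)).symm⟩
    · rintro ⟨x, rfl⟩
      obtain ⟨h2, h3⟩ := mem_graph_iff_exists.1 ((h x _).2 rfl)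
      exact ⟨⟨x, h2⟩, h3⟩
  rw [← SetLike.mem_coe, Submodule.topologicalClosure_coe, h1]

theorem mem_feshRange (hP : ∀ x, P (P x) = P x) (hχ : IsCutoff χ) {ι : ℝ≥0 → ℂ}
    (hι : ∀ r : ℝ≥0, ι r = if √(1 - χ (r / ρ) ^ 2) = 0 then 0 else 1)
    (hq : IsDiag P (fun r : ℝ≥0 => ((√(1 - χ (r / ρ) ^ 2) : ℝ) : ℂ)) fun _ => 1 - P)
    (hy : IsDiag P ι fun _ => 1 - P) (u : Fock d Particle) :
    u ∈ feshRange d P χ ρ ↔ diagOp d hy u = u := by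
  have hm : Measurable fun r : ℝ≥0 => √(1 - χ (r / ρ) ^ 2) := by
    have := hχ.1.continuous
    exact Continuous.measurable (by fun_prop)
  exact (mem_topologicalClosure_range (mem_graph_feshPiBar hq) u).trans
    (mem_closure_range_diagOp hP (fun _ => rfl) (fun r => IsCutoff.abs_sqrt_le _) hm hι hq hy u)

end Projections

/-! ### The Feshbach data of a generalized particle-field Hamiltonian -/

/-- The coupling constants below which the Feshbach-Schur map is defined. -/
def couplingThreshold (κ : ℂ) (M : ℝ) : ℝ :=
  (1 + (1 + 2 * M) * (10 * √M * (fibreConst M ‖κ‖ * (7 * (M + 1) + 2))) * (1 + 2 * M))⁻¹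

theorem fibreConst_nonneg {M n : ℝ} (hM : 0 ≤ M) (hn : 0 ≤ n) : 0 ≤ fibreConst M n := by
  unfold fibreConst
  positivity

theorem couplingThreshold_pos (κ : ℂ) {M : ℝ} (hM : 0 ≤ M) : 0 < couplingThreshold κ M := by
  have := fibreConst_nonneg hM (norm_nonneg κ)
  unfold couplingThreshold
  positivity

/-- Here `1 + 2M` bounds `π̄`, while `7(M + 1)/ρ` and `2/ρ` bound the resolvent on `Ran P` and `ker
P`. Everything scales like `1/ρ`, so the product is `(g/ρ) X ≤ X/(1 + X) < 1`. -/
theorem coupling_small {κ : ℂ} {M g ρ : ℝ} (hM : 0 ≤ M) (hρ : 0 < ρ)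
    (hg : g ≤ couplingThreshold κ M * ρ) :
    (1 + 2 * M) * (g * (10 * √M * (fibreConst M ‖κ‖ * (7 * (M + 1) / ρ + 2 / ρ)))) * (1 + 2 * M)
      < 1 := by
  have h0 := fibreConst_nonneg hM (norm_nonneg κ)
  unfold couplingThreshold at hg
  set X := (1 + 2 * M) * (10 * √M * (fibreConst M ‖κ‖ * (7 * (M + 1) + 2))) * (1 + 2 * M) with hX
  have hX0 : 0 ≤ X := by positivity
  have h1 : (1 + 2 * M) * (g * (10 * √M * (fibreConst M ‖κ‖ * (7 * (M + 1) / ρ + 2 / ρ)))) *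
      (1 + 2 * M) = g / ρ * X := by
    rw [hX]
    field_simp
  have h2 : g / ρ ≤ (1 + X)⁻¹ := (div_le_iff₀ hρ).2 hg
  rw [h1]
  refine (mul_le_mul_of_nonneg_right h2 hX0).trans_lt ?_
  rw [inv_mul_eq_div, div_lt_one (by positivity)]
  linarith

theorem mul_one_add_smul_comm {H : Type*} [NormedAddCommGroup H] [NormedSpace ℂ H]
    {L G : H →L[ℂ] H} (h : L * G = G * L) (c : ℂ) :
    L * (1 + c • G) = (1 + c • G) * L := by
  rw [mul_add, add_mul, mul_one, one_mul, mul_smul_comm, smul_mul_assoc, h]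

section Data

variable {d : ℕ} {κ lam ζ : ℂ} {V : Pos → ℂ} {P : Particle →L[ℂ] Particle} {ψ : Particle}
  {M μ δ₀ g ρ : ℝ} {w : ∀ m n, Coupling d m n} {χ : ℝ → ℝ}

-- All analytic hypotheses are used up here: the spectral assumptions give the fibres of `G`, `τ`
-- and `t`, the coupling bounds give `W`, and the smallness of `g/ρ` gives `s`. What remains
-- afterwards is algebra.
set_option maxHeartbeats 400000 in
theorem exists_isRepresented (hκ : κ ≠ 0) (hκ' : 0 ≤ κ.re) (hμ : 0 ≤ μ) (hδ₀ : 0 < δ₀)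
    (hχ : IsCutoff χ) (hGH : IsGH μ δ₀ M κ V w)
    (h : IsSimpleSpectralProjection (particleHam κ V) lam P ψ)
    (hgap : 0 < gap (particleHam κ V) lam) (hgapM : gap (particleHam κ V) lam ≤ M)
    (hlam : ‖lam‖ ≤ M) (hPM : ‖P‖ ≤ M) (hρ : 0 < ρ)
    (hρκ : ENNReal.ofReal ρ ≤ kappaParam (particleHam κ V) lam P δ₀) (hg : 0 ≤ g)
    (hgρ : g ≤ couplingThreshold κ M * ρ) (hζ : ζ ∈ regionQ (particleHam κ V) lam)
    (hζρ : (ζ - lam).re ≤ ρ / 2) :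
    ∃ G p q y τ W t s : Fock d Particle →L[ℂ] Fock d Particle,
      IsRepresented (unperturbedHam d κ V) (interaction g w) (feshPi d P χ ρ) (feshPiBar d P χ ρ)
        (feshRange d P χ ρ) ζ G p q y τ W ∧
      FeshbachData p q y τ W t s ∧
      fibreOp d _ (IsFibre.const P) * p = p ∧ p * fibreOp d _ (IsFibre.const P) = p ∧
      fibreOp d _ (IsFibre.const P) * G = G * fibreOp d _ (IsFibre.const P) ∧
      fibreOp d _ (IsFibre.const P) * τ = τ * fibreOp d _ (IsFibre.const P) := by
  have hM : 0 ≤ M := (norm_nonneg _).trans hlam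
  have hP := h.idem
  have hK := hasReducedBound_of_kappaParam hδ₀ hρ hρκ
  have hK0 : 0 ≤ 2 / ρ := by positivity
  have hρM := le_of_gap h hρ hgap hgapM hK
  have hR := exists_reducedResolvents h hgap hK0 hK
  obtain ⟨R, hR⟩ := hR
  have hRK : ∀ ζ ∈ regionQ (particleHam κ V) lam, ‖R ζ‖ ≤ 2 / ρ := fun ζ hζ =>
    (hR ζ hζ).opNorm_le (hK ζ hζ) hK0
  have hMK : 1 ≤ (M + 1) * (2 / ρ) := by
    rw [← mul_div_assoc, le_div_iff₀ hρ]
    linarith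
  -- The base point `z = lam - 1` lies in `Q_j`, and `lam - (z - r) = 1 + r` never vanishes, so the
  -- free resolvent exists at every photon energy.
  have hz : lam - ((1 : ℝ) : ℂ) ∈ regionQ (particleHam κ V) lam :=
    sub_mem_regionQ (self_mem_regionQ hgap.le) zero_le_one
  have hD : ∀ r : ℝ≥0, lam - (lam - ((1 : ℝ) : ℂ) - (r : ℝ)) = ((1 + r : ℝ) : ℂ) := fun r => by
    push_cast
    ring
  have hpos : ∀ r : ℝ≥0, (0 : ℝ) < 1 + r := fun r => by positivity
  have hne : ∀ r : ℝ≥0, lam - (lam - ((1 : ℝ) : ℂ) - (r : ℝ)) ≠ 0 := fun r => by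
    rw [hD]
    exact Complex.ofReal_ne_zero.2 (hpos r).ne'
  have hcm : Measurable fun r : ℝ≥0 => √(1 - χ (r / ρ) ^ 2) := by
    have := hχ.1.continuous
    exact Continuous.measurable (by fun_prop)
  have hχm : Measurable fun r : ℝ≥0 => χ (r / ρ) := by
    have := hχ.1.continuous
    exact Continuous.measurable (by fun_prop)
  have hrm : Measurable fun r : ℝ≥0 => ((r : ℝ) : ℂ) :=
    Complex.measurable_ofReal.comp measurable_coe_nnreal_real
  have hιe : ∃ ι : ℝ≥0 → ℂ, (∀ r, ι r = if √(1 - χ (r / ρ) ^ 2) = 0 then 0 else 1) ∧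
      Measurable ι := ⟨_, fun _ => rfl,
    Measurable.ite (hcm (measurableSet_singleton 0)) measurable_const measurable_const⟩
  obtain ⟨ι, hι, hιm⟩ := hιe
  have hae : ∃ a : ℝ≥0 → ℂ, (∀ r : ℝ≥0, a r = (lam - (lam - ((1 : ℝ) : ℂ) - (r : ℝ)))⁻¹) ∧
      Measurable a := ⟨_, fun _ => rfl, ((hrm.const_sub _).const_sub _).inv⟩
  obtain ⟨a, ha, ham⟩ := hae
  have hbe : ∃ b : ℝ≥0 → ℂ, (∀ r : ℝ≥0, b r = ι r * (lam - (ζ - (r : ℝ)))⁻¹) ∧ Measurable b :=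
    ⟨_, fun _ => rfl, hιm.mul ((hrm.const_sub _).const_sub _).inv⟩
  obtain ⟨b, hb, hbm⟩ := hbe
  -- The left side equals `1`; the bound `ρ ≤ 2(M + 1)` puts it below the constant needed at `ζ`, so
  -- one `α` serves both resolvents.
  have haα : ∀ r : ℝ≥0, (1 + (r : ℝ)) * ‖a r‖ ≤ 7 * (M + 1) / ρ := fun r => by
    rw [ha, hD, norm_inv, Complex.norm_real, Real.norm_of_nonneg (hpos r).le,
      mul_inv_cancel₀ (hpos r).ne', le_div_iff₀ hρ]
    linarith
  have hbα : ∀ r : ℝ≥0, (1 + (r : ℝ)) * ‖b r‖ ≤ 7 * (M + 1) / ρ := fun r => by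
    by_cases h1 : √(1 - χ (r / ρ) ^ 2) = 0
    · rw [hb, hι, if_pos h1, zero_mul, norm_zero, mul_zero]
      positivity
    · rw [hb, hι, if_neg h1, one_mul]
      exact (hχ.norm_inv_le hρ hM hρM hζρ r h1).2
  have hbdd : ∀ {a : ℝ≥0 → ℂ}, (∀ r : ℝ≥0, (1 + (r : ℝ)) * ‖a r‖ ≤ 7 * (M + 1) / ρ) →
      ∃ C, ∀ r, ‖a r‖ ≤ C := fun h1 =>
    ⟨_, fun r => (le_mul_of_one_le_left (norm_nonneg _) (by simp)).trans (h1 r)⟩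
  have hG : IsDiag P a fun r : ℝ≥0 => R (lam - ((1 : ℝ) : ℂ) - (r : ℝ)) :=
    isDiag_reducedResolvent h hR hRK hK0 hz ham (hbdd haα)
  have hG' : IsDiag P b fun r : ℝ≥0 => R (ζ - (r : ℝ)) :=
    isDiag_reducedResolvent h hR hRK hK0 hζ hbm (hbdd hbα)
  have hp : IsDiag P (fun r : ℝ≥0 => ((χ (r / ρ) : ℝ) : ℂ)) fun _ => 0 :=
    IsDiag.zero (Complex.measurable_ofReal.comp hχm) ⟨1, fun r => by
      rw [Complex.norm_real, Real.norm_of_nonneg (hχ.2.1 _).1]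
      exact (hχ.2.1 _).2⟩
  have hc1 : ∀ r : ℝ≥0, ‖((√(1 - χ (r / ρ) ^ 2) : ℝ) : ℂ)‖ ≤ 1 := fun r => by
    rw [Complex.norm_real]
    exact IsCutoff.abs_sqrt_le _
  have hq : IsDiag P (fun r : ℝ≥0 => ((√(1 - χ (r / ρ) ^ 2) : ℝ) : ℂ)) fun _ => 1 - P :=
    IsDiag.one_sub hP (Complex.measurable_ofReal.comp hcm) ⟨1, hc1⟩
  have hy : IsDiag P ι fun _ => 1 - P := IsDiag.one_sub hP hιm ⟨1, fun r => by
    rw [hι]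
    split_ifs <;> simp⟩
  have hRz := fun r : ℝ≥0 => hR _ (sub_mem_regionQ hz r.2)
  have hRζ := fun r : ℝ≥0 => hR _ (sub_mem_regionQ hζ r.2)
  have hbG := diagOp_interaction_bound (d := d) (g := g) h hR hRK hK0 hz hκ hκ' hGH hμ hδ₀.le hg
    hlam hgapM hPM hMK hG haα
  have hbR := diagOp_interaction_bound (d := d) (g := g) h hR hRK hK0 hζ hκ hκ' hGH hμ hδ₀.le hg
    hlam hgapM hPM hMK hG' hbα
  have hex := exists_diagOp_inverse (d := d) (χ := fun r : ℝ≥0 => χ (r / ρ)) h hRz hRζ hG hG'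
    ha hne hb hι (fun r h1 => (hχ.norm_inv_le hρ hM hρM hζρ r h1).1)
    (fun r => hχ.sq_add_sq _) hp hq hy
  obtain ⟨t, hGt, hqt, ht⟩ := hex
  have hW := exists_clm_of_graph _ _ _ hbG.2
  obtain ⟨W, hW⟩ := hW
  -- `G t` is the resolvent at `ζ` on `Ran π̄`, so `W t` is the interaction applied after it.
  have hWt : ∀ f, ‖W (t f)‖ ≤
      g * (10 * √M * (fibreConst M ‖κ‖ * (7 * (M + 1) / ρ + 2 / ρ))) * ‖f‖ := by
    intro f
    have h1 := hbR.2 f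
    obtain ⟨v, h2, h3⟩ := h1
    have h4 : W (t f) = v :=
      LinearPMap.mem_graph_snd_inj _ (hW (t f)) h2 (DFunLike.congr_fun hGt f)
    exact (congrArg norm h4).trans_le h3
  have hqn : ‖diagOp d hq‖ ≤ 1 + 2 * M := by
    refine norm_fibreOp_le hq.isFibre_diag (by positivity) fun r => ?_
    refine (norm_add_le _ _).trans ?_
    have h1 : ‖((√(1 - χ (r / ρ) ^ 2) : ℝ) : ℂ) • P‖ ≤ 1 * M := by
      rw [norm_smul]
      exact mul_le_mul (hc1 r) hPM (norm_nonneg _) zero_le_one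
    have h2 : ‖(1 : Particle →L[ℂ] Particle) - P‖ ≤ 1 + M :=
      (norm_sub_le _ _).trans (add_le_add ContinuousLinearMap.norm_id_le hPM)
    linarith
  have hf0 := fibreConst_nonneg hM (norm_nonneg κ)
  have hs := ht W (isUnit_one_add_of_bound (by positivity) (by positivity) hqn hqt hWt
    (coupling_small hM hρ hgρ))
  obtain ⟨s, hs⟩ := hs
  have hham := diagOp_resolvent_ham (d := d) h hRz hG ha hne hbG.1
  have hLG := fibreOp_const_mul_comm (d := d) hP hG
  have hLp := fibreOp_const_mul (d := d) hP hp
  refine ⟨diagOp d hG, diagOp d hp, diagOp d hq, diagOp d hy, _, W, t, s,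
    ⟨injective_of_resolvent hham, mem_graph_shift_of_resolvent hham ζ, hW, mem_graph_feshPi hp,
      mem_graph_feshPiBar hq, mem_feshRange hP hχ hι hq hy,
      diagOp_mul_comm hP hG hp fun r x => by simp,
      diagOp_mul_comm_one_sub hP hG hq, diagOp_mul_comm_one_sub hP hG hy⟩, hs, hLp,
    (fibreOp_const_mul_comm hP hp).symm.trans hLp, hLG, mul_one_add_smul_comm hLG _⟩

end Data

/-! ### The restriction to the range of the spectral projection -/

section Restriction

variable {d : ℕ} {E : Type*} [NormedAddCommGroup E] [NormedSpace ℂ E] {P : E →L[ℂ] E} {ψ : E}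
  {A : E →ₗ.[ℂ] E} {lam : ℂ}

/-- Hahn-Banach gives a functional with value `1` at `ψ`; composed with `P` it becomes the
coordinate along `ψ`. -/
theorem IsSimpleSpectralProjection.exists_coordinate (h : IsSimpleSpectralProjection A lam P ψ) :
    ∃ ℓ : E →L[ℂ] ℂ, ℓ ψ = 1 ∧ ∀ u, ℓ u • ψ = P u := by
  obtain ⟨φ, hφ⟩ := SeparatingDual.exists_eq_one (R := ℂ) h.2.1
  have hspan : ∀ u, ∃ c : ℂ, c • ψ = P u := fun u => by
    have h1 : P u ∈ LinearMap.range (P : E →ₗ[ℂ] E) := ⟨u, rfl⟩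
    rw [h.2.2.1] at h1
    exact Submodule.mem_span_singleton.1 h1
  have hψ : P ψ = ψ := by
    have h1 : ψ ∈ LinearMap.range (P : E →ₗ[ℂ] E) := by
      rw [h.2.2.1]
      exact Submodule.mem_span_singleton_self ψ
    obtain ⟨u, hu⟩ := h1
    rw [← hu]
    exact h.idem u
  refine ⟨φ ∘L P, ?_, fun u => ?_⟩
  · rw [ContinuousLinearMap.comp_apply, hψ, hφ]
  · obtain ⟨c, hc⟩ := hspan u
    rw [ContinuousLinearMap.comp_apply, ← hc, map_smul, hφ, smul_eq_mul, mul_one]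

variable {ℓ : E →L[ℂ] ℂ}

theorem fibreOp_coordinate_embedding (hψ : ℓ ψ = 1) (x : Fock d ℂ) :
    fibreOp d _ (IsFibre.const ℓ)
      (fibreOp d _ (IsFibre.const (ContinuousLinearMap.toSpanSingleton ℂ ψ)) x) = x := by
  have h1 := fibreOp_comp (d := d) (IsFibre.const ℓ)
    (IsFibre.const (ContinuousLinearMap.toSpanSingleton ℂ ψ))
    (IsFibre.const (1 : ℂ →L[ℂ] ℂ)) fun r => by
      ext
      simp [hψ]
  rw [fibreOp_one _ fun r => rfl] at h1
  exact DFunLike.congr_fun h1 x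

/-- Dilations commute with operators acting on the particle alone, so the projection `P ⊗ 1`
survives the rescaling unchanged. -/
theorem dilation_fibreOp_embedding (hℓ : ∀ u, ℓ u • ψ = P u) (θ : ℝ) (u : Fock d E) :
    dilation d E (-θ) (fibreOp d _ (IsFibre.const (ContinuousLinearMap.toSpanSingleton ℂ ψ))
      (fibreOp d _ (IsFibre.const ℓ) (dilation d E θ u))) = fibreOp d _ (IsFibre.const P) u := by
  have h1 := fibreOp_comp (d := d) (IsFibre.const (ContinuousLinearMap.toSpanSingleton ℂ ψ))
    (IsFibre.const ℓ) (IsFibre.const P) fun r => by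
      ext u
      simp [hℓ]
  have h2 := DFunLike.congr_fun h1 (dilation d E θ u)
  rw [ContinuousLinearMap.comp_apply] at h2
  rw [h2, dilation_fibreOp_const, dilation_neg_apply]

theorem mem_graph_tensorLeft {ψ : Particle} (x : Fock d ℂ) (v : Fock d Particle) :
    (x, v) ∈ (tensorLeft d ψ).graph ↔
      v = fibreOp d _ (IsFibre.const (ContinuousLinearMap.toSpanSingleton ℂ ψ)) x :=
  mem_graph_decomposable_toPMap (IsFibre.const (ContinuousLinearMap.toSpanSingleton ℂ ψ))
    fun _ _ _ => rfl

end Restriction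

/-! ### Isospectrality of `H_g` and `H_{λj}`. -/

theorem isospectral_of_isRepresented {d : ℕ} {H₀ I : Fock d Particle →ₗ.[ℂ] Fock d Particle}
    {A : Particle →ₗ.[ℂ] Particle} {lam ζ : ℂ} {P : Particle →L[ℂ] Particle} {ψ : Particle}
    {ρ : ℝ} {χ : ℝ → ℝ} {G p q y τ W t s : Fock d Particle →L[ℂ] Fock d Particle}
    (h : IsSimpleSpectralProjection A lam P ψ) (hρ : 0 < ρ)
    (hrep : IsRepresented H₀ I (feshPi d P χ ρ) (feshPiBar d P χ ρ) (feshRange d P χ ρ) ζ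
      G p q y τ W)
    (hd : FeshbachData p q y τ W t s)
    (hLp : fibreOp d _ (IsFibre.const P) * p = p) (hpL : p * fibreOp d _ (IsFibre.const P) = p)
    (hLG : fibreOp d _ (IsFibre.const P) * G = G * fibreOp d _ (IsFibre.const P))
    (hLτ : fibreOp d _ (IsFibre.const P) * τ = τ * fibreOp d _ (IsFibre.const P)) :
    InFeshDomain H₀ I P χ ρ ζ ∧
      (ζ ∈ opSpectrum (H₀ + I) ↔ 0 ∈ opSpectrum (effectiveHam H₀ I P ψ χ ρ ζ)) ∧
      (ζ ∈ pointSpectrum (H₀ + I) ↔ 0 ∈ pointSpectrum (effectiveHam H₀ I P ψ χ ρ ζ)) ∧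
      (ζ ∈ essSpectrum (H₀ + I) ↔ 0 ∈ essSpectrum (effectiveHam H₀ I P ψ χ ρ ζ)) := by
  have hcoord := h.exists_coordinate
  obtain ⟨ℓ, hℓψ, hℓ⟩ := hcoord
  have hc : ((ρ⁻¹ : ℝ) : ℂ) ≠ 0 := Complex.ofReal_ne_zero.2 (inv_ne_zero hρ.ne')
  refine ⟨hrep.bddInvertibleOn hd, ?_⟩
  refine spectra_iff_of_feshbach (H₀ := H₀) (I := I) (c := ((ρ⁻¹ : ℝ) : ℂ)) hrep hd hc
    (D := photonDilation d Particle (-Real.log ρ))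
    (D' := (photonDilation d Particle (-Real.log ρ)).inverse) (T := tensorLeft d ψ)
    (F := feshbachMap H₀ I P χ ρ ζ)
    (fun u v => mem_graph_photonDilation_iff) (fun u v => mem_graph_photonDilation_inverse)
    mem_graph_tensorLeft (fibreOp_coordinate_embedding hℓψ)
    (fun u => dilation_apply_neg _ u) (fun u => dilation_neg_apply _ u)
    (dilation_fibreOp_embedding hℓ _) hLp hpL hLG hLτ rfl rfl

theorem feshbach_isospectral {d : ℕ} {κ lam ζ : ℂ} {V : Pos → ℂ} {P : Particle →L[ℂ] Particle}
    {ψ : Particle} {M μ δ₀ g ρ : ℝ} {w : ∀ m n, Coupling d m n} {χ : ℝ → ℝ}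
    (hκ : κ ≠ 0) (hκ' : 0 ≤ κ.re) (hμ : 0 ≤ μ) (hδ₀ : 0 < δ₀)
    (hχ : IsCutoff χ) (hGH : IsGH μ δ₀ M κ V w)
    (h : IsSimpleSpectralProjection (particleHam κ V) lam P ψ)
    (hgap : 0 < gap (particleHam κ V) lam) (hgapM : gap (particleHam κ V) lam ≤ M)
    (hlam : ‖lam‖ ≤ M) (hPM : ‖P‖ ≤ M) (hρ : 0 < ρ)
    (hρκ : ENNReal.ofReal ρ ≤ kappaParam (particleHam κ V) lam P δ₀) (hg : 0 ≤ g)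
    (hgρ : g ≤ couplingThreshold κ M * ρ) (hζ : ζ ∈ regionQ (particleHam κ V) lam)
    (hζρ : (ζ - lam).re ≤ ρ / 2) :
    InFeshDomain (unperturbedHam d κ V) (interaction g w) P χ ρ ζ ∧
      (ζ ∈ opSpectrum (hamiltonian κ V g w) ↔ 0 ∈ opSpectrum
        (effectiveHam (unperturbedHam d κ V) (interaction g w) P ψ χ ρ ζ)) ∧
      (ζ ∈ pointSpectrum (hamiltonian κ V g w) ↔ 0 ∈ pointSpectrum
        (effectiveHam (unperturbedHam d κ V) (interaction g w) P ψ χ ρ ζ)) ∧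
      (ζ ∈ essSpectrum (hamiltonian κ V g w) ↔ 0 ∈ essSpectrum
        (effectiveHam (unperturbedHam d κ V) (interaction g w) P ψ χ ρ ζ)) := by
  have hex := exists_isRepresented (d := d) hκ hκ' hμ hδ₀ hχ hGH h hgap hgapM hlam hPM hρ hρκ hg
    hgρ hζ hζρ
  exact hex.elim fun G hex => hex.elim fun p hex => hex.elim fun q hex => hex.elim fun y hex =>
    hex.elim fun τ hex => hex.elim fun W hex => hex.elim fun t hex => hex.elim fun s hex =>
    isospectral_of_isRepresented h hρ hex.1 hex.2.1 hex.2.2.1 hex.2.2.2.1 hex.2.2.2.2.1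
      hex.2.2.2.2.2

end ParticleField

end

theorem mainTheorem8 (d : ℕ) (hd : 1 ≤ d) (κ : ℂ) (hκ : κ ≠ 0) (hκ' : 0 ≤ κ.re)
    (μ δ₀ M : ℝ) (hμ : 0 ≤ μ) (hδ₀ : 0 < δ₀) :
    ∃ c : ℝ, 0 < c ∧
      ∀ (χ : ℝ → ℝ) (V : ParticleField.Pos → ℂ) (w : ∀ m n, ParticleField.Coupling d m n)
        (lam : ℂ) (P : ParticleField.Particle →L[ℂ] ParticleField.Particle)
        (ψ : ParticleField.Particle) (g ρ : ℝ),
        ParticleField.IsCutoff χ →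
        ParticleField.IsGH μ δ₀ M κ V w →
        ParticleField.IsSimpleSpectralProjection (ParticleField.particleHam κ V) lam P ψ →
        0 < ParticleField.gap (ParticleField.particleHam κ V) lam →
        ParticleField.gap (ParticleField.particleHam κ V) lam ≤ M →
        ‖lam‖ ≤ M → ‖P‖ ≤ M →
        0 < ρ →
        ENNReal.ofReal ρ ≤
          ParticleField.kappaParam (ParticleField.particleHam κ V) lam P δ₀ →
        0 < g → g ≤ c * ρ →
        ∀ ζ ∈ ParticleField.regionQ (ParticleField.particleHam κ V) lam,
          (ζ - lam).re ≤ ρ / 2 →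
          ParticleField.InFeshDomain (ParticleField.unperturbedHam d κ V)
            (ParticleField.interaction g w) P χ ρ ζ ∧
          (ζ ∈ ParticleField.opSpectrum (ParticleField.hamiltonian κ V g w) ↔
            0 ∈ ParticleField.opSpectrum (ParticleField.effectiveHam
              (ParticleField.unperturbedHam d κ V) (ParticleField.interaction g w) P ψ χ ρ ζ)) ∧
          (ζ ∈ ParticleField.pointSpectrum (ParticleField.hamiltonian κ V g w) ↔
            0 ∈ ParticleField.pointSpectrum (ParticleField.effectiveHam
              (ParticleField.unperturbedHam d κ V) (ParticleField.interaction g w) P ψ χ ρ ζ)) ∧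
          (ζ ∈ ParticleField.essSpectrum (ParticleField.hamiltonian κ V g w) ↔
            0 ∈ ParticleField.essSpectrum (ParticleField.effectiveHam
              (ParticleField.unperturbedHam d κ V) (ParticleField.interaction g w) P ψ χ ρ ζ)) := by
  -- The constant is chosen before any data, when the sign of `M` is still unknown; given data,
  -- `‖lam‖ ≤ M` forces `M ≥ 0` and `|M| = M`.
  refine ⟨ParticleField.couplingThreshold κ |M|,
    ParticleField.couplingThreshold_pos κ (abs_nonneg M), ?_⟩
  intro χ V w lam P ψ g ρ hχ hGH h hgap hgapM hlam hPM hρ hρκ hg hgρ ζ hζ hζρ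
  rw [abs_of_nonneg ((norm_nonneg lam).trans hlam)] at hgρ
  exact ParticleField.feshbach_isospectral hκ hκ' hμ hδ₀ hχ hGH h hgap hgapM hlam hPM hρ hρκ hg.le
    hgρ hζ hζρ
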